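/- All graphs are simple, and "contains" means "contains as an induced subgraph". An odd hole is a chordless cycle of odd length at least $4$. A prism is a graph consisting of two vertex-disjoint triangles $\{a_1,a_2,a_3\}$, $\{b_1,b_2,b_3\}$ and three vertex-disjoint paths $P_1,P_2,P_3$, with $P_i$ from $a_i$ to $b_i$, and with no other edges than those of the two triangles and the three paths; it is odd (even) if all three paths have odd (even) length. A subdivision of $K_4$ is obtained by replacing the edges of $K_4$ by internally disjoint paths of length at least $1$; it is proper if at least one of these paths has length at least $2$. (1) There is an algorithm which, given the adjacency matrix of a graph $G$ on $n$ vertices that contains no odd hole, runs in time $O(n^{20})$ (on a random access machine with unit-cost operations on words of $O(\log n)$ bits), decides whether $G$ contains an odd prism, and, if it does, returns the vertex set of an induced odd prism of $G$. (2) If $R$ is a bipartite subdivision of $K_4$, then the line graph of $R$ contains an odd prism. (3) Let $G$ be a graph that contains no odd hole and no line graph of a proper subdivision of $K_4$. Let $H$ be a prism in $G$ formed by paths $P_1,P_2,P_3$, with triangles $\{a_1,a_2,a_3\}$ and $\{b_1,b_2,b_3\}$, where $P_i$ is from $a_i$ to $b_i$. Let $i\in\{1,2,3\}$ and let $P$ be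 any chordless path of $G$ from $a_i$ to $b_i$ none of whose interior vertices is adjacent to $a_j$ or $b_j$ for any $j\neq i$. Then the paths obtained from $P_1,P_2,P_3$ by replacing $P_i$ with $P$ form a prism of $G$ of the same parity as $H$ (both prisms are odd or both are even). -/

import Mathlib

/-! ### Odd holes and prisms -/

section Graphs

variable {V : Type*}

/-- `G` contains an odd hole: an induced cycle of odd length at least four. -/
def HasOddHole (G : SimpleGraph V) : Prop :=
  ∃ m : ℕ, 4 ≤ m ∧ Odd m ∧ (SimpleGraph.cycleGraph m).IsIndContained G

/-- The three paths `P i`, from `a i` to `b i`, form a prism of `G` (as an induced subgraph) with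
triangles `{a 0, a 1, a 2}` and `{b 0, b 1, b 2}`: the two triangles are disjoint, the three paths
are disjoint, and the edges of `G` between vertices of the paths are exactly the edges of the
paths and those of the two triangles. -/
structure FormsPrism (G : SimpleGraph V) (a b : Fin 3 → V)
    (P : ∀ i : Fin 3, G.Walk (a i) (b i)) : Prop where
  isPath : ∀ i, (P i).IsPath
  triangles_disjoint : ∀ i j, a i ≠ b j
  paths_disjoint : ∀ i j, i ≠ j → ∀ x ∈ (P i).support, x ∉ (P j).support
  adj_iff : ∀ i j, ∀ x ∈ (P i).support, ∀ y ∈ (P j).support,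
    (G.Adj x y ↔ (i = j ∧ s(x, y) ∈ (P i).edges) ∨
      (i ≠ j ∧ ((x = a i ∧ y = a j) ∨ (x = b i ∧ y = b j))))

/-- The subgraph of `G` induced by the vertex set `S` is an odd prism: a prism whose three paths
all have odd length. -/
def InducesOddPrism (G : SimpleGraph V) (S : Set V) : Prop :=
  ∃ (a b : Fin 3 → V) (P : ∀ i : Fin 3, G.Walk (a i) (b i)),
    FormsPrism G a b P ∧ (∀ i, Odd (P i).length) ∧ S = {x | ∃ i, x ∈ (P i).support}

/-- `G` contains an odd prism (as an induced subgraph). -/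
def HasOddPrism (G : SimpleGraph V) : Prop :=
  ∃ S : Set V, InducesOddPrism G S

/-! ### Subdivisions of `K₄` and their line graphs -/

/-- The six edges of `K₄`, as ordered pairs of indices. -/
abbrev K4Edge : Type := {e : Fin 4 × Fin 4 // e.1 < e.2}

/-- `R` is the subdivision of `K₄` with (distinct) branch vertices `c 0, …, c 3` in which the edge
`e` of `K₄` is replaced by the path `Q e`: two of these paths meet only in a common end, and
every vertex and every edge of `R` lies on one of them. -/
structure FormsK4Subdivision (R : SimpleGraph V) (c : Fin 4 → V)
    (Q : ∀ e : K4Edge, R.Walk (c e.1.1) (c e.1.2)) : Prop where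
  branch_injective : Function.Injective c
  isPath : ∀ e, (Q e).IsPath
  internally_disjoint : ∀ e f : K4Edge, e ≠ f → ∀ x ∈ (Q e).support, x ∈ (Q f).support →
    (x = c e.1.1 ∨ x = c e.1.2) ∧ (x = c f.1.1 ∨ x = c f.1.2)
  vertex_covered : ∀ x : V, ∃ e, x ∈ (Q e).support
  edge_covered : ∀ x y : V, R.Adj x y → ∃ e, s(x, y) ∈ (Q e).edges

/-- `R` is a subdivision of `K₄`. -/
def IsK4Subdivision (R : SimpleGraph V) : Prop :=
  ∃ (c : Fin 4 → V) (Q : ∀ e : K4Edge, R.Walk (c e.1.1) (c e.1.2)), FormsK4Subdivision R c Q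

/-- `R` is a proper subdivision of `K₄`: at least one edge of `K₄` is actually subdivided. -/
def IsProperK4Subdivision (R : SimpleGraph V) : Prop :=
  ∃ (c : Fin 4 → V) (Q : ∀ e : K4Edge, R.Walk (c e.1.1) (c e.1.2)),
    FormsK4Subdivision R c Q ∧ ∃ e, 2 ≤ (Q e).length

/-- `G` contains, as an induced subgraph, the line graph of a proper subdivision of `K₄`. -/
def HasLineGraphOfProperK4Subdivision (G : SimpleGraph V) : Prop :=
  ∃ (W : Type) (R : SimpleGraph W), IsProperK4Subdivision R ∧ R.lineGraph.IsIndContained G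

end Graphs

/-! ### Random access machine programs with a step count -/

/-- The arithmetic operations of the machine (on natural numbers; subtraction is truncated). -/
inductive RamOp : Type
  | add | sub | mul | div

/-- The value of an arithmetic operation. -/
def RamOp.apply : RamOp → ℕ → ℕ → ℕ
  | .add, x, y => x + y
  | .sub, x, y => x - y
  | .mul, x, y => x * y
  | .div, x, y => x / y

/-- Expressions: constants, registers, memory cells with a computed address, arithmetic. -/
inductive RamExpr : Type
  | lit (k : ℕ)
  | reg (i : ℕ)
  | load (addr : RamExpr)
  | bin (op : RamOp) (e₁ e₂ : RamExpr)

/-- Programs. A test succeeds when the value of its expression is nonzero. -/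
inductive RamProg : Type
  | skip
  | assign (i : ℕ) (e : RamExpr)
  | store (addr e : RamExpr)
  | seq (p q : RamProg)
  | ite (e : RamExpr) (p q : RamProg)
  | loop (e : RamExpr) (p : RamProg)

/-- A state: the contents of the registers and of the memory cells. -/
@[ext] structure RamState : Type where
  reg : ℕ → ℕ
  mem : ℕ → ℕ

/-- The value of an expression in a state. -/
def RamExpr.eval (s : RamState) : RamExpr → ℕ
  | .lit k => k
  | .reg i => s.reg i
  | .load addr => s.mem (addr.eval s)
  | .bin op e₁ e₂ => op.apply (e₁.eval s) (e₂.eval s)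

/-- The number of elementary operations needed to evaluate an expression. -/
def RamExpr.cost : RamExpr → ℕ
  | .lit _ => 1
  | .reg _ => 1
  | .load addr => addr.cost + 1
  | .bin _ e₁ e₂ => e₁.cost + e₂.cost + 1

/-- All the values that occur in the evaluation of an expression fit into a machine word, that is,
are at most `W`. -/
def RamExpr.Fits (W : ℕ) (s : RamState) : RamExpr → Prop
  | .lit k => k ≤ W
  | .reg i => s.reg i ≤ W
  | .load addr => addr.Fits W s ∧ s.mem (addr.eval s) ≤ W
  | .bin op e₁ e₂ => e₁.Fits W s ∧ e₂.Fits W s ∧ op.apply (e₁.eval s) (e₂.eval s) ≤ W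

/-- `RamExec W p s s' t`: started in the state `s`, on a machine whose words hold the numbers up to
`W`, the program `p` halts in the state `s'` after exactly `t` elementary steps. There is no such
execution if some computed value exceeds `W`. -/
inductive RamExec (W : ℕ) : RamProg → RamState → RamState → ℕ → Prop
  | skip (s : RamState) : RamExec W .skip s s 1
  | assign (i : ℕ) (e : RamExpr) (s : RamState) (he : e.Fits W s) :
      RamExec W (.assign i e) s ⟨Function.update s.reg i (e.eval s), s.mem⟩ (e.cost + 1)
  | store (addr e : RamExpr) (s : RamState) (ha : addr.Fits W s) (he : e.Fits W s) :
      RamExec W (.store addr e) s ⟨s.reg, Function.update s.mem (addr.eval s) (e.eval s)⟩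
        (addr.cost + e.cost + 1)
  | seq (p q : RamProg) (s₁ s₂ s₃ : RamState) (t₁ t₂ : ℕ)
      (hp : RamExec W p s₁ s₂ t₁) (hq : RamExec W q s₂ s₃ t₂) :
      RamExec W (.seq p q) s₁ s₃ (t₁ + t₂)
  | ite_true (e : RamExpr) (p q : RamProg) (s s' : RamState) (t : ℕ)
      (he : e.Fits W s) (h : e.eval s ≠ 0) (hp : RamExec W p s s' t) :
      RamExec W (.ite e p q) s s' (e.cost + 1 + t)
  | ite_false (e : RamExpr) (p q : RamProg) (s s' : RamState) (t : ℕ)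
      (he : e.Fits W s) (h : e.eval s = 0) (hq : RamExec W q s s' t) :
      RamExec W (.ite e p q) s s' (e.cost + 1 + t)
  | loop_true (e : RamExpr) (p : RamProg) (s₁ s₂ s₃ : RamState) (t₁ t₂ : ℕ)
      (he : e.Fits W s₁) (h : e.eval s₁ ≠ 0) (hp : RamExec W p s₁ s₂ t₁)
      (hl : RamExec W (.loop e p) s₂ s₃ t₂) :
      RamExec W (.loop e p) s₁ s₃ (e.cost + 1 + t₁ + t₂)
  | loop_false (e : RamExpr) (p : RamProg) (s : RamState)
      (he : e.Fits W s) (h : e.eval s = 0) :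
      RamExec W (.loop e p) s s (e.cost + 1)

open Classical in
/-- The initial state for an input graph `G` on the vertices `0, …, n - 1`: register `0` holds `n`,
the memory cells `0, …, n² - 1` hold the adjacency matrix of `G` row by row, and everything else
is `0`. -/
noncomputable def graphInput {n : ℕ} (G : SimpleGraph (Fin n)) : RamState where
  reg i := if i = 0 then n else 0
  mem x := if ∃ u v : Fin n, x = (u : ℕ) * n + (v : ℕ) ∧ G.Adj u v then 1 else 0

/-- The set of vertices that a final state returns: the memory cells `n², …, n² + n - 1` are read
as its characteristic vector. -/
def returnedSet (n : ℕ) (s : RamState) : Set (Fin n) :=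
  {v | s.mem (n * n + (v : ℕ)) = 1}

/-- The final state `s` is a correct answer to the search for an odd prism in `G`: if `G` contains
an odd prism, then register `0` holds `1` and the returned set induces an odd prism in `G`;
otherwise register `0` holds `0`. -/
def IsOddPrismAnswer {n : ℕ} (G : SimpleGraph (Fin n)) (s : RamState) : Prop :=
  (HasOddPrism G → s.reg 0 = 1 ∧ InducesOddPrism G (returnedSet n s)) ∧
    (¬ HasOddPrism G → s.reg 0 = 0)

/-! Prisms and line graphs of subdivisions of `K₄` are treated uniformly as line graphs of
subdivided multigraphs (`LineModel`): every edge of the multigraph becomes an induced path, and two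
such paths are joined at those ends where the edges share a vertex. Three parallel edges give a
prism (`IsTheta`). A path of length `l` of the subdivision becomes a path with `l` vertices, so a
subdivision of `K₄` is proper when the total number of vertices exceeds 6.

The structural core is that a graph without odd holes has no pyramid: the three holes of a pyramid
cannot all be even. Take a prism and an induced path that avoids the corners, is attached to one
path of the prism and, away from the corners, to the other two. A minimal connecting piece of it
must, at each end, have exactly two extreme attachments that are consecutive; otherwise a pyramid
arises, or, in one case where the piece is a single vertex, a contradiction of parities of holes.
Prism and piece together then form the line graph of a proper subdivision of `K₄`
(`exists_k4_of_connecting`).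

This gives two exchange properties. If there is no line graph of a proper subdivision of `K₄`, then
a path of a prism can be replaced as in (3), since a new path that touched the others would contain
a connecting piece; parity is kept because any two paths of a prism close up to an even hole
(`FormsPrism.update`). In a smallest line graph of a proper subdivision of `K₄`, a path can be
replaced by one that is not longer: otherwise deleting the old path leaves a prism, and a connecting
piece that misses an end of the new path yields a smaller example (`LineModel.update_k4`).

For (2), two of the four branch vertices have the same colour; deleting the path between the other
two leaves a prism all of whose paths have an even number of vertices.

For (1), the line graph of a proper subdivision of `K₄` always yields an odd prism: one of its six
paths has an even number of vertices, and then deleting the opposite path works. The program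
therefore has two phases. The first guesses the 12 ends of the six paths of a smallest such line
graph, the second the 6 corners of an odd prism. In both, the paths are found one after another as
shortest paths that avoid the other marked vertices and their neighbourhoods. By the exchange
properties (`IsClosedClass`) each path found may be substituted into the sought configuration, so
the greedy search cannot fail on a correct guess. Whatever is found is a `LineModel`, which makes
the output sound even if it is not smallest. There are at most `n ^ 12` guesses, and each costs `O(n
^ 3)`.

Conventions of the program: register 0 holds `n`, 1 the number of the guess, 2 the success flag, 3
whether the current guess is still alive, 4 to 6 are loop counters, 7 is a search result, 8 the
vertex at which the tracing of a path stands, and `9 + e` the number of vertices of the path `e`.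
Array 0 is the output, 1 the marks, 2 the levels of the breadth-first search, 3 the vertices it may
enter. -/

section InducedPaths

/-! ### Induced paths as lists, adjacency between two of them, holes and pyramids. -/

variable {V : Type*} (G : SimpleGraph V)

/-- The list `l` is the sequence of vertices of an induced path of `G`. -/
def IndPath : List V → Prop
  | [] => True
  | x :: t => IndPath t ∧ ∀ y ∈ t, x ≠ y ∧ (G.Adj x y ↔ t.head? = some y)

/-- The lists `l` and `m` are disjoint, and the only edges between them join their ends; the four
propositions say which of the pairs head-head, head-last, last-head, last-last are edges. -/
def Cross (l m : List V) (hh hl lh ll : Prop) : Prop :=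
  ∀ x ∈ l, ∀ y ∈ m, x ≠ y ∧ (G.Adj x y ↔
    (hh ∧ l.head? = some x ∧ m.head? = some y) ∨ (hl ∧ l.head? = some x ∧ m.getLast? = some y) ∨
    (lh ∧ l.getLast? = some x ∧ m.head? = some y) ∨
    (ll ∧ l.getLast? = some x ∧ m.getLast? = some y))

variable {G}

theorem Cross.symm {l m : List V} {hh hl lh ll : Prop} (h : Cross G l m hh hl lh ll) :
    Cross G m l hh lh hl ll := by
  intro x hx y hy
  have := h y hy x hx
  refine ⟨this.1.symm, ?_⟩
  rw [G.adj_comm, this.2]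
  grind

theorem cross_reverse_left {l m : List V} {hh hl lh ll : Prop} :
    Cross G l.reverse m hh hl lh ll ↔ Cross G l m lh ll hh hl := by
  simp only [Cross, List.mem_reverse, List.head?_reverse, List.getLast?_reverse]
  refine forall₂_congr fun x _ => forall₂_congr fun y _ => and_congr_right fun _ => ?_
  constructor <;> (intro h; rw [h]; grind)

theorem cross_reverse_right {l m : List V} {hh hl lh ll : Prop} :
    Cross G l m.reverse hh hl lh ll ↔ Cross G l m hl hh ll lh := by
  simp only [Cross, List.mem_reverse, List.head?_reverse, List.getLast?_reverse]
  refine forall₂_congr fun x _ => forall₂_congr fun y _ => and_congr_right fun _ => ?_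
  constructor <;> (intro h; rw [h]; grind)

theorem Cross.disjoint {l m : List V} {hh hl lh ll : Prop} (h : Cross G l m hh hl lh ll) :
    l.Disjoint m := fun x hx hy => (h x hx x hy).1 rfl

/-- Ends are recognised by value, so a vertex of `l₁` that is also the last vertex of `l₂` would
spoil the splitting; hence the disjointness. -/
theorem cross_append_left {l₁ l₂ m : List V} {hh hl lh ll : Prop} (h1 : l₁ ≠ []) (h2 : l₂ ≠ [])
    (hd : l₁.Disjoint l₂) : Cross G (l₁ ++ l₂) m hh hl lh ll ↔
      Cross G l₁ m hh hl False False ∧ Cross G l₂ m False False lh ll := by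
  have e1 : (l₁ ++ l₂).head? = l₁.head? := by
    cases l₁ <;> simp at h1 ⊢
  have e2 : (l₁ ++ l₂).getLast? = l₂.getLast? := by
    rw [List.getLast?_append_of_ne_nil _ h2]
  have k1 : ∀ x ∈ l₁, l₂.getLast? ≠ some x := fun x hx hl =>
    hd hx (List.mem_of_getLast? hl)
  have k2 : ∀ x ∈ l₂, l₁.head? ≠ some x := fun x hx hl =>
    hd (List.mem_of_head? hl) hx
  simp only [Cross, e1, e2, List.mem_append]
  constructor
  · intro h
    exact ⟨fun x hx y hy => by simpa [k1 x hx] using h x (Or.inl hx) y hy,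
      fun x hx y hy => by simpa [k2 x hx] using h x (Or.inr hx) y hy⟩
  · rintro ⟨h, h'⟩ x (hx | hx) y hy
    · simpa [k1 x hx] using h x hx y hy
    · simpa [k2 x hx] using h' x hx y hy

theorem cross_append_right {l₁ l₂ m : List V} {hh hl lh ll : Prop} (h1 : l₁ ≠ []) (h2 : l₂ ≠ [])
    (hd : l₁.Disjoint l₂) : Cross G m (l₁ ++ l₂) hh hl lh ll ↔
      Cross G m l₁ hh False lh False ∧ Cross G m l₂ False hl False ll := by
  constructor
  · intro h
    have := (cross_append_left h1 h2 hd).1 h.symm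
    exact ⟨this.1.symm, this.2.symm⟩
  · intro h
    exact ((cross_append_left h1 h2 hd).2 ⟨h.1.symm, h.2.symm⟩).symm

theorem cross_singleton_left {v : V} {m : List V} {hh hl lh ll : Prop} :
    Cross G [v] m hh hl lh ll ↔ ∀ y ∈ m, v ≠ y ∧
      (G.Adj v y ↔ ((hh ∨ lh) ∧ m.head? = some y) ∨ ((hl ∨ ll) ∧ m.getLast? = some y)) := by
  simp only [Cross, List.mem_singleton, forall_eq, List.head?_cons, List.getLast?_singleton,
    true_and]
  refine forall₂_congr fun y _ => and_congr_right fun _ => ?_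
  constructor <;> (intro h; rw [h]; grind)

theorem cross_nil_left {m : List V} {hh hl lh ll : Prop} : Cross G [] m hh hl lh ll := by
  simp [Cross]

theorem indPath_singleton (x : V) : IndPath G [x] := by simp [IndPath]

theorem indPath_cons {x : V} {t : List V} :
    IndPath G (x :: t) ↔ IndPath G t ∧ ∀ y ∈ t, x ≠ y ∧ (G.Adj x y ↔ t.head? = some y) := Iff.rfl

theorem indPath_append {l m : List V} :
    IndPath G (l ++ m) ↔ IndPath G l ∧ IndPath G m ∧ Cross G l m False False True False := by
  induction l with
  | nil => simp [IndPath, Cross]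
  | cons x t ih =>
    rw [List.cons_append, indPath_cons, ih, indPath_cons]
    by_cases ht : t = []
    · subst ht
      simp [cross_singleton_left, IndPath, cross_nil_left]
    · have e1 : (t ++ m).head? = t.head? := by cases t <;> simp at ht ⊢
      have e2 : ∀ y, (x :: t).getLast? = some y ↔ t.getLast? = some y := by
        intro y
        rw [show x :: t = [x] ++ t from rfl, List.getLast?_append_of_ne_nil _ ht]
      rw [e1]
      simp only [Cross, e2, List.mem_cons, List.mem_append, forall_eq_or_imp]
      constructor
      · rintro ⟨⟨h1, h2, h3⟩, h4⟩
        have hd : ∀ y ∈ m, t.head? ≠ some y := fun y hy hh =>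
          (h3 y (List.mem_of_head? hh) y hy).1 rfl
        have hx : t.getLast? ≠ some x := fun hh =>
          (h4 x (Or.inl (List.mem_of_getLast? hh))).1 rfl
        refine ⟨⟨h1, fun y hy => h4 y (Or.inl hy)⟩, h2, fun y hy => ?_, ?_⟩
        · have := h4 y (Or.inr hy)
          simpa [hd y hy, hx] using this
        · simpa using h3
      · rintro ⟨⟨h1, h2⟩, h3, h4, h5⟩
        have hd : ∀ y ∈ m, t.head? ≠ some y := fun y hy hh =>
          (h5 y (List.mem_of_head? hh) y hy).1 rfl
        have hx : t.getLast? ≠ some x := fun hh =>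
          (h2 x ((List.mem_of_getLast? hh))).1 rfl
        refine ⟨⟨h1, h3, ?_⟩, ?_⟩
        · simpa using h5
        · rintro y (hy | hy)
          · exact h2 y hy
          · simpa [hd y hy, hx] using h4 y hy

theorem IndPath.nodup {l : List V} (h : IndPath G l) : l.Nodup := by
  induction l with
  | nil => simp
  | cons x t ih =>
    rw [List.nodup_cons]
    exact ⟨fun hx => (h.2 x hx).1 rfl, ih h.1⟩

theorem indPath_reverse {l : List V} : IndPath G l.reverse ↔ IndPath G l := by
  induction l with
  | nil => simp
  | cons x t ih =>
    rw [List.reverse_cons, indPath_append, ih, indPath_cons, cross_reverse_left]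
    refine and_congr_right fun _ => ?_
    constructor
    · rintro ⟨_, h⟩
      have := cross_singleton_left.1 h.symm
      simpa using this
    · intro h
      exact ⟨indPath_singleton x, (cross_singleton_left.2 (by simpa using h)).symm⟩

theorem IndPath.left {l m : List V} (h : IndPath G (l ++ m)) : IndPath G l :=
  (indPath_append.1 h).1

theorem IndPath.right {l m : List V} (h : IndPath G (l ++ m)) : IndPath G m :=
  (indPath_append.1 h).2.1

theorem IndPath.infix {l m : List V} (h : IndPath G l) (hm : m <:+: l) : IndPath G m := by
  obtain ⟨s, t, rfl⟩ := hm
  exact h.left.right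

/-- The form by positions, for arguments that count indices: holes, line graphs of walks,
breadth-first levels. -/
theorem indPath_iff_getElem {l : List V} : IndPath G l ↔ l.Nodup ∧
    ∀ i j (hi : i < l.length) (hj : j < l.length), G.Adj l[i] l[j] ↔ i + 1 = j ∨ j + 1 = i := by
  induction l with
  | nil => simp [IndPath]
  | cons x t ih =>
    rw [indPath_cons, ih, List.nodup_cons]
    constructor
    · rintro ⟨⟨h1, h2⟩, h3⟩
      have hx : x ∉ t := fun hx => (h3 x hx).1 rfl
      have key : ∀ j (hj : j < t.length), G.Adj x t[j] ↔ j = 0 := by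
        intro j hj
        rw [(h3 _ (List.getElem_mem hj)).2, List.head?_eq_getElem?,
          List.getElem?_eq_getElem (by omega : 0 < t.length), Option.some_inj,
          h1.getElem_inj_iff, eq_comm]
      refine ⟨⟨hx, h1⟩, ?_⟩
      rintro (_ | i) (_ | j) hi hj
      · simp
      · simpa using key j (by simpa using hj)
      · simpa [G.adj_comm] using key i (by simpa using hi)
      · simpa using h2 i j (by simpa using hi) (by simpa using hj)
    · rintro ⟨⟨hx, h1⟩, h2⟩
      refine ⟨⟨h1, fun i j hi hj => ?_⟩, fun y hy => ⟨fun h => hx (h ▸ hy), ?_⟩⟩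
      · have := h2 (i + 1) (j + 1) (by simpa using hi) (by simpa using hj)
        rw [List.getElem_cons_succ, List.getElem_cons_succ] at this
        rw [this]; omega
      · obtain ⟨j, hj, rfl⟩ := List.mem_iff_getElem.1 hy
        have := h2 0 (j + 1) (by simp) (by simpa using hj)
        rw [List.head?_eq_getElem?,
          List.getElem?_eq_getElem (by omega : 0 < t.length), Option.some_inj,
          h1.getElem_inj_iff]
        simp only [List.getElem_cons_zero, List.getElem_cons_succ] at this
        rw [this]; omega

/-- A vertex together with an induced path whose ends are its only neighbours forms a hole. -/
theorem hasOddHole_of_even {v : V} {t : List V} (ht : IndPath G t)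
    (hv : Cross G [v] t True True True True) (h3 : 3 ≤ t.length) (he : Even t.length) :
    HasOddHole G := by
  have hv' : ∀ y ∈ t, v ≠ y ∧ (G.Adj v y ↔ t.head? = some y ∨ t.getLast? = some y) := by
    simpa using cross_singleton_left.1 hv
  rw [indPath_iff_getElem] at ht
  obtain ⟨hn, hA⟩ := ht
  obtain ⟨k, hk⟩ : ∃ k, t.length = k + 3 := ⟨t.length - 3, by omega⟩
  -- The hole has `v` in position 0 and the vertices of `t` in positions 1 to `k + 3`; its length is
  -- that of `t` plus one, hence odd.
  refine ⟨k + 4, by omega, by rw [hk] at he; grind, ⟨⟨⟨fun i => if h : (i : ℕ) = 0 then v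
    else t[(i : ℕ) - 1]'(by have := i.2; omega), ?_⟩, ?_⟩⟩⟩
  · intro i j hij
    have hi := i.2
    have hj := j.2
    dsimp only at hij
    split_ifs at hij with h1 h2 h2
    · exact Fin.ext (h1.trans h2.symm)
    · exact absurd hij (hv' _ (List.getElem_mem _)).1
    · exact absurd hij.symm (hv' _ (List.getElem_mem _)).1
    · rw [hn.getElem_inj_iff] at hij
      exact Fin.ext (by omega)
  · intro i j
    have hi := i.2
    have hj := j.2
    have key : ∀ j (hj : j < t.length), G.Adj v t[j] ↔ j = 0 ∨ j = k + 2 := by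
      intro j hj
      rw [(hv' _ (List.getElem_mem hj)).2, List.head?_eq_getElem?, List.getLast?_eq_getElem?,
        List.getElem?_eq_getElem (by omega : 0 < t.length),
        List.getElem?_eq_getElem (by omega : t.length - 1 < t.length), Option.some_inj,
        Option.some_inj, hn.getElem_inj_iff, hn.getElem_inj_iff]
      omega
    have hc : (SimpleGraph.cycleGraph (k + 4)).Adj i j ↔ (i : ℕ) + 1 = j ∨ (j : ℕ) + 1 = i ∨
        ((i : ℕ) = 0 ∧ (j : ℕ) = k + 3) ∨ ((j : ℕ) = 0 ∧ (i : ℕ) = k + 3) := by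
      rw [SimpleGraph.cycleGraph_adj']
      simp only [Fin.sub_def]
      have e1 : ∀ a b : ℕ, a < k + 4 → b < k + 4 → ((k + 4 - b + a) % (k + 4) = 1 ↔
          b + 1 = a ∨ (a = 0 ∧ b = k + 3)) := by
        intro a b ha hb
        by_cases hab : b ≤ a
        · rw [show k + 4 - b + a = (a - b) + (k + 4) by omega, Nat.add_mod_right,
            Nat.mod_eq_of_lt (by omega)]
          omega
        · rw [Nat.mod_eq_of_lt (by omega)]
          omega
      rw [e1 _ _ hi hj, e1 _ _ hj hi]
      omega
    change G.Adj (dite _ _ _) (dite _ _ _) ↔ _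
    rw [hc]
    split_ifs with h1 h2 h2
    · simp; omega
    · rw [key]; omega
    · rw [G.adj_comm, key]; omega
    · rw [hA]; omega

theorem odd_length_of_hole (hG : ¬ HasOddHole G) {v : V} {t : List V} (ht : IndPath G t)
    (hv : Cross G [v] t True True True True) (h3 : 3 ≤ t.length) : Odd t.length := by
  by_contra h
  exact hG (hasOddHole_of_even ht hv h3 (Nat.not_odd_iff_even.1 h))

/-- The two paths close up to a hole. It is cut at the first vertex of `l`, and the rest is the
induced path `t ++ m.reverse`. -/
theorem even_add_length_of_hole (hG : ¬ HasOddHole G) {l m : List V} (hl : IndPath G l)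
    (hm : IndPath G m) (hlm : Cross G l m True False False True) (hl0 : l ≠ []) (hm0 : m ≠ [])
    (h4 : 4 ≤ l.length + m.length) : Even (l.length + m.length) := by
  obtain ⟨v, t, rfl⟩ := List.exists_cons_of_ne_nil hl0
  have h := odd_length_of_hole hG (v := v) (t := t ++ m.reverse) ?_ ?_ (by simp at h4 ⊢; omega)
  · simp only [List.length_append, List.length_reverse] at h
    simp only [List.length_cons]
    rw [show t.length + 1 + m.length = t.length + m.length + 1 by ring]
    exact h.add_one
  · rw [indPath_append, indPath_reverse, cross_reverse_right]
    refine ⟨hl.1, hm, ?_⟩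
    by_cases ht : t = []
    · subst ht; exact cross_nil_left
    · rw [show v :: t = [v] ++ t from rfl, cross_append_left (by simp) ht
        (by simpa using hl.nodup.notMem)] at hlm
      exact hlm.2
  · have hm' : m.reverse ≠ [] := by simpa using hm0
    by_cases ht : t = []
    · subst ht
      rw [List.nil_append, cross_reverse_right]
      rw [cross_singleton_left] at hlm ⊢
      simpa using hlm
    · have hdis : t.Disjoint m := by
        intro x hx hx'
        exact hlm.disjoint (List.mem_cons_of_mem _ hx) hx'
      rw [cross_append_right ht hm' (by simpa using hdis), cross_reverse_right]
      rw [show v :: t = [v] ++ t from rfl, cross_append_left (by simp) ht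
        (by simpa using hl.nodup.notMem)] at hlm
      have h1 := hlm.1
      rw [cross_singleton_left] at h1 ⊢
      rw [cross_singleton_left]
      refine ⟨?_, by simpa using h1⟩
      simpa using hl.2

/-- A graph without odd holes contains no pyramid. -/
theorem no_pyramid (hG : ¬ HasOddHole G) {v : V} {l₁ l₂ l₃ : List V}
    (h1 : IndPath G l₁) (h2 : IndPath G l₂) (h3 : IndPath G l₃)
    (h12 : Cross G l₁ l₂ True False False False) (h13 : Cross G l₁ l₃ True False False False)
    (h23 : Cross G l₂ l₃ True False False False)
    (hv1 : Cross G [v] l₁ False True False True) (hv2 : Cross G [v] l₂ False True False True)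
    (hv3 : Cross G [v] l₃ False True False True)
    (n1 : l₁ ≠ []) (n2 : l₂ ≠ []) (n3 : l₃ ≠ [])
    (k12 : 3 ≤ l₁.length + l₂.length) (k13 : 3 ≤ l₁.length + l₃.length)
    (k23 : 3 ≤ l₂.length + l₃.length) : False := by
  have key : ∀ l m : List V, IndPath G l → IndPath G m → Cross G l m True False False False →
      Cross G [v] l False True False True → Cross G [v] m False True False True → l ≠ [] →
      m ≠ [] → 3 ≤ l.length + m.length → Odd (l.length + m.length) := by
    intro l m hl hm hlm hvl hvm nl nm hk
    have := odd_length_of_hole hG (v := v) (t := l.reverse ++ m) ?_ ?_ (by simpa using hk)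
    · simpa using this
    · rw [indPath_append, indPath_reverse, cross_reverse_left]
      exact ⟨hl, hm, hlm⟩
    · rw [cross_append_right (by simpa using nl) nm (by simpa using hlm.disjoint),
        cross_reverse_right]
      rw [cross_singleton_left] at *
      rw [cross_singleton_left]
      exact ⟨by simpa using hvl, by simpa using hvm⟩
  -- All three pairwise sums of lengths are odd, but together they make twice the sum of the three
  -- lengths.
  have a := key _ _ h1 h2 h12 hv1 hv2 n1 n2 k12
  have b := key _ _ h1 h3 h13 hv1 hv3 n1 n3 k13
  have c := key _ _ h2 h3 h23 hv2 hv3 n2 n3 k23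
  grind

end InducedPaths

/-! ### Line graphs of subdivided multigraphs, and paths attached to a prism. -/

section Attachments

variable {V : Type*} {G : SimpleGraph V}

/-- Unlike splitting, gluing needs no disjointness: each end of the whole list is located in its own
half. -/
theorem Cross.append_left {l₁ l₂ m : List V} {hh hl lh ll : Prop} (h1 : l₁ ≠ []) (h2 : l₂ ≠ [])
    (h : Cross G l₁ m hh hl False False) (h' : Cross G l₂ m False False lh ll) :
    Cross G (l₁ ++ l₂) m hh hl lh ll := by
  have e1 : (l₁ ++ l₂).head? = l₁.head? := by
    cases l₁ <;> simp at h1 ⊢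
  have e2 : (l₁ ++ l₂).getLast? = l₂.getLast? := by
    rw [List.getLast?_append_of_ne_nil _ h2]
  have k1 : ∀ x, l₁.head? = some x → x ∈ l₁ := fun x => List.mem_of_head?
  have k2 : ∀ x, l₂.getLast? = some x → x ∈ l₂ := fun x => List.mem_of_getLast?
  simp only [Cross, e1, e2, List.mem_append, false_and, or_false, false_or] at *
  intro x hx y hy
  constructor
  · rcases hx with hx | hx
    · exact (h x hx y hy).1
    · exact (h' x hx y hy).1
  · constructor
    · intro ha
      rcases hx with hx | hx
      · have := (h x hx y hy).2.1 ha
        grind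
      · have := (h' x hx y hy).2.1 ha
        grind
    · rintro (hb | hb | hb | hb)
      · exact (h x (k1 x hb.2.1) y hy).2.2 (Or.inl hb)
      · exact (h x (k1 x hb.2.1) y hy).2.2 (Or.inr hb)
      · exact (h' x (k2 x hb.2.1) y hy).2.2 (Or.inl hb)
      · exact (h' x (k2 x hb.2.1) y hy).2.2 (Or.inr hb)

theorem Cross.append_right {l₁ l₂ m : List V} {hh hl lh ll : Prop} (h1 : l₁ ≠ []) (h2 : l₂ ≠ [])
    (h : Cross G m l₁ hh False lh False) (h' : Cross G m l₂ False hl False ll) :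
    Cross G m (l₁ ++ l₂) hh hl lh ll :=
  (Cross.append_left h1 h2 h.symm h'.symm).symm

theorem Cross.append_left_anti {l₁ l₂ m : List V} {hh hl : Prop} (h1 : l₁ ≠ [])
    (h : Cross G l₁ m hh hl False False) (h' : Cross G l₂ m False False False False) :
    Cross G (l₁ ++ l₂) m hh hl False False := by
  by_cases h2 : l₂ = []
  · simpa [h2] using h
  · exact h.append_left h1 h2 h'

theorem Cross.anti_append_left {l₁ l₂ m : List V} {lh ll : Prop} (h2 : l₂ ≠ [])
    (h : Cross G l₁ m False False False False) (h' : Cross G l₂ m False False lh ll) :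
    Cross G (l₁ ++ l₂) m False False lh ll := by
  by_cases h1 : l₁ = []
  · simpa [h1] using h'
  · exact h.append_left h1 h2 h'

theorem Cross.append_right_anti {l₁ l₂ m : List V} {hh lh : Prop} (h1 : l₁ ≠ [])
    (h : Cross G m l₁ hh False lh False) (h' : Cross G m l₂ False False False False) :
    Cross G m (l₁ ++ l₂) hh False lh False :=
  (Cross.append_left_anti h1 h.symm h'.symm).symm

theorem Cross.anti_append_right {l₁ l₂ m : List V} {hl ll : Prop} (h2 : l₂ ≠ [])
    (h : Cross G m l₁ False False False False) (h' : Cross G m l₂ False hl False ll) :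
    Cross G m (l₁ ++ l₂) False hl False ll :=
  (Cross.anti_append_left h2 h.symm h'.symm).symm

theorem anti_iff {l m : List V} : Cross G l m False False False False ↔
    ∀ x ∈ l, ∀ y ∈ m, x ≠ y ∧ ¬ G.Adj x y := by
  simp [Cross]

theorem Cross.anti_mono {l l' m m' : List V} (h : Cross G l m False False False False)
    (hl : l' ⊆ l) (hm : m' ⊆ m) : Cross G l' m' False False False False :=
  anti_iff.2 fun x hx y hy => anti_iff.1 h x (hl hx) y (hm hy)

theorem Cross.take_left {l₁ l₂ m : List V} {hh hl : Prop} (h1 : l₁ ≠ [])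
    (h : Cross G (l₁ ++ l₂) m hh hl False False) : Cross G l₁ m hh hl False False := by
  have e1 : (l₁ ++ l₂).head? = l₁.head? := by
    cases l₁ <;> simp at h1 ⊢
  intro x hx y hy
  simpa [e1] using h x (List.mem_append_left _ hx) y hy

theorem Cross.drop_left {l₁ l₂ m : List V} {lh ll : Prop} (h2 : l₂ ≠ [])
    (h : Cross G (l₁ ++ l₂) m False False lh ll) : Cross G l₂ m False False lh ll := by
  have e2 : (l₁ ++ l₂).getLast? = l₂.getLast? := by
    rw [List.getLast?_append_of_ne_nil _ h2]
  intro x hx y hy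
  simpa [e2] using h x (List.mem_append_right _ hx) y hy

theorem Cross.take_right {l₁ l₂ m : List V} {hh lh : Prop} (h1 : l₁ ≠ [])
    (h : Cross G m (l₁ ++ l₂) hh False lh False) : Cross G m l₁ hh False lh False :=
  (h.symm.take_left h1).symm

/-- The line graph of a subdivision of the multigraph with the edges `src e, tgt e`, as an induced
subgraph of `G`: the path of the edge `e` of the multigraph has become the induced path `L e`. -/
structure LineModel (G : SimpleGraph V) {k : ℕ} {N : Type*} (src tgt : Fin k → N)
    (L : Fin k → List V) : Prop where
  ne_nil : ∀ e, L e ≠ []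
  indPath : ∀ e, IndPath G (L e)
  cross : ∀ e f, e ≠ f → Cross G (L e) (L f) (src e = src f) (src e = tgt f) (tgt e = src f)
    (tgt e = tgt f)

/-- The edges of `K₄` are `src e, tgt e`. -/
def k4src : Fin 6 → Fin 4 := ![0, 0, 0, 1, 1, 2]

/-- The edges of `K₄` are `src e, tgt e`. -/
def k4tgt : Fin 6 → Fin 4 := ![1, 2, 3, 2, 3, 3]

theorem LineModel.of_lt {k : ℕ} {N : Type*} {src tgt : Fin k → N} {L : Fin k → List V}
    (h1 : ∀ e, L e ≠ []) (h2 : ∀ e, IndPath G (L e))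
    (h3 : ∀ e f, e < f → Cross G (L e) (L f) (src e = src f) (src e = tgt f) (tgt e = src f)
      (tgt e = tgt f)) : LineModel G src tgt L := by
  refine ⟨h1, h2, fun e f hef => ?_⟩
  rcases lt_or_gt_of_ne hef with h | h
  · exact h3 e f h
  · have := (h3 f e h).symm
    simpa only [eq_comm] using this

theorem lineModel_k4_of {l₀ l₁ l₂ l₃ l₄ l₅ : List V}
    (n0 : l₀ ≠ []) (n1 : l₁ ≠ []) (n2 : l₂ ≠ []) (n3 : l₃ ≠ []) (n4 : l₄ ≠ []) (n5 : l₅ ≠ [])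
    (i0 : IndPath G l₀) (i1 : IndPath G l₁) (i2 : IndPath G l₂) (i3 : IndPath G l₃)
    (i4 : IndPath G l₄) (i5 : IndPath G l₅)
    (h01 : Cross G l₀ l₁ True False False False) (h02 : Cross G l₀ l₂ True False False False)
    (h03 : Cross G l₀ l₃ False False True False) (h04 : Cross G l₀ l₄ False False True False)
    (h05 : Cross G l₀ l₅ False False False False)
    (h12 : Cross G l₁ l₂ True False False False) (h13 : Cross G l₁ l₃ False False False True)
    (h14 : Cross G l₁ l₄ False False False False) (h15 : Cross G l₁ l₅ False False True False)
    (h23 : Cross G l₂ l₃ False False False False) (h24 : Cross G l₂ l₄ False False False True)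
    (h25 : Cross G l₂ l₅ False False False True)
    (h34 : Cross G l₃ l₄ True False False False) (h35 : Cross G l₃ l₅ False False True False)
    (h45 : Cross G l₄ l₅ False False False True) :
    LineModel G k4src k4tgt ![l₀, l₁, l₂, l₃, l₄, l₅] := by
  refine LineModel.of_lt ?_ ?_ ?_
  · simp [Fin.forall_fin_succ, *]
  · simp [Fin.forall_fin_succ, *]
  · simp [Fin.forall_fin_succ, k4src, k4tgt, *]

/-- The three paths form a prism (possibly a degenerate one) and the induced path `D` is disjoint
from it; only its first vertex has neighbours on `A₁`, only its last vertex has neighbours on `A₂`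
or `A₃`, and these are not ends of `A₂` and `A₃`. -/
structure Attach (G : SimpleGraph V) (A₁ A₂ A₃ D : List V) : Prop where
  i1 : IndPath G A₁
  i2 : IndPath G A₂
  i3 : IndPath G A₃
  iD : IndPath G D
  c12 : Cross G A₁ A₂ True False False True
  c13 : Cross G A₁ A₃ True False False True
  c23 : Cross G A₂ A₃ True False False True
  len1 : 2 ≤ A₁.length
  ne3 : A₃ ≠ []
  d1 : ∀ x ∈ D, ∀ y ∈ A₁, x ≠ y ∧ (G.Adj x y → D.head? = some x)
  d2 : ∀ x ∈ D, ∀ y ∈ A₂, x ≠ y ∧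
    (G.Adj x y → D.getLast? = some x ∧ A₂.head? ≠ some y ∧ A₂.getLast? ≠ some y)
  d3 : ∀ x ∈ D, ∀ y ∈ A₃, x ≠ y ∧
    (G.Adj x y → D.getLast? = some x ∧ A₃.head? ≠ some y ∧ A₃.getLast? ≠ some y)
  n1 : ∃ x ∈ D, ∃ y ∈ A₁, G.Adj x y

theorem Attach.swap {A₁ A₂ A₃ D : List V} (h : Attach G A₁ A₂ A₃ D) (h2 : A₂ ≠ []) :
    Attach G A₁ A₃ A₂ D :=
  ⟨h.i1, h.i3, h.i2, h.iD, h.c13, h.c12, h.c23.symm, h.len1, h2, h.d1, h.d3, h.d2, h.n1⟩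

theorem Attach.reverse {A₁ A₂ A₃ D : List V} (h : Attach G A₁ A₂ A₃ D) :
    Attach G A₁.reverse A₂.reverse A₃.reverse D := by
  refine ⟨indPath_reverse.2 h.i1, indPath_reverse.2 h.i2, indPath_reverse.2 h.i3, h.iD, ?_, ?_, ?_,
    by simpa using h.len1, by simpa using h.ne3, by simpa using h.d1, ?_, ?_, by simpa using h.n1⟩
  · simpa [cross_reverse_left, cross_reverse_right] using h.c12
  · simpa [cross_reverse_left, cross_reverse_right] using h.c13
  · simpa [cross_reverse_left, cross_reverse_right] using h.c23
  · have := h.d2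
    simp only [List.mem_reverse, List.head?_reverse, List.getLast?_reverse]
    grind
  · have := h.d3
    simp only [List.mem_reverse, List.head?_reverse, List.getLast?_reverse]
    grind

theorem exists_first {l : List V} {p : V → Prop} (h : ∃ x ∈ l, p x) :
    ∃ S a T, l = S ++ a :: T ∧ p a ∧ ∀ x ∈ S, ¬ p x := by
  induction l with
  | nil => simp at h
  | cons x t ih =>
    by_cases hx : p x
    · exact ⟨[], x, t, rfl, hx, by simp⟩
    · obtain ⟨S, a, T, rfl, ha, hS⟩ := ih (by simpa [hx] using h)
      exact ⟨x :: S, a, T, rfl, ha, by simpa [hx] using hS⟩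

theorem exists_last {l : List V} {p : V → Prop} (h : ∃ x ∈ l, p x) :
    ∃ S a T, l = S ++ a :: T ∧ p a ∧ ∀ x ∈ T, ¬ p x := by
  obtain ⟨S, a, T, e, ha, hS⟩ := exists_first (l := l.reverse) (p := p) (by simpa using h)
  refine ⟨T.reverse, a, S.reverse, ?_, ha, by simpa using hS⟩
  rw [← List.reverse_reverse l, e]
  simp

/-- Only the extreme vertices with the property matter. In the last case nothing is known about `M`:
a path through a common neighbour of `a` and `b` bypasses it. -/
theorem first_last_trichotomy {l : List V} {p : V → Prop} (h : ∃ x ∈ l, p x) :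
    (∃ S a T, l = S ++ a :: T ∧ p a ∧ (∀ x ∈ S, ¬ p x) ∧ ∀ x ∈ T, ¬ p x) ∨
    (∃ S a b T, l = S ++ a :: b :: T ∧ p a ∧ p b ∧ (∀ x ∈ S, ¬ p x) ∧ ∀ x ∈ T, ¬ p x) ∨
    (∃ S a M b T, M ≠ [] ∧ l = S ++ a :: (M ++ b :: T) ∧ p a ∧ p b ∧ (∀ x ∈ S, ¬ p x) ∧
      ∀ x ∈ T, ¬ p x) := by
  obtain ⟨S, a, T, rfl, ha, hS⟩ := exists_first h
  by_cases hT : ∃ x ∈ T, p x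
  · obtain ⟨M, b, T, rfl, hb, hT⟩ := exists_last hT
    by_cases hM : M = []
    · exact Or.inr (Or.inl ⟨S, a, b, T, by simp [hM], ha, hb, hS, hT⟩)
    · exact Or.inr (Or.inr ⟨S, a, M, b, T, hM, rfl, ha, hb, hS, hT⟩)
  · exact Or.inl ⟨S, a, T, rfl, ha, hS, by simpa using hT⟩

end Attachments

/-! ### Where the last vertex of an attached path sees the prism. -/

section Attachments

variable {V : Type*} {G : SimpleGraph V}

theorem nodup_append_singleton_last {l : List V} {c : V} (h : (l ++ [c]).Nodup) :
    ∀ x ∈ l, x ≠ c := by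
  intro x hx hc
  rw [List.nodup_append] at h
  exact h.2.2 x hx c (by simp) hc

theorem IndPath.cross_append {l m : List V} (h : IndPath G (l ++ m)) :
    Cross G l m False False True False := (indPath_append.1 h).2.2

theorem IndPath.anti_of_ne_nil {l m r : List V} (h : IndPath G (l ++ (m ++ r))) (hm : m ≠ []) :
    Cross G l r False False False False := by
  have h1 := h.cross_append
  have h2 := h.right.nodup
  rw [List.nodup_append] at h2
  obtain ⟨a, t, rfl⟩ := List.exists_cons_of_ne_nil hm
  rw [anti_iff]
  intro x hx y hy
  have := h1 x hx y (List.mem_append_right _ hy)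
  refine ⟨this.1, fun ha => ?_⟩
  have hh := this.2.1 ha
  simp only [List.cons_append, List.head?_cons, Option.some_inj, false_and, false_or, or_false]
    at hh
  exact h2.2.2 a (by simp) y hy hh.2.2

/-- The common part of the paths that start from the first end of `A₁` and continue on `D`. -/
theorem Attach.leg_indPath {A₁ A₂ A₃ D S T E F : List V} {α : V} (h : Attach G A₁ A₂ A₃ D)
    (hA : A₁ = S ++ α :: T) (hα : ∃ x ∈ D, G.Adj x α)
    (hS : ∀ y ∈ S, ∀ x ∈ D, ¬ G.Adj x y) (hD : D = E ++ F) : IndPath G ((S ++ [α]) ++ E) := by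
  have hi : IndPath G (S ++ [α]) := by
    have := h.i1
    rw [hA, List.append_cons] at this
    exact this.left
  by_cases hE : E = []
  · simpa [hE] using hi
  have hh : D.head? = E.head? := by
    rw [hD]; cases E <;> simp at hE ⊢
  obtain ⟨d, hd, hdα⟩ := hα
  have hmem : ∀ y ∈ S ++ [α], y ∈ A₁ := by
    intro y hy; rw [hA]; simp at hy ⊢; tauto
  have hdh := (h.d1 d hd α (hmem α (by simp))).2 hdα
  refine indPath_append.2 ⟨hi, (hD ▸ h.iD).left, ?_⟩
  intro x hx y hy
  have hyD : y ∈ D := hD ▸ List.mem_append_left _ hy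
  have h1 := h.d1 y hyD x (hmem x hx)
  refine ⟨h1.1.symm, ?_⟩
  simp only [List.getLast?_concat, Option.some_inj, false_and, false_or, or_false, true_and]
  constructor
  · intro ha
    refine ⟨?_, by rw [← hh]; exact h1.2 ha.symm⟩
    simp only [List.mem_append, List.mem_singleton] at hx
    rcases hx with hx | hx
    · exact absurd ha.symm (hS x hx y hyD)
    · exact hx.symm
  · rintro ⟨rfl, hy'⟩
    rw [← hh, hdh, Option.some_inj] at hy'
    exact hy' ▸ hdα.symm

theorem Attach.no_adj_dropLast {A₁ A₂ A₃ D D₀ : List V} {c : V} (h : Attach G A₁ A₂ A₃ D)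
    (hD : D = D₀ ++ [c]) : Cross G D₀ A₂ False False False False ∧
      Cross G D₀ A₃ False False False False := by
  have hc := nodup_append_singleton_last (hD ▸ h.iD.nodup)
  constructor
  · refine anti_iff.2 fun x hx y hy => ?_
    have := h.d2 x (by simp [hD, hx]) y hy
    refine ⟨this.1, fun ha => hc x hx ?_⟩
    have := (this.2 ha).1
    simpa [hD, eq_comm] using this
  · refine anti_iff.2 fun x hx y hy => ?_
    have := h.d3 x (by simp [hD, hx]) y hy
    refine ⟨this.1, fun ha => hc x hx ?_⟩
    have := (this.2 ha).1
    simpa [hD, eq_comm] using this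

/-- The last vertex of `D` sees only the last vertex of the leg that ends before it. -/
theorem Attach.leg_apex {A₁ A₂ A₃ D S T D₀ : List V} {α c : V} (h : Attach G A₁ A₂ A₃ D)
    (hA : A₁ = S ++ α :: T) (hα : ∃ x ∈ D, G.Adj x α)
    (hS : ∀ y ∈ S, ∀ x ∈ D, ¬ G.Adj x y) (hD : D = D₀ ++ [c]) :
    Cross G [c] ((S ++ [α]) ++ D₀) False True False True := by
  have hmem : ∀ y ∈ S ++ [α], y ∈ A₁ := by
    intro y hy; rw [hA]; simp at hy ⊢; tauto
  have hcD : c ∈ D := by simp [hD]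
  have hX : ∀ y ∈ S ++ [α], c ≠ y := fun y hy => (h.d1 c hcD y (hmem y hy)).1
  by_cases hD0 : D₀ = []
  · subst hD0
    simp only [List.nil_append] at hD
    subst hD
    rw [List.append_nil, cross_singleton_left]
    intro y hy
    refine ⟨hX y hy, ?_⟩
    simp only [List.mem_append, List.mem_singleton, List.getLast?_concat, Option.some_inj] at hy ⊢
    obtain ⟨x, hx, hxα⟩ := hα
    obtain rfl := List.mem_singleton.1 hx
    constructor
    · intro ha
      rcases hy with hy | hy
      · exact absurd ha (hS y hy x hx)
      · exact Or.inr ⟨by simp, hy.symm⟩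
    · rintro (⟨h, -⟩ | ⟨-, rfl⟩)
      · simp at h
      · exact hxα
  · refine Cross.anti_append_right hD0 ?_ ?_
    · rw [anti_iff]
      intro x hx y hy
      obtain rfl := List.mem_singleton.1 hx
      refine ⟨hX y hy, fun ha => ?_⟩
      have h1 := (h.d1 x hcD y (hmem y hy)).2 ha
      rw [hD] at h1
      have hc := nodup_append_singleton_last (hD ▸ h.iD.nodup)
      obtain ⟨a, t, rfl⟩ := List.exists_cons_of_ne_nil hD0
      simp at h1
      exact hc a (by simp) h1
    · have := (hD ▸ h.iD).cross_append.symm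
      rw [cross_singleton_left] at this ⊢
      simpa using this

/-- The neighbours on `A₂` and `A₃` of the last vertex of `D` are two consecutive vertices of `A₂`,
if some of them lie on `A₂` and the first vertex of `A₁` with a neighbour in `D` is not its end. -/
theorem Attach.pair_aux (hG : ¬ HasOddHole G) {A₁ A₂ A₃ D S₁ T₁ : List V} {α : V}
    (h : Attach G A₁ A₂ A₃ D) (hA : A₁ = S₁ ++ α :: T₁) (hα : ∃ x ∈ D, G.Adj x α)
    (hS : ∀ y ∈ S₁, ∀ x ∈ D, ¬ G.Adj x y) (hT : T₁ ≠ [])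
    (h2 : ∃ x ∈ D, ∃ y ∈ A₂, G.Adj x y) :
    (∀ x ∈ D, ∀ y ∈ A₃, ¬ G.Adj x y) ∧ ∃ c S γ δ T, D.getLast? = some c ∧
      A₂ = S ++ γ :: δ :: T ∧ G.Adj c γ ∧ G.Adj c δ ∧ (∀ x ∈ S, ¬ G.Adj c x) ∧
      ∀ x ∈ T, ¬ G.Adj c x := by
  obtain ⟨c, hcD, hc2⟩ := h2
  obtain ⟨y, hy, hcy⟩ := hc2
  have hcl := ((h.d2 c hcD y hy).2 hcy).1
  obtain ⟨D₀, hD⟩ := List.getLast?_eq_some_iff.1 hcl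
  have hanti := h.no_adj_dropLast hD
  have hmL := h.leg_indPath hA hα hS hD
  have hap := h.leg_apex hA hα hS hD
  have hX1 : S₁ ++ [α] ≠ [] := by simp
  have hA' : A₁ = (S₁ ++ [α]) ++ T₁ := by simp [hA]
  have hdisj1 : (S₁ ++ [α]).Disjoint T₁ := by
    have := h.i1.nodup
    rw [hA', List.nodup_append'] at this
    exact this.2.2
  have hX12 : Cross G (S₁ ++ [α]) A₂ True False False False :=
    ((cross_append_left hX1 hT hdisj1).1 (hA' ▸ h.c12)).1
  have hX13 : Cross G (S₁ ++ [α]) A₃ True False False False :=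
    ((cross_append_left hX1 hT hdisj1).1 (hA' ▸ h.c13)).1
  have hleg2 : Cross G ((S₁ ++ [α]) ++ D₀) A₂ True False False False :=
    hX12.append_left_anti hX1 hanti.1
  have hleg3 : Cross G ((S₁ ++ [α]) ++ D₀) A₃ True False False False :=
    hX13.append_left_anti hX1 hanti.2
  obtain ⟨S₂, γ, T₂, hA2, hcγ, hS2⟩ := exists_first (p := fun y => G.Adj c y) ⟨y, hy, hcy⟩
  have hS2ne : S₂ ≠ [] := by
    rintro rfl
    have := ((h.d2 c hcD γ (by simp [hA2])).2 hcγ).2.1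
    simp [hA2] at this
  have hT2ne : T₂ ≠ [] := by
    rintro rfl
    have := ((h.d2 c hcD γ (by simp [hA2])).2 hcγ).2.2
    simp [hA2] at this
  have hc2 : ∀ y ∈ A₂, c ≠ y := fun y hy => (h.d2 c hcD y hy).1
  have hc3 : ∀ y ∈ A₃, c ≠ y := fun y hy => (h.d3 c hcD y hy).1
  have hX2 : S₂ ++ [γ] ≠ [] := by simp
  have hA2' : A₂ = (S₂ ++ [γ]) ++ T₂ := by simp [hA2]
  have hdisj2 : (S₂ ++ [γ]).Disjoint T₂ := by
    have := h.i2.nodup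
    rw [hA2', List.nodup_append'] at this
    exact this.2.2
  have hdisjS : S₂.Disjoint [γ] := by
    have := h.i2.nodup
    rw [hA2', List.nodup_append', List.nodup_append'] at this
    exact this.1.2.2
  have hcX2 : Cross G [c] (S₂ ++ [γ]) False True False True := by
    rw [cross_singleton_left]
    intro y hy
    refine ⟨hc2 y (by rw [hA2']; exact List.mem_append_left _ hy), ?_⟩
    simp only [List.mem_append, List.mem_singleton, List.getLast?_concat, Option.some_inj] at hy ⊢
    rcases hy with hy | rfl
    · have : y ≠ γ := by
        rintro rfl; exact hS2 _ hy hcγ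
      simp [hS2 y hy, this.symm]
    · simpa using hcγ
  have hX23 : Cross G (S₂ ++ [γ]) A₃ True False False False :=
    ((cross_append_left hX2 hT2ne hdisj2).1 (hA2' ▸ h.c23)).1
  have hT23 : Cross G T₂ A₃ False False False True :=
    ((cross_append_left hX2 hT2ne hdisj2).1 (hA2' ▸ h.c23)).2
  have hlegX2 : Cross G ((S₁ ++ [α]) ++ D₀) (S₂ ++ [γ]) True False False False :=
    (hA2' ▸ hleg2).take_right hX2
  have hiA2 := h.i2
  rw [hA2'] at hiA2
  have hS2len := List.length_pos_iff.2 hS2ne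
  have hT2len := List.length_pos_iff.2 hT2ne
  have hA3len := List.length_pos_iff.2 h.ne3
  -- no neighbours on `A₃`
  have no3 : ∀ y ∈ A₃, ¬ G.Adj c y := by
    by_contra! h3
    obtain ⟨S₃, ε, T₃, hA3, hcε, hS3⟩ := exists_first (p := fun y => G.Adj c y) h3
    have hS3ne : S₃ ≠ [] := by
      rintro rfl
      have := ((h.d3 c hcD ε (by simp [hA3])).2 hcε).2.1
      simp [hA3] at this
    have hS3len := List.length_pos_iff.2 hS3ne
    have hA3' : A₃ = (S₃ ++ [ε]) ++ T₃ := by simp [hA3]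
    have hX3 : S₃ ++ [ε] ≠ [] := by simp
    -- Neighbours on both `A₂` and `A₃` give a pyramid with apex `c` and the three first vertices as
    -- triangle: one leg runs through `α` and `D`, the others run on `A₂` and `A₃` up to their first
    -- neighbours of `c`.
    refine no_pyramid hG hmL hiA2.left (hA3' ▸ h.i3).left hlegX2
      ((hA3' ▸ hleg3).take_right hX3) ((hA3' ▸ hX23).take_right hX3) hap hcX2 ?_ (by simp) hX2 hX3
      (by simp; omega) (by simp; omega) (by simp; omega)
    rw [cross_singleton_left]
    intro y hy
    refine ⟨hc3 y (by rw [hA3']; exact List.mem_append_left _ hy), ?_⟩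
    simp only [List.mem_append, List.mem_singleton, List.getLast?_concat, Option.some_inj] at hy ⊢
    rcases hy with hy | rfl
    · have : y ≠ ε := by
        rintro rfl; exact hS3 _ hy hcε
      simp [hS3 y hy, this.symm]
    · simpa using hcε
  have no3' : ∀ x ∈ D, ∀ y ∈ A₃, ¬ G.Adj x y := by
    intro x hx y hy ha
    have := ((h.d3 x hx y hy).2 ha).1
    rw [hcl, Option.some_inj] at this
    exact no3 y hy (this ▸ ha)
  refine ⟨no3', ?_⟩
  have hD3 : Cross G D A₃ False False False False :=
    anti_iff.2 fun x hx y hy => ⟨(h.d3 x hx y hy).1, no3' x hx y hy⟩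
  have hc3' : Cross G [c] A₃ False False False False := hD3.anti_mono (by simp [hcD]) (by simp)
  -- at least two neighbours on `A₂`
  by_cases hq : ∃ y ∈ T₂, G.Adj c y
  swap
  · exfalso
    push Not at hq
    have hγ3 : Cross G [γ] A₃ False False False False :=
      ((cross_append_left hS2ne (by simp) hdisjS).1 hX23).2
    have h1γ : Cross G (S₁ ++ [α]) [γ] False False False False :=
      ((cross_append_right hS2ne (by simp) hdisjS).1 (hA2' ▸ hX12 |>.take_right hX2)).2
    have hlegD : Cross G ((S₁ ++ [α]) ++ D) A₃ True False False False :=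
      hX13.append_left_anti hX1 hD3
    have hDc : ∀ x ∈ D, ∀ y ∈ A₂, G.Adj x y → y = γ := by
      intro x hx y hy ha
      have := ((h.d2 x hx y hy).2 ha).1
      rw [hcl, Option.some_inj] at this
      subst this
      rw [hA2] at hy
      simp only [List.mem_append, List.mem_cons] at hy
      rcases hy with hy | hy | hy
      · exact absurd ha (hS2 y hy)
      · exact hy
      · exact absurd ha (hq y hy)
    have hDS2 : Cross G D S₂ False False False False := by
      refine anti_iff.2 fun x hx y hy => ⟨(h.d2 x hx y (by simp [hA2, hy])).1, fun ha => ?_⟩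
      have := hDc x hx y (by simp [hA2, hy]) ha
      exact hS2 y hy (this ▸ hcγ)
    have hDT2 : Cross G D T₂ False False False False := by
      refine anti_iff.2 fun x hx y hy => ⟨(h.d2 x hx y (by simp [hA2, hy])).1, fun ha => ?_⟩
      have := hDc x hx y (by simp [hA2, hy]) ha
      exact hq y hy (this ▸ hcγ)
    have hXT2 : Cross G (S₁ ++ [α]) T₂ False False False False :=
      ((cross_append_right hX2 hT2ne hdisj2).1 (hA2' ▸ hX12)).2
    have hγS : Cross G [γ] S₂ False True False True := by
      have := hiA2.left.cross_append.symm
      rw [cross_singleton_left] at this ⊢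
      simpa using this
    have hγT : Cross G [γ] T₂ True False True False := by
      have := (show IndPath G (S₂ ++ ([γ] ++ T₂)) by simpa using hiA2).right.cross_append
      rw [cross_singleton_left] at this ⊢
      simpa using this
    -- If `γ` is the only neighbour of `c` on `A₂`, it is itself the apex: the legs reach it
    -- directly on `A₂`, along all of `A₃` and back on `A₂`, and through `D`.
    refine no_pyramid hG hiA2.left.left (l₂ := A₃ ++ T₂.reverse)
      (l₃ := (S₁ ++ [α]) ++ D) (v := γ) ?_ (h.leg_indPath hA hα hS (F := []) (by simp)) ?_ ?_ ?_
      hγS ?_ ?_ hS2ne (by simp [h.ne3]) (by simp) (by simp; omega) ?_ (by simp; omega)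
    · rw [indPath_append, indPath_reverse, cross_reverse_right]
      exact ⟨h.i3, hiA2.right, hT23.symm⟩
    · refine Cross.append_right_anti h.ne3 (hX23.take_left hS2ne) ?_
      rw [cross_reverse_right]
      exact (show IndPath G (S₂ ++ ([γ] ++ T₂)) by simpa using hiA2).anti_of_ne_nil (by simp)
    · refine Cross.symm (Cross.append_left_anti hX1 ?_ hDS2)
      exact (hA2' ▸ hX12 |>.take_right hX2).take_right hS2ne
    · refine Cross.symm (hlegD.append_right_anti h.ne3 ?_)
      rw [cross_reverse_right]
      exact hXT2.append_left_anti hX1 hDT2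
    · refine Cross.anti_append_right (by simpa using hT2ne) hγ3 ?_
      rw [cross_reverse_right]
      rw [cross_singleton_left] at hγT ⊢
      simpa using hγT
    · refine Cross.anti_append_right (by rintro rfl; simp at hcD) h1γ.symm ?_
      rw [cross_singleton_left]
      intro y hy
      have hne := (h.d2 y hy γ (by simp [hA2])).1
      refine ⟨hne.symm, ?_⟩
      rw [hcl]
      simp only [Option.some_inj, false_and, true_and, false_or, or_true, or_false]
      constructor
      · intro ha
        have := ((h.d2 y hy γ (by simp [hA2])).2 ha.symm).1
        rwa [hcl, Option.some_inj] at this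
      · rintro rfl
        exact hcγ.symm
    · have := List.length_pos_of_mem hcD
      simp; omega
  · obtain ⟨M, δ, T, rfl, hcδ, hTc⟩ := exists_last hq
    by_cases hM : M = []
    · subst hM
      exact ⟨c, S₂, γ, δ, T, hcl, by simp [hA2], hcγ, hcδ, hS2, hTc⟩
    exfalso
    have hδ : Cross G [c] (δ :: T) True False True False := by
      rw [cross_singleton_left]
      intro y hy
      refine ⟨hc2 y (by rw [hA2]; simp at hy ⊢; tauto), ?_⟩
      simp only [List.mem_cons, List.head?_cons, Option.some_inj] at hy ⊢
      rcases hy with rfl | hy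
      · simpa using hcδ
      · have : δ ≠ y := by
          rintro rfl; exact hTc _ hy hcδ
        simp [hTc y hy, this]
    have hanti' : Cross G (S₂ ++ [γ]) (δ :: T) False False False False :=
      hiA2.anti_of_ne_nil hM
    have hδT3 : Cross G (δ :: T) A₃ False False False True := hT23.drop_left (by simp)
    -- If the first and last neighbours `γ` and `δ` of `c` are separated, `c` is an apex again: the
    -- third leg runs along all of `A₃` and back on `A₂` to `δ`.
    refine no_pyramid hG hmL hiA2.left (l₃ := A₃ ++ (δ :: T).reverse) ?_ hlegX2 ?_ ?_ hap hcX2 ?_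
      (by simp) hX2 (by simp) (by simp; omega) (by simp; omega) (by simp; omega)
    · rw [indPath_append, indPath_reverse, cross_reverse_right]
      exact ⟨h.i3, hiA2.right.right, hδT3.symm⟩
    · refine hleg3.append_right_anti h.ne3 ?_
      rw [cross_reverse_right]
      have := ((cross_append_right hX2 hT2ne hdisj2).1 (hA2' ▸ hleg2)).2
      exact this.anti_mono (by simp) (by simp)
    · refine hX23.append_right_anti h.ne3 ?_
      rw [cross_reverse_right]
      exact hanti'
    · refine Cross.anti_append_right (by simp) hc3' ?_
      rw [cross_reverse_right]
      rw [cross_singleton_left] at hδ ⊢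
      simpa using hδ

end Attachments

/-! ### From an attached path to the line graph of a subdivision of `K₄`. -/

section Attachments

variable {V : Type*} {G : SimpleGraph V}

/-- `Attach.pair_aux` uses the triangle of first vertices, which requires the first attachment on
`A₁` not to be the last vertex of `A₁`. If it is, reversing all three paths makes it the first
vertex, and then something follows it since `A₁` has two vertices. -/
theorem Attach.pair (hG : ¬ HasOddHole G) {A₁ A₂ A₃ D : List V} (h : Attach G A₁ A₂ A₃ D)
    (h2 : ∃ x ∈ D, ∃ y ∈ A₂, G.Adj x y) :
    (∀ x ∈ D, ∀ y ∈ A₃, ¬ G.Adj x y) ∧ ∃ c S γ δ T, D.getLast? = some c ∧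
      A₂ = S ++ γ :: δ :: T ∧ G.Adj c γ ∧ G.Adj c δ ∧ (∀ x ∈ S, ¬ G.Adj c x) ∧
      ∀ x ∈ T, ¬ G.Adj c x := by
  obtain ⟨S, α, T, hA, hα, hS⟩ := exists_first (l := A₁) (p := fun y => ∃ x ∈ D, G.Adj x y) (by
    obtain ⟨x, hx, y, hy, ha⟩ := h.n1
    exact ⟨y, hy, x, hx, ha⟩)
  have hS' : ∀ y ∈ S, ∀ x ∈ D, ¬ G.Adj x y := fun y hy x hx ha => hS y hy ⟨x, hx, ha⟩
  by_cases hT : T = []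
  · subst hT
    have hl := h.len1
    have hSne : S ≠ [] := by
      rintro rfl
      simp [hA] at hl
    obtain ⟨h3, c, S', γ, δ, T', hc, hA2, hγ, hδ, hSc, hTc⟩ := h.reverse.pair_aux hG (S₁ := [])
      (α := α) (T₁ := S.reverse) (by simp [hA]) hα (by simp) (by simpa using hSne)
      (by simpa using h2)
    refine ⟨by simpa using h3, c, T'.reverse, δ, γ, S'.reverse, hc, ?_, hδ, hγ, by simpa using hTc,
      by simpa using hSc⟩
    rw [← List.reverse_reverse A₂, hA2]
    simp
  · exact h.pair_aux hG hA hα hS' hT h2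

theorem cross_apex_last {c a : V} {S : List V} (hS : ∀ x ∈ S, c ≠ x ∧ ¬ G.Adj c x)
    (ha : G.Adj c a) : Cross G [c] (S ++ [a]) False True False True := by
  refine Cross.anti_append_right (by simp) ?_ ?_
  · rw [cross_singleton_left]
    simpa using hS
  · rw [cross_singleton_left]
    simpa using ⟨ha.ne, ha⟩

theorem cross_apex_head {c a : V} {S : List V} (hS : ∀ x ∈ S, c ≠ x ∧ ¬ G.Adj c x)
    (ha : G.Adj c a) : Cross G [c] (a :: S) True False True False := by
  refine Cross.append_right_anti (l₁ := [a]) (by simp) ?_ ?_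
  · rw [cross_singleton_left]
    simpa using ⟨ha.ne, ha⟩
  · rw [cross_singleton_left]
    simpa using hS

/-- On a singleton the two ends coincide, so only the disjunctions of the flags count. -/
theorem cross_singleton_congr {c : V} {m : List V} {hh hl lh ll hh' hl' lh' ll' : Prop}
    (h : Cross G [c] m hh hl lh ll) (e1 : (hh ∨ lh) ↔ (hh' ∨ lh')) (e2 : (hl ∨ ll) ↔ (hl' ∨ ll')) :
    Cross G [c] m hh' hl' lh' ll' := by
  rw [cross_singleton_left] at h ⊢
  rwa [← e1, ← e2]

/-- In a graph without odd holes, a path that joins one path of a prism to the two others extends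
the prism to the line graph of a subdivision of `K₄`. -/
theorem Attach.exists_k4_aux (hG : ¬ HasOddHole G) {A₁ A₂ A₃ D : List V}
    (h : Attach G A₁ A₂ A₃ D) (h2 : ∃ x ∈ D, ∃ y ∈ A₂, G.Adj x y) :
    ∃ L, LineModel G k4src k4tgt L ∧ 6 < ∑ e, (L e).length ∧
      ∑ e, (L e).length = A₁.length + A₂.length + A₃.length + D.length := by
  obtain ⟨no3, c, S₂, γ, δ, T₂, hcl, hA2, hcγ, hcδ, hS2, hT2⟩ := h.pair hG h2
  have hcD := List.mem_of_getLast? hcl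
  have hA2' : A₂ = (S₂ ++ [γ]) ++ (δ :: T₂) := by simp [hA2]
  have hS2ne : S₂ ≠ [] := by
    rintro rfl
    have := ((h.d2 c hcD γ (by simp [hA2])).2 hcγ).2.1
    simp [hA2] at this
  have hT2ne : T₂ ≠ [] := by
    rintro rfl
    have := ((h.d2 c hcD δ (by simp [hA2])).2 hcδ).2.2
    simp [hA2] at this
  have hD3 : Cross G D A₃ False False False False :=
    anti_iff.2 fun x hx y hy => ⟨(h.d3 x hx y hy).1, no3 x hx y hy⟩
  have hDne : D ≠ [] := List.ne_nil_of_mem hcD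
  have hi2 := hA2' ▸ h.i2
  have hdisj2 : (S₂ ++ [γ]).Disjoint (δ :: T₂) := by
    have := hi2.nodup
    rw [List.nodup_append'] at this
    exact this.2.2
  have hX2 : S₂ ++ [γ] ≠ [] := by simp
  have hY2 : δ :: T₂ ≠ [] := by simp
  obtain ⟨hX23, hY23⟩ := (cross_append_left hX2 hY2 hdisj2).1 (hA2' ▸ h.c23)
  obtain ⟨h1X2, h1Y2⟩ := (cross_append_right hX2 hY2 hdisj2).1 (hA2' ▸ h.c12)
  have hXY2 := hi2.cross_append
  -- `D` against the two parts of `A₂`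
  have hDc : ∀ x ∈ D, ∀ y ∈ A₂, G.Adj x y → x = c := by
    intro x hx y hy ha
    have := ((h.d2 x hx y hy).2 ha).1
    rw [hcl, Option.some_inj] at this
    exact this.symm
  have hcX2 : Cross G [c] (S₂ ++ [γ]) False True False True :=
    cross_apex_last (fun x hx => ⟨(h.d2 c hcD x (by simp [hA2, hx])).1, hS2 x hx⟩) hcγ
  have hcY2 : Cross G [c] (δ :: T₂) True False True False :=
    cross_apex_head (fun x hx => ⟨(h.d2 c hcD x (by simp [hA2, hx])).1, hT2 x hx⟩) hcδ
  obtain ⟨D₀, hD⟩ := List.getLast?_eq_some_iff.1 hcl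
  have hanti := h.no_adj_dropLast hD
  have hDX2 : Cross G D (S₂ ++ [γ]) False False False True := by
    rw [hD]
    exact Cross.anti_append_left (by simp) (hanti.1.anti_mono (by simp) (by simp [hA2']))
      (cross_singleton_congr hcX2 (by simp) (by simp))
  have hDY2 : Cross G D (δ :: T₂) False False True False := by
    rw [hD]
    exact Cross.anti_append_left (by simp) (hanti.1.anti_mono (by simp) (by simp [hA2']))
      (cross_singleton_congr hcY2 (by simp) (by simp))
  have hS2len := List.length_pos_iff.2 hS2ne
  have hT2len := List.length_pos_iff.2 hT2ne
  have hA3len := List.length_pos_iff.2 h.ne3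
  have hDlen := List.length_pos_iff.2 hDne
  obtain ⟨d, hd⟩ : ∃ d, D.head? = some d := by
    cases D with
    | nil => exact absurd rfl hDne
    | cons d t => exact ⟨d, rfl⟩
  have hdD := List.mem_of_head? hd
  obtain ⟨D₁, hD1⟩ := List.head?_eq_some_iff.1 hd
  have hDd : ∀ x ∈ D, ∀ y ∈ A₁, G.Adj x y → x = d := by
    intro x hx y hy ha
    have := (h.d1 x hx y hy).2 ha
    rw [hd, Option.some_inj] at this
    exact this.symm
  have hd1 : ∀ y ∈ A₁, d ≠ y := fun y hy => (h.d1 d hdD y hy).1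
  have hD1anti : Cross G D₁ A₁ False False False False := by
    refine anti_iff.2 fun x hx y hy => ⟨(h.d1 x (by simp [hD1, hx]) y hy).1, fun ha => ?_⟩
    have h1 := hDd x (by simp [hD1, hx]) y hy ha
    have h2 := h.iD.nodup
    rw [hD1, List.nodup_cons] at h2
    exact h2.1 (h1 ▸ hx)
  have hiD := hD1 ▸ h.iD
  rcases first_last_trichotomy (l := A₁) (p := fun y => G.Adj d y) (by
    obtain ⟨x, hx, y, hy, ha⟩ := h.n1
    exact ⟨y, hy, hDd x hx y hy ha ▸ ha⟩) with
    ⟨S₁, α, T₁, hA, hα, hS1, hT1⟩ | ⟨S₁, α, β, T₁, hA, hα, hβ, hS1, hT1⟩ |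
    ⟨S₁, α, M, β, T₁, hM, hA, hα, hβ, hS1, hT1⟩
  · exfalso
    have hA' : A₁ = S₁ ++ ([α] ++ T₁) := by simp [hA]
    have hA'' : A₁ = (S₁ ++ [α]) ++ T₁ := by simp [hA]
    have hi1 := hA' ▸ h.i1
    have hnd := hi1.nodup
    rw [List.nodup_append', List.nodup_append'] at hnd
    have hdis : S₁.Disjoint ([α] ++ T₁) := hnd.2.2
    have hdis' : (S₁ ++ [α]).Disjoint T₁ := by
      have := (hA'' ▸ h.i1).nodup
      rw [List.nodup_append'] at this
      exact this.2.2
    have hS1X2 : Cross G S₁ (S₂ ++ [γ]) True False False False := by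
      by_cases hS : S₁ = []
      · subst hS; exact cross_nil_left
      · exact (hA' ▸ h1X2).take_left hS
    have hT1Y2 : Cross G T₁ (δ :: T₂) False False False True := by
      by_cases hS : T₁ = []
      · subst hS; exact cross_nil_left
      · exact (hA'' ▸ h1Y2).drop_left hS
    have hS1Y2 : Cross G S₁ (δ :: T₂) False False False False := by
      by_cases hS : S₁ = []
      · subst hS; exact cross_nil_left
      · exact ((cross_append_left hS (by simp) hdis).1 (hA' ▸ h1Y2)).1
    have hT1X2 : Cross G T₁ (S₂ ++ [γ]) False False False False := by
      by_cases hS : T₁ = []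
      · subst hS; exact cross_nil_left
      · exact ((cross_append_left (by simp) hS hdis').1 (hA'' ▸ h1X2)).2
    have hST : Cross G S₁ T₁ False False False False := hi1.anti_of_ne_nil (by simp)
    have hDα : ∀ x ∈ D, ∀ y ∈ A₁, G.Adj x y → y = α := by
      intro x hx y hy ha
      have hxd := hDd x hx y hy ha
      subst hxd
      rw [hA] at hy
      simp only [List.mem_append, List.mem_cons] at hy
      rcases hy with hy | hy | hy
      · exact absurd ha (hS1 y hy)
      · exact hy
      · exact absurd ha (hT1 y hy)
    have hDS1 : Cross G D S₁ False False False False := by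
      refine anti_iff.2 fun x hx y hy => ⟨(h.d1 x hx y (by simp [hA, hy])).1, fun ha => ?_⟩
      have := hDα x hx y (by simp [hA, hy]) ha
      exact hS1 y hy (this ▸ hα)
    have hDT1 : Cross G D T₁ False False False False := by
      refine anti_iff.2 fun x hx y hy => ⟨(h.d1 x hx y (by simp [hA, hy])).1, fun ha => ?_⟩
      have := hDα x hx y (by simp [hA, hy]) ha
      exact hT1 y hy (this ▸ hα)
    have hαD : Cross G [α] D True False True False := by
      rw [hD1]
      refine cross_apex_head (fun x hx => ?_) hα.symm
      have := anti_iff.1 hD1anti x hx α (by simp [hA])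
      exact ⟨this.1.symm, fun ha => this.2 ha.symm⟩
    -- A single attachment `α` is the apex of a pyramid with triangle `c`, `γ`, `δ`: the legs are
    -- `D` and the two ways along the prism from `γ` and from `δ`.
    refine no_pyramid hG (v := α) (l₁ := D.reverse) (l₂ := (S₂ ++ [γ]).reverse ++ S₁)
      (l₃ := (δ :: T₂) ++ T₁.reverse) (indPath_reverse.2 h.iD) ?_ ?_ ?_ ?_ ?_ ?_ ?_ ?_
      (by simpa using hDne) (by simp) (by simp) (by simp; omega) (by simp; omega)
      (by simp; omega)
    · rw [indPath_append, indPath_reverse, cross_reverse_left]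
      exact ⟨hi2.left, hi1.left, hS1X2.symm⟩
    · rw [indPath_append, indPath_reverse, cross_reverse_right]
      exact ⟨hi2.right, hi1.right.right, hT1Y2.symm⟩
    · refine Cross.append_right_anti (by simp) ?_ ?_
      · rw [cross_reverse_left, cross_reverse_right]; exact hDX2
      · rw [cross_reverse_left]; exact hDS1
    · refine Cross.append_right_anti (by simp) ?_ ?_
      · rw [cross_reverse_left]; exact hDY2
      · rw [cross_reverse_left, cross_reverse_right]; exact hDT1
    · refine Cross.append_right_anti (by simp) (Cross.append_left_anti (by simp) ?_ hS1Y2)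
        (Cross.append_left_anti (by simp) ?_ ?_)
      · rw [cross_reverse_left]; exact hXY2
      · rw [cross_reverse_left, cross_reverse_right]; exact hT1X2.symm
      · rw [cross_reverse_right]; exact hST
    · rw [cross_reverse_right]
      exact cross_singleton_congr hαD (by simp) (by simp)
    · by_cases hS : S₁ = []
      · subst hS
        rw [List.append_nil, cross_reverse_right]
        exact cross_singleton_congr ((hA' ▸ h1X2).take_left (l₁ := [α]) (by simp))
          (by simp) (by simp)
      · refine Cross.anti_append_right hS ?_ ?_
        · rw [cross_reverse_right]
          exact ((cross_append_left hS (by simp) hdis).1 (hA' ▸ h1X2)).2.anti_mono (by simp) (by simp)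
        · exact cross_singleton_congr (hA'' ▸ h.i1).left.cross_append.symm (by simp) (by simp)
    · by_cases hS : T₁ = []
      · subst hS
        rw [List.reverse_nil, List.append_nil]
        have h5 : Cross G (S₁ ++ [α]) (δ :: T₂) False False False True := hA ▸ h1Y2
        exact cross_singleton_congr (h5.drop_left (by simp)) (by simp) (by simp)
      · refine Cross.anti_append_right (by simpa using hS) ?_ ?_
        · exact ((cross_append_left (by simp) hS hdis').1 (hA'' ▸ h1Y2)).1.anti_mono (by simp)
            (by simp)
        · rw [cross_reverse_right]
          exact cross_singleton_congr hi1.right.cross_append (by simp) (by simp)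
  · have hA' : A₁ = (S₁ ++ [α]) ++ (β :: T₁) := by simp [hA]
    have hi1 := hA' ▸ h.i1
    have hdisj1 : (S₁ ++ [α]).Disjoint (β :: T₁) := by
      have := hi1.nodup
      rw [List.nodup_append'] at this
      exact this.2.2
    have hX1 : S₁ ++ [α] ≠ [] := by simp
    have hY1 : β :: T₁ ≠ [] := by simp
    obtain ⟨hX13, hY13⟩ := (cross_append_left hX1 hY1 hdisj1).1 (hA' ▸ h.c13)
    obtain ⟨hX1X2, hY1X2⟩ := (cross_append_left hX1 hY1 hdisj1).1 (hA' ▸ h1X2)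
    obtain ⟨hX1Y2, hY1Y2⟩ := (cross_append_left hX1 hY1 hdisj1).1 (hA' ▸ h1Y2)
    have hdX1 : Cross G [d] (S₁ ++ [α]) False True False True :=
      cross_apex_last (fun x hx => ⟨hd1 x (by simp [hA, hx]), hS1 x hx⟩) hα
    have hdY1 : Cross G [d] (β :: T₁) True False True False :=
      cross_apex_head (fun x hx => ⟨hd1 x (by simp [hA, hx]), hT1 x hx⟩) hβ
    have hDX1 : Cross G D (S₁ ++ [α]) False True False False := by
      rw [hD1]
      exact Cross.append_left_anti (l₁ := [d]) (by simp)
        (cross_singleton_congr hdX1 (by simp) (by simp)) (hD1anti.anti_mono (by simp) (by simp [hA']))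
    have hDY1 : Cross G D (β :: T₁) True False False False := by
      rw [hD1]
      exact Cross.append_left_anti (l₁ := [d]) (by simp)
        (cross_singleton_congr hdY1 (by simp) (by simp)) (hD1anti.anti_mono (by simp) (by simp [hA']))
    -- The vertices 0 and 1 of `K₄` are the triangles of first and of last vertices of the prism, 2
    -- is the triangle `α`, `β`, `d`, and 3 is `γ`, `δ`, `c`.
    refine ⟨_, lineModel_k4_of (l₀ := A₃) (l₁ := S₁ ++ [α]) (l₂ := S₂ ++ [γ])
      (l₃ := (β :: T₁).reverse) (l₄ := (δ :: T₂).reverse) (l₅ := D) h.ne3 hX1 hX2 (by simp)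
      (by simp) hDne h.i3 hi1.left hi2.left (indPath_reverse.2 hi1.right)
      (indPath_reverse.2 hi2.right) h.iD hX13.symm hX23.symm ?_ ?_ hD3.symm hX1X2 ?_ ?_ hDX1.symm
      ?_ ?_ hDX2.symm ?_ ?_ ?_, ?_, ?_⟩
    · rw [cross_reverse_right]; exact hY13.symm
    · rw [cross_reverse_right]; exact hY23.symm
    · rw [cross_reverse_right]; exact hi1.cross_append
    · rw [cross_reverse_right]; exact hX1Y2
    · rw [cross_reverse_right]; exact hY1X2.symm
    · rw [cross_reverse_right]; exact hXY2
    · rw [cross_reverse_right, cross_reverse_left]; exact hY1Y2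
    · rw [cross_reverse_left]; exact hDY1.symm
    · rw [cross_reverse_left]; exact hDY2.symm
    · simp [Fin.sum_univ_succ]; omega
    · simp [Fin.sum_univ_succ, hA, hA2]; omega
  · exfalso
    have hA' : A₁ = (S₁ ++ [α]) ++ (M ++ (β :: T₁)) := by simp [hA]
    have hA'' : A₁ = ((S₁ ++ [α]) ++ M) ++ (β :: T₁) := by simp [hA]
    have hi1 := hA' ▸ h.i1
    have hi1' := hA'' ▸ h.i1
    have hdis : (S₁ ++ [α]).Disjoint (M ++ (β :: T₁)) := by
      have := hi1.nodup
      rw [List.nodup_append'] at this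
      exact this.2.2
    have hdis' : ((S₁ ++ [α]) ++ M).Disjoint (β :: T₁) := by
      have := hi1'.nodup
      rw [List.nodup_append'] at this
      exact this.2.2
    have hX1 : S₁ ++ [α] ≠ [] := by simp
    have hY1 : β :: T₁ ≠ [] := by simp
    have hXY1 : Cross G (S₁ ++ [α]) (β :: T₁) False False False False := hi1.anti_of_ne_nil hM
    have hX1X2 : Cross G (S₁ ++ [α]) (S₂ ++ [γ]) True False False False :=
      (hA' ▸ h1X2).take_left hX1
    have hX1Y2 : Cross G (S₁ ++ [α]) (δ :: T₂) False False False False :=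
      ((cross_append_left hX1 (by simp) hdis).1 (hA' ▸ h1Y2)).1
    have hY1Y2 : Cross G (β :: T₁) (δ :: T₂) False False False True :=
      (hA'' ▸ h1Y2).drop_left hY1
    have hY1X2 : Cross G (β :: T₁) (S₂ ++ [γ]) False False False False :=
      ((cross_append_left (by simp) hY1 hdis').1 (hA'' ▸ h1X2)).2
    have hX13 : Cross G (S₁ ++ [α]) A₃ True False False False :=
      ((cross_append_left hX1 (by simp) hdis).1 (hA' ▸ h.c13)).1
    have hY13 : Cross G (β :: T₁) A₃ False False False True :=
      ((cross_append_left (by simp) hY1 hdis').1 (hA'' ▸ h.c13)).2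
    have hdX1 : Cross G [d] (S₁ ++ [α]) False True False True :=
      cross_apex_last (fun x hx => ⟨hd1 x (by simp [hA, hx]), hS1 x hx⟩) hα
    have hdY1 : Cross G [d] (β :: T₁) True False True False :=
      cross_apex_head (fun x hx => ⟨hd1 x (by simp [hA, hx]), hT1 x hx⟩) hβ
    have hm2 : IndPath G ((S₂ ++ [γ]).reverse ++ (S₁ ++ [α])) := by
      rw [indPath_append, indPath_reverse, cross_reverse_left]
      exact ⟨hi2.left, hi1.left, hX1X2.symm⟩
    have hm3 : IndPath G ((δ :: T₂) ++ (β :: T₁).reverse) := by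
      rw [indPath_append, indPath_reverse, cross_reverse_right]
      exact ⟨hi2.right, hi1'.right, hY1Y2.symm⟩
    by_cases hD1ne : D₁ = []
    · have hcd : c = d := by
        rw [hD1, hD1ne] at hcl
        simpa using hcl.symm
      subst hcd
      -- Here `D` is the single vertex `c`. The holes through `c` and `α`, `γ`, through `c` and `β`,
      -- `δ`, and through `c`, `α`, `A₃`, `β`, together with the hole formed by `A₂` and `A₃`,
      -- cannot all be even.
      have e1 := odd_length_of_hole hG (v := c) hm2 ?_ (by simp; omega)
      have e2 := odd_length_of_hole hG (v := c) hm3 ?_ (by simp; omega)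
      have e3 := odd_length_of_hole hG (v := c)
        (t := (S₁ ++ [α]).reverse ++ (A₃ ++ (β :: T₁).reverse)) ?_ ?_ (by simp; omega)
      have e4 := even_add_length_of_hole hG h.i2 h.i3 h.c23 (by simp [hA2]) h.ne3
        (by simp [hA2]; omega)
      · rw [hA2] at e4
        simp only [List.length_append, List.length_reverse, List.length_cons, List.length_nil]
          at e1 e2 e3 e4
        grind
      · rw [indPath_append, indPath_append, indPath_reverse, indPath_reverse, cross_reverse_left,
          cross_reverse_right]
        refine ⟨hi1.left, ⟨h.i3, hi1'.right, hY13.symm⟩, Cross.append_right_anti h.ne3 hX13 ?_⟩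
        rw [cross_reverse_right]; exact hXY1
      · refine Cross.append_right (by simp) (by simp) ?_ (Cross.anti_append_right (by simp)
          (hD3.anti_mono (by simp [hcD]) (by simp)) ?_)
        · rw [cross_reverse_right]; exact cross_singleton_congr hdX1 (by simp) (by simp)
        · rw [cross_reverse_right]; exact cross_singleton_congr hdY1 (by simp) (by simp)
      · refine Cross.append_right (by simp) (by simp) ?_ ?_
        · exact cross_singleton_congr hcY2 (by simp) (by simp)
        · rw [cross_reverse_right]; exact cross_singleton_congr hdY1 (by simp) (by simp)
      · refine Cross.append_right (by simp) (by simp) ?_ ?_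
        · rw [cross_reverse_right]; exact cross_singleton_congr hcX2 (by simp) (by simp)
        · exact cross_singleton_congr hdX1 (by simp) (by simp)
    · have hdis : [d].Disjoint D₁ := by
        have := h.iD.nodup
        rw [hD1, List.nodup_cons] at this
        simpa using this.1
      have hD' : D = [d] ++ D₁ := hD1
      obtain ⟨hdX2, hD1X2⟩ := (cross_append_left (by simp) hD1ne hdis).1 (hD' ▸ hDX2)
      obtain ⟨hdY2, hD1Y2⟩ := (cross_append_left (by simp) hD1ne hdis).1 (hD' ▸ hDY2)
      have hD1X1 : Cross G D₁ (S₁ ++ [α]) False False False False :=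
        hD1anti.anti_mono (by simp) (by simp [hA'])
      have hD1Y1 : Cross G D₁ (β :: T₁) False False False False :=
        hD1anti.anti_mono (by simp) (hA'' ▸ List.subset_append_right _ _)
      have hD1len := List.length_pos_iff.2 hD1ne
      -- Now `d` and `c` differ, and separated attachments make `d` the apex over the triangle `c`,
      -- `γ`, `δ`.
      refine no_pyramid hG (v := d) (indPath_reverse.2 hiD.1) hm2 hm3 ?_ ?_ ?_ ?_ ?_ ?_
        (by simpa using hD1ne) (by simp) (by simp) (by simp; omega) (by simp; omega)
        (by simp; omega)
      · refine Cross.append_right_anti (by simp) ?_ ?_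
        · rw [cross_reverse_left, cross_reverse_right]; exact hD1X2
        · rw [cross_reverse_left]; exact hD1X1
      · refine Cross.append_right_anti (by simp) ?_ ?_
        · rw [cross_reverse_left]; exact hD1Y2
        · rw [cross_reverse_left, cross_reverse_right]; exact hD1Y1
      · refine Cross.append_right_anti (by simp) (Cross.append_left_anti (by simp) ?_ hX1Y2)
          (Cross.append_left_anti (by simp) ?_ ?_)
        · rw [cross_reverse_left]; exact hXY2
        · rw [cross_reverse_left, cross_reverse_right]; exact hY1X2.symm
        · rw [cross_reverse_right]; exact hXY1
      · rw [cross_reverse_right]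
        exact cross_singleton_congr (IndPath.cross_append (l := [d]) hiD) (by simp) (by simp)
      · refine Cross.anti_append_right (by simp) ?_ hdX1
        rw [cross_reverse_right]; exact hdX2
      · refine Cross.anti_append_right (by simp) hdY2 ?_
        rw [cross_reverse_right]
        exact cross_singleton_congr hdY1 (by simp) (by simp)

theorem Attach.exists_k4 (hG : ¬ HasOddHole G) {A₁ A₂ A₃ D : List V}
    (h : Attach G A₁ A₂ A₃ D) (hne : A₂ ≠ []) (h2 : ∃ x ∈ D, ∃ y ∈ A₂ ++ A₃, G.Adj x y) :
    ∃ L, LineModel G k4src k4tgt L ∧ 6 < ∑ e, (L e).length ∧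
      ∑ e, (L e).length = A₁.length + A₂.length + A₃.length + D.length := by
  obtain ⟨x, hx, y, hy, ha⟩ := h2
  rcases List.mem_append.1 hy with hy | hy
  · exact h.exists_k4_aux hG ⟨x, hx, y, hy, ha⟩
  · obtain ⟨L, h1, h2, h3⟩ := (h.swap hne).exists_k4_aux hG ⟨x, hx, y, hy, ha⟩
    exact ⟨L, h1, h2, by omega⟩

end Attachments

/-! ### Connecting pieces, and replacing a path of a prism. -/

section Replacement

variable {V : Type*} {G : SimpleGraph V}

/-- A further vertex with `U` or `W` allows the list to be cut there; induction on the length. -/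
theorem exists_minimal_infix {U W : V → Prop} (D : List V) (hu : ∃ x, D.head? = some x ∧ U x)
    (hw : ∃ x, D.getLast? = some x ∧ W x) : ∃ D', D' <:+: D ∧
      (∃ x, D'.head? = some x ∧ U x) ∧ (∃ x, D'.getLast? = some x ∧ W x) ∧
      (∀ x ∈ D', U x → D'.head? = some x) ∧ (∀ x ∈ D', W x → D'.getLast? = some x) := by
  induction hn : D.length using Nat.strong_induction_on generalizing D with
  | _ n ih =>
    by_cases h1 : ∀ x ∈ D, U x → D.head? = some x
    · by_cases h2 : ∀ x ∈ D, W x → D.getLast? = some x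
      · exact ⟨D, List.infix_rfl, hu, hw, h1, h2⟩
      · push Not at h2
        obtain ⟨x, hx, hWx, hne⟩ := h2
        obtain ⟨S, T, rfl⟩ := List.append_of_mem hx
        have hT : T ≠ [] := by rintro rfl; simp at hne
        have hTl := List.length_pos_iff.2 hT
        obtain ⟨D', hD', h⟩ := ih _ (by simp at hn ⊢; omega) (S ++ [x])
          (by cases S <;> simpa using hu) ⟨x, by simp, hWx⟩ rfl
        refine ⟨D', hD'.trans ⟨[], T, by simp⟩, h⟩
    · push Not at h1
      obtain ⟨x, hx, hUx, hne⟩ := h1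
      obtain ⟨S, T, rfl⟩ := List.append_of_mem hx
      have hS : S ≠ [] := by rintro rfl; simp at hne
      have hSl := List.length_pos_iff.2 hS
      obtain ⟨D', hD', h⟩ := ih _ (by simp at hn ⊢; omega) (x :: T) ⟨x, by simp, hUx⟩
        (by rwa [List.getLast?_append_of_ne_nil _ (by simp)] at hw) rfl
      refine ⟨D', hD'.trans ⟨S, [], by simp⟩, h⟩

/-- Extracts from an arbitrary path a piece in the shape that `Attach` requires. Reversal covers the
case that the vertex with `W` comes first. -/
theorem exists_connecting {U W : V → Prop} {l : List V} (hu : ∃ x ∈ l, U x) (hw : ∃ x ∈ l, W x) :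
    ∃ D, (D <:+: l ∨ D <:+: l.reverse) ∧
      (∃ x, D.head? = some x ∧ U x) ∧ (∃ x, D.getLast? = some x ∧ W x) ∧
      (∀ x ∈ D, U x → D.head? = some x) ∧ (∀ x ∈ D, W x → D.getLast? = some x) := by
  obtain ⟨u, hul, hu⟩ := hu
  obtain ⟨w, hwl, hw⟩ := hw
  obtain ⟨S, T, rfl⟩ := List.append_of_mem hul
  by_cases hwT : w ∈ u :: T
  · obtain ⟨M, T', hM⟩ := List.append_of_mem hwT
    have hh : (M ++ [w]).head? = some u := by
      have : (M ++ w :: T').head? = some u := by rw [← hM]; rfl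
      cases M <;> simpa using this
    obtain ⟨D, hD, h⟩ := exists_minimal_infix (M ++ [w]) ⟨u, hh, hu⟩ ⟨w, by simp, hw⟩
    exact ⟨D, Or.inl (hD.trans ⟨S, T', by rw [hM]; simp⟩), h⟩
  · have hwS : w ∈ S := by
      rcases List.mem_append.1 hwl with h | h
      · exact h
      · exact absurd h hwT
    obtain ⟨S', M, rfl⟩ := List.append_of_mem hwS
    obtain ⟨D, hD, h⟩ := exists_minimal_infix (u :: (M.reverse ++ [w])) ⟨u, by simp, hu⟩
      ⟨w, by rw [← List.cons_append, List.getLast?_concat], hw⟩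
    exact ⟨D, Or.inr (hD.trans ⟨T.reverse, S'.reverse, by simp⟩), h⟩

theorem IndPath.exists_adj_of_ne_head {l : List V} (h : IndPath G l) {x : V} (hx : x ∈ l)
    (hne : l.head? ≠ some x) : ∃ y ∈ l, G.Adj x y := by
  rw [indPath_iff_getElem] at h
  obtain ⟨i, hi, rfl⟩ := List.mem_iff_getElem.1 hx
  have hi0 : i ≠ 0 := by
    rintro rfl
    rw [List.head?_eq_getElem?, List.getElem?_eq_getElem hi] at hne
    exact hne rfl
  exact ⟨l[i - 1], List.getElem_mem _, (h.2 i (i - 1) hi (by omega)).2 (by omega)⟩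

theorem Cross.left_end_of_adj {l m : List V} {hh hl lh ll : Prop} (h : Cross G l m hh hl lh ll)
    {x y : V} (hx : x ∈ l) (hy : y ∈ m) (ha : G.Adj x y) :
    l.head? = some x ∨ l.getLast? = some x := by
  have := (h x hx y hy).2.1 ha
  tauto

/-- The second vertex of `D` is adjacent to `x`, so it would have `U` and be the first vertex too.
-/
theorem IndPath.eq_singleton_of_head {D : List V} {U : V → Prop} {x : V} (hD : IndPath G D)
    (hU : ∀ y ∈ D, U y → D.head? = some y) (hx : D.head? = some x)
    (h : ∀ y ∈ D, G.Adj y x → U y) : D = [x] := by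
  obtain ⟨t, rfl⟩ := List.head?_eq_some_iff.1 hx
  cases t with
  | nil => rfl
  | cons y t =>
    have hy := hD.2 y (by simp)
    have h1 := hU y (by simp) (h y (by simp) (hy.2.2 (by simp)).symm)
    simp at h1
    exact absurd h1 hy.1

theorem IndPath.eq_singleton_of_getLast {D : List V} {U : V → Prop} {x : V} (hD : IndPath G D)
    (hU : ∀ y ∈ D, U y → D.getLast? = some y) (hx : D.getLast? = some x)
    (h : ∀ y ∈ D, G.Adj y x → U y) : D = [x] := by
  have := (indPath_reverse.2 hD).eq_singleton_of_head (U := U) (x := x) (by simpa using hU)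
    (by simpa using hx) (by simpa using h)
  simpa using congrArg List.reverse this

/-- In a graph without odd holes, an induced path that avoids the corners of a prism and is attached
both to one of its paths and to the others gives the line graph of a subdivision of `K₄`. -/
theorem exists_k4_of_connecting (hG : ¬ HasOddHole G) {A₁ A₂ A₃ I : List V}
    (i1 : IndPath G A₁) (i2 : IndPath G A₂) (i3 : IndPath G A₃) (hI : IndPath G I)
    (c12 : Cross G A₁ A₂ True False False True) (c13 : Cross G A₁ A₃ True False False True)
    (c23 : Cross G A₂ A₃ True False False True) (len1 : 2 ≤ A₁.length) (ne2 : A₂ ≠ [])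
    (ne3 : A₃ ≠ [])
    (k1 : ∀ x ∈ I, A₁.head? ≠ some x ∧ A₁.getLast? ≠ some x)
    (k2 : ∀ x ∈ I, A₂.head? ≠ some x ∧ A₂.getLast? ≠ some x)
    (k3 : ∀ x ∈ I, A₃.head? ≠ some x ∧ A₃.getLast? ≠ some x)
    (n2 : ∀ x ∈ I, ∀ y ∈ A₂, G.Adj x y → A₂.head? ≠ some y ∧ A₂.getLast? ≠ some y)
    (n3 : ∀ x ∈ I, ∀ y ∈ A₃, G.Adj x y → A₃.head? ≠ some y ∧ A₃.getLast? ≠ some y)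
    (hu : ∃ x ∈ I, ∃ y ∈ A₁, G.Adj x y) (hw : ∃ x ∈ I, ∃ y ∈ A₂ ++ A₃, G.Adj x y) :
    ∃ L, LineModel G k4src k4tgt L ∧ 6 < ∑ e, (L e).length ∧
      ∑ e, (L e).length ≤ A₁.length + A₂.length + A₃.length + I.length := by
  obtain ⟨D, hDI, ⟨d, hd, hdU⟩, ⟨c, hc, hcW⟩, hU, hW⟩ := exists_connecting hu hw
  have hsub : ∀ x ∈ D, x ∈ I := by
    intro x hx
    rcases hDI with h | h
    · exact h.subset hx
    · simpa using h.subset hx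
  have hiD : IndPath G D := by
    rcases hDI with h | h
    · exact hI.infix h
    · exact (indPath_reverse.2 hI).infix h
  have hlen : D.length ≤ I.length := by
    rcases hDI with h | h
    · exact h.length_le
    · simpa using h.length_le
  have hdD := List.mem_of_head? hd
  have hcD := List.mem_of_getLast? hc
  have hA : Attach G A₁ A₂ A₃ D := by
    refine ⟨i1, i2, i3, hiD, c12, c13, c23, len1, ne3, ?_, ?_, ?_, d, hdD, hdU⟩
    · refine fun x hx y hy => ⟨?_, fun ha => hU x hx ⟨y, hy, ha⟩⟩
      -- A vertex of `D` on `A₁` is interior to `A₁`, so it and its neighbours in `D` have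
      -- neighbours on `A₁`; minimality makes it all of `D`. But then it must see `A₂` or `A₃`,
      -- which only the ends of `A₁` do. The other two paths are treated in the same way.
      rintro rfl
      have h1 := hU x hx (i1.exists_adj_of_ne_head hy (k1 x (hsub x hx)).1)
      have h2 := hiD.eq_singleton_of_head hU h1 fun z hz ha => ⟨x, hy, ha⟩
      rw [h2] at hcD
      obtain rfl := List.mem_singleton.1 hcD
      obtain ⟨z, hz, ha⟩ := hcW
      rcases List.mem_append.1 hz with hz | hz
      · have := c12.left_end_of_adj hy hz ha
        have := k1 c (hsub c hx)
        tauto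
      · have := c13.left_end_of_adj hy hz ha
        have := k1 c (hsub c hx)
        tauto
    · refine fun x hx y hy => ⟨?_, fun ha => ⟨hW x hx ⟨y, by simp [hy], ha⟩,
        n2 x (hsub x hx) y hy ha⟩⟩
      rintro rfl
      obtain ⟨z, hz, ha⟩ := i2.exists_adj_of_ne_head hy (k2 x (hsub x hx)).1
      have h1 := hW x hx ⟨z, by simp [hz], ha⟩
      have h2 := hiD.eq_singleton_of_getLast hW h1 fun z hz ha => ⟨x, by simp [hy], ha⟩
      rw [h2] at hdD
      obtain rfl := List.mem_singleton.1 hdD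
      obtain ⟨z, hz, ha⟩ := hdU
      have := c12.symm.left_end_of_adj hy hz ha
      have := k2 d (hsub d hx)
      tauto
    · refine fun x hx y hy => ⟨?_, fun ha => ⟨hW x hx ⟨y, by simp [hy], ha⟩,
        n3 x (hsub x hx) y hy ha⟩⟩
      rintro rfl
      obtain ⟨z, hz, ha⟩ := i3.exists_adj_of_ne_head hy (k3 x (hsub x hx)).1
      have h1 := hW x hx ⟨z, by simp [hz], ha⟩
      have h2 := hiD.eq_singleton_of_getLast hW h1 fun z hz ha => ⟨x, by simp [hy], ha⟩
      rw [h2] at hdD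
      obtain rfl := List.mem_singleton.1 hdD
      obtain ⟨z, hz, ha⟩ := hdU
      have := c13.symm.left_end_of_adj hy hz ha
      have := k3 d (hsub d hx)
      tauto
  obtain ⟨L, h1, h2, h3⟩ := hA.exists_k4 hG ne2 ⟨c, hcD, hcW⟩
  exact ⟨L, h1, h2, by omega⟩

theorem LineModel.update {k : ℕ} {N : Type*} {src tgt : Fin k → N} {L : Fin k → List V}
    (h : LineModel G src tgt L) (i : Fin k) {Q : List V} (hQ : IndPath G Q)
    (hhead : Q.head? = (L i).head?) (hlast : Q.getLast? = (L i).getLast?)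
    (hint : ∀ x ∈ Q, Q.head? ≠ some x → Q.getLast? ≠ some x → ∀ j, j ≠ i → ∀ y ∈ L j,
      x ≠ y ∧ ¬ G.Adj x y) : LineModel G src tgt (Function.update L i Q) := by
  have hne : Q ≠ [] := by
    rintro rfl
    exact h.ne_nil i (by simpa [eq_comm] using hhead)
  have key : ∀ f, f ≠ i → Cross G Q (L f) (src i = src f) (src i = tgt f) (tgt i = src f)
      (tgt i = tgt f) := by
    intro f hf x hx y hy
    by_cases hx1 : Q.head? = some x
    · have := h.cross i f hf.symm x (List.mem_of_head? (hhead ▸ hx1)) y hy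
      rwa [← hhead, ← hlast] at this
    by_cases hx2 : Q.getLast? = some x
    · have := h.cross i f hf.symm x (List.mem_of_getLast? (hlast ▸ hx2)) y hy
      rwa [← hhead, ← hlast] at this
    · simpa [hx1, hx2] using hint x hx hx1 hx2 f hf y hy
  refine ⟨fun e => ?_, fun e => ?_, fun e f hef => ?_⟩
  · by_cases he : e = i
    · subst he; simpa using hne
    · simpa [he] using h.ne_nil e
  · by_cases he : e = i
    · subst he; simpa using hQ
    · simpa [he] using h.indPath e
  · by_cases he : e = i
    · subst he
      simpa [hef.symm] using key f hef.symm
    · by_cases hf : f = i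
      · subst hf
        have := (key e he).symm
        simp only [Function.update_self, Function.update_of_ne he]
        simpa only [eq_comm] using this
      · simpa [he, hf] using h.cross e f hef

/-- Three induced paths that form a prism, or a degenerate prism if some path has one vertex. -/
abbrev IsTheta (G : SimpleGraph V) (L : Fin 3 → List V) : Prop :=
  LineModel G (fun _ => false) (fun _ => true) L

theorem IsTheta.crossing {L : Fin 3 → List V} (h : IsTheta G L) {e f : Fin 3} (hef : e ≠ f) :
    Cross G (L e) (L f) True False False True := by
  simpa using h.cross e f hef

theorem exists_cons_concat {Q : List V} {x : V} (hx : x ∈ Q) (h1 : Q.head? ≠ some x)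
    (h2 : Q.getLast? ≠ some x) : ∃ a I b, Q = a :: (I ++ [b]) ∧ x ∈ I := by
  cases Q with
  | nil => simp at hx
  | cons a t =>
    have hxt : x ∈ t := by
      rcases List.mem_cons.1 hx with rfl | h
      · simp at h1
      · exact h
    obtain ⟨I, b, rfl⟩ : ∃ I b, t = I ++ [b] :=
      List.eq_nil_or_concat t |>.resolve_left (List.ne_nil_of_mem hxt) |>.imp fun I h => by
        simpa using h
    refine ⟨a, I, b, rfl, ?_⟩
    rcases List.mem_append.1 hxt with h | h
    · exact h
    · obtain rfl := List.mem_singleton.1 h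
      rw [← List.cons_append, List.getLast?_concat] at h2
      exact absurd rfl h2

theorem IndPath.interior_ne {a b : V} {I : List V} (h : IndPath G (a :: (I ++ [b]))) :
    ∀ x ∈ I, x ≠ a ∧ x ≠ b := by
  have hn := h.nodup
  intro x hx
  rw [List.nodup_cons, List.nodup_append] at hn
  refine ⟨?_, fun hb => hn.2.2.2 x hx b (by simp) hb⟩
  rintro rfl
  exact hn.1 (by simp [hx])

/-- Replacing one path of a prism in a graph without odd holes. -/
theorem IsTheta.update (hG : ¬ HasOddHole G)
    (hK : ∀ L, LineModel G k4src k4tgt L → ¬ 6 < ∑ e, (L e).length) {L : Fin 3 → List V}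
    (h : IsTheta G L) {i : Fin 3} (hi : 2 ≤ (L i).length) {Q : List V} (hQ : IndPath G Q)
    (hhead : Q.head? = (L i).head?) (hlast : Q.getLast? = (L i).getLast?)
    (hint : ∀ x ∈ Q, Q.head? ≠ some x → Q.getLast? ≠ some x → ∀ j, j ≠ i → ∀ y ∈ L j,
      (L j).head? = some y ∨ (L j).getLast? = some y → ¬ G.Adj x y) :
    IsTheta G (Function.update L i Q) := by
  refine LineModel.update h i hQ hhead hlast ?_
  by_contra! hcon
  obtain ⟨x, hx, hx1, hx2, j, hj, y, hy, hxy⟩ := hcon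
  obtain ⟨k, hki, hkj⟩ : ∃ k : Fin 3, k ≠ i ∧ k ≠ j :=
    (by decide : ∀ i j : Fin 3, ∃ k : Fin 3, k ≠ i ∧ k ≠ j) i j
  obtain ⟨a, I, b, rfl, hxI⟩ := exists_cons_concat hx hx1 hx2
  have hab := hQ.interior_ne
  have hha : (L i).head? = some a := by rw [← hhead]; rfl
  have hlb : (L i).getLast? = some b := by
    rw [← hlast, ← List.cons_append, List.getLast?_concat]
  have hlast' : (a :: (I ++ [b])).getLast? = some b := by rw [hlast, hlb]
  have hint' : ∀ x ∈ I, ∀ j, j ≠ i → ∀ y ∈ L j,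
      (L j).head? = some y ∨ (L j).getLast? = some y → ¬ G.Adj x y := by
    intro x hx
    refine hint x (by simp [hx]) ?_ ?_
    · simpa using (hab x hx).1.symm
    · rw [hlast']; simpa using (hab x hx).2.symm
  have hends : ∀ m : Fin 3, ∃ p q, (L m).head? = some p ∧ (L m).getLast? = some q := by
    intro m
    have := h.ne_nil m
    exact ⟨(L m).head this, (L m).getLast this, List.head?_eq_some_head this,
      List.getLast?_eq_some_getLast this⟩
  -- A corner of one of the two other paths is adjacent to the corresponding corner of the other
  -- one, which the vertices of `I` are not.
  have corner : ∀ m n : Fin 3, m ≠ i → n ≠ i → m ≠ n → ∀ x ∈ I,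
      (L m).head? ≠ some x ∧ (L m).getLast? ≠ some x := by
    intro m n hm hn hmn x hx
    obtain ⟨p, q, hp, hq⟩ := hends n
    have hc := h.crossing hmn
    constructor
    · intro h1
      exact hint' x hx n hn p (List.mem_of_head? hp) (Or.inl hp)
        ((hc x (List.mem_of_head? h1) p (List.mem_of_head? hp)).2.2 (by simp [h1, hp]))
    · intro h1
      exact hint' x hx n hn q (List.mem_of_getLast? hq) (Or.inr hq)
        ((hc x (List.mem_of_getLast? h1) q (List.mem_of_getLast? hq)).2.2 (by simp [h1, hq]))
  have hi' : ∀ x ∈ I, (L i).head? ≠ some x ∧ (L i).getLast? ≠ some x := by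
    intro x hx
    rw [hha, hlb]
    have := hab x hx
    exact ⟨by simpa using this.1.symm, by simpa using this.2.symm⟩
  have hiI : IndPath G I := hQ.1.left
  -- The interior of the new path is attached to the old one at the common end `a`.
  have hu : ∃ x ∈ I, ∃ y ∈ L i, G.Adj x y := by
    cases I with
    | nil => simp at hxI
    | cons z t =>
      refine ⟨z, by simp, a, List.mem_of_head? hha, ?_⟩
      exact ((hQ.2 z (by simp)).2.2 (by simp)).symm
  have hw : ∃ x ∈ I, ∃ y ∈ L j ++ L k, G.Adj x y := by
    by_cases hxj : x = y
    · subst hxj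
      obtain ⟨z, hz, ha⟩ :=
        (h.indPath j).exists_adj_of_ne_head hy (corner j k hj hki hkj.symm x hxI).1
      exact ⟨x, hxI, z, by simp [hz], ha⟩
    · exact ⟨x, hxI, y, by simp [hy], hxy hxj⟩
  obtain ⟨M, hM, h6, -⟩ := exists_k4_of_connecting hG (h.indPath i) (h.indPath j) (h.indPath k) hiI
    (h.crossing hj.symm) (h.crossing hki.symm) (h.crossing hkj.symm) hi (h.ne_nil j) (h.ne_nil k)
    hi' (corner j k hj hki hkj.symm) (corner k j hki hj hkj)
    (fun x hx y hy ha => by have := hint' x hx j hj y hy; tauto)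
    (fun x hx y hy ha => by have := hint' x hx k hki y hy; tauto) hu hw
  exact hK M hM h6

end Replacement

/-! ### Oriented paths in the line graph of a subdivision of `K₄`, and replacing one of them. -/

section K4Segments

variable {V : Type*} {G : SimpleGraph V}

/-- The index of the edge of `K₄` between two vertices. -/
def k4idx : Fin 4 → Fin 4 → Fin 6 := ![![0, 0, 1, 2], ![0, 0, 3, 4], ![1, 3, 0, 5], ![2, 4, 5, 0]]

/-- The path of the edge `uv` of `K₄`, from `u` to `v`. -/
def seg (L : Fin 6 → List V) (u v : Fin 4) : List V :=
  if u < v then L (k4idx u v) else (L (k4idx u v)).reverse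

theorem k4src_idx : ∀ u v : Fin 4, u ≠ v → k4src (k4idx u v) = if u < v then u else v := by decide

theorem k4tgt_idx : ∀ u v : Fin 4, u ≠ v → k4tgt (k4idx u v) = if u < v then v else u := by decide

theorem k4idx_comm : ∀ u v : Fin 4, k4idx v u = k4idx u v := by decide

theorem k4idx_injective : ∀ p q r s : Fin 4, p ≠ q → r ≠ s → k4idx p q = k4idx r s →
    (p = r ∧ q = s) ∨ (p = s ∧ q = r) := by decide

theorem k4idx_cases : ∀ v x z w : Fin 4, v ≠ x → v ≠ z → v ≠ w → x ≠ z → x ≠ w → z ≠ w → ∀ j,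
    j = k4idx v x ∨ j = k4idx z v ∨ j = k4idx v w ∨ j = k4idx z x ∨ j = k4idx x w ∨
      j = k4idx z w := by decide

/-- Three edges meet at `p`, so one remains besides `pq` and `i`. It supplies a neighbouring corner
when a vertex is shown not to be a corner. -/
theorem exists_k4idx_ne : ∀ (i : Fin 6) (p q : Fin 4), p ≠ q → k4idx p q ≠ i →
    ∃ r, p ≠ r ∧ q ≠ r ∧ k4idx p r ≠ i := by decide

theorem exists_other_vertices : ∀ i : Fin 6, ∃ z w : Fin 4, k4src i ≠ k4tgt i ∧ k4src i ≠ z ∧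
    k4src i ≠ w ∧ k4tgt i ≠ z ∧ k4tgt i ≠ w ∧ z ≠ w ∧ k4idx (k4src i) (k4tgt i) = i := by decide

theorem k4idx_src_tgt : ∀ e : Fin 6, k4idx (k4src e) (k4tgt e) = e := by decide

theorem k4src_lt_tgt : ∀ e : Fin 6, k4src e < k4tgt e := by decide

theorem seg_src_tgt (L : Fin 6 → List V) (e : Fin 6) : seg L (k4src e) (k4tgt e) = L e := by
  rw [seg, if_pos (k4src_lt_tgt e), k4idx_src_tgt]

theorem seg_reverse (L : Fin 6 → List V) {u v : Fin 4} (huv : u ≠ v) :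
    (seg L u v).reverse = seg L v u := by
  unfold seg
  rw [k4idx_comm u v]
  rcases lt_or_gt_of_ne huv with h | h
  · rw [if_pos h, if_neg h.not_gt]
  · rw [if_pos h, if_neg h.not_gt, List.reverse_reverse]

theorem mem_seg {L : Fin 6 → List V} {u v : Fin 4} {x : V} :
    x ∈ seg L u v ↔ x ∈ L (k4idx u v) := by
  unfold seg
  split_ifs <;> simp

theorem length_seg {L : Fin 6 → List V} {u v : Fin 4} :
    (seg L u v).length = (L (k4idx u v)).length := by
  unfold seg
  split_ifs <;> simp

theorem seg_end {L : Fin 6 → List V} {u v : Fin 4} {x : V}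
    (h : (seg L u v).head? = some x ∨ (seg L u v).getLast? = some x) :
    (L (k4idx u v)).head? = some x ∨ (L (k4idx u v)).getLast? = some x := by
  unfold seg at h
  split_ifs at h
  · exact h
  · simpa [or_comm] using h

theorem seg_ne_nil {L : Fin 6 → List V} (h : LineModel G k4src k4tgt L) (u v : Fin 4) :
    seg L u v ≠ [] := by
  have := h.ne_nil (k4idx u v)
  unfold seg
  split_ifs <;> simpa

theorem seg_indPath {L : Fin 6 → List V} (h : LineModel G k4src k4tgt L) (u v : Fin 4) :
    IndPath G (seg L u v) := by
  have := h.indPath (k4idx u v)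
  unfold seg
  split_ifs
  · exact this
  · exact indPath_reverse.2 this

theorem seg_star {L : Fin 6 → List V} (h : LineModel G k4src k4tgt L) {p q r : Fin 4}
    (hpq : p ≠ q) (hpr : p ≠ r) (hqr : q ≠ r) :
    Cross G (seg L p q) (seg L p r) True False False False := by
  have hc := h.cross (k4idx p q) (k4idx p r) (by
    intro he
    have := k4idx_injective p q p r hpq hpr he
    tauto)
  rw [k4src_idx p q hpq, k4src_idx p r hpr, k4tgt_idx p q hpq, k4tgt_idx p r hpr] at hc
  unfold seg
  split_ifs at hc ⊢ <;> simpa [cross_reverse_left, cross_reverse_right, hpq, hpr, hqr, hpq.symm,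
    hpr.symm, hqr.symm] using hc

theorem seg_opp {L : Fin 6 → List V} (h : LineModel G k4src k4tgt L) {p q r s : Fin 4}
    (hpq : p ≠ q) (hrs : r ≠ s) (hpr : p ≠ r) (hps : p ≠ s) (hqr : q ≠ r) (hqs : q ≠ s) :
    Cross G (seg L p q) (seg L r s) False False False False := by
  have hc := h.cross (k4idx p q) (k4idx r s) (by
    intro he
    have := k4idx_injective p q r s hpq hrs he
    tauto)
  rw [k4src_idx p q hpq, k4src_idx r s hrs, k4tgt_idx p q hpq, k4tgt_idx r s hrs] at hc
  unfold seg
  split_ifs at hc ⊢ <;> simpa [cross_reverse_left, cross_reverse_right, hpr, hps, hqr, hqs] using hc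

theorem sum_length_k4 (L : Fin 6 → List V) {v x z w : Fin 4} (h1 : v ≠ x) (h2 : v ≠ z)
    (h3 : v ≠ w) (h4 : x ≠ z) (h5 : x ≠ w) (h6 : z ≠ w) : ∑ e, (L e).length =
      (seg L v x).length + (seg L z v).length + (seg L v w).length + (seg L z x).length +
        (seg L x w).length + (seg L z w).length := by
  have hp : ∀ v x z w : Fin 4, v ≠ x → v ≠ z → v ≠ w → x ≠ z → x ≠ w → z ≠ w →
    (List.finRange 6).Perm
      [k4idx v x, k4idx z v, k4idx v w, k4idx z x, k4idx x w, k4idx z w] := by decide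
  have := ((hp v x z w h1 h2 h3 h4 h5 h6).map fun e => (L e).length).sum_eq
  rw [← List.ofFn_eq_map, List.sum_ofFn] at this
  simp only [length_seg]
  rw [this]
  simp [add_assoc]

/-- Deleting the path of the edge `zw` of `K₄` leaves a path with the ends of two other paths. -/
theorem seg_append_indPath {L : Fin 6 → List V} (h : LineModel G k4src k4tgt L) {z v w : Fin 4}
    (h1 : z ≠ v) (h2 : v ≠ w) (h3 : z ≠ w) : IndPath G (seg L z v ++ seg L v w) := by
  refine indPath_append.2 ⟨seg_indPath h _ _, seg_indPath h _ _, ?_⟩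
  have := seg_star h h1.symm h2 h3
  rwa [← seg_reverse L h1, cross_reverse_left] at this

/-- The paths of `K₄` between two vertices, one direct and two through the other vertices. -/
theorem seg_theta {L : Fin 6 → List V} (h : LineModel G k4src k4tgt L) {v x z w : Fin 4}
    (h1 : v ≠ x) (h2 : v ≠ z) (h3 : v ≠ w) (h4 : x ≠ z) (h5 : x ≠ w) (h6 : z ≠ w) :
    Cross G (seg L z v ++ seg L v w) (seg L z x ++ seg L x w) True False False True ∧
    Cross G (seg L z v ++ seg L v w) (seg L z w) True False False True := by
  have hw : ∀ p q, p ≠ w → q ≠ w → p ≠ q → Cross G (seg L p w) (seg L q w) False False False True := by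
    intro p q hp hq hpq
    have := seg_star h hp.symm hq.symm hpq
    rwa [← seg_reverse L hp, ← seg_reverse L hq, cross_reverse_left, cross_reverse_right] at this
  constructor
  · refine Cross.append_left (seg_ne_nil h _ _) (seg_ne_nil h _ _) ?_ ?_
    · exact Cross.append_right_anti (seg_ne_nil h _ _) (seg_star h h2.symm h4.symm h1)
        (seg_opp h h2.symm h5 h4.symm h6 h1 h3)
    · exact Cross.anti_append_right (seg_ne_nil h _ _) (seg_opp h h3 h4.symm h2 h1 h6.symm h5.symm)
        (hw v x h3 h5 h1)
  · exact Cross.append_left (seg_ne_nil h _ _) (seg_ne_nil h _ _) (seg_star h h2.symm h6 h3)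
      (hw v z h3 h6 h2)

set_option maxHeartbeats 1000000 in
/-- Replacing one path of a smallest line graph of a subdivision of `K₄` in a graph without odd
holes. -/
theorem LineModel.update_k4 (hG : ¬ HasOddHole G) {L : Fin 6 → List V}
    (h : LineModel G k4src k4tgt L)
    (hmin : ∀ L', LineModel G k4src k4tgt L' → 6 < ∑ e, (L' e).length →
      ∑ e, (L e).length ≤ ∑ e, (L' e).length) {i : Fin 6} {Q : List V} (hQ : IndPath G Q)
    (hhead : Q.head? = (L i).head?) (hlast : Q.getLast? = (L i).getLast?)
    (hlen : Q.length ≤ (L i).length)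
    (hint : ∀ x ∈ Q, Q.head? ≠ some x → Q.getLast? ≠ some x → ∀ j, j ≠ i → ∀ y ∈ L j,
      (L j).head? = some y ∨ (L j).getLast? = some y → ¬ G.Adj x y) :
    LineModel G k4src k4tgt (Function.update L i Q) := by
  refine h.update i hQ hhead hlast ?_
  by_contra! hcon
  obtain ⟨x₀, hx₀, hx1, hx2, j, hj, y₀, hy₀, hxy⟩ := hcon
  obtain ⟨a, I, b, rfl, hxI⟩ := exists_cons_concat hx₀ hx1 hx2
  have hab := hQ.interior_ne
  have hne : a ≠ b := (hQ.2 b (by simp)).1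
  have hlast' : (a :: (I ++ [b])).getLast? = some b := by
    rw [← List.cons_append, List.getLast?_concat]
  have hint' : ∀ x ∈ I, ∀ j, j ≠ i → ∀ y ∈ L j,
      (L j).head? = some y ∨ (L j).getLast? = some y → ¬ G.Adj x y := by
    intro x hx
    refine hint x (by simp [hx]) ?_ ?_
    · simpa using (hab x hx).1.symm
    · rw [hlast']; simpa using (hab x hx).2.symm
  obtain ⟨v, x, z, w, hvx, hvz, hvw, hxz, hxw, hzw, hi, hLi⟩ : ∃ v x z w : Fin 4, v ≠ x ∧ v ≠ z ∧
      v ≠ w ∧ x ≠ z ∧ x ≠ w ∧ z ≠ w ∧ k4idx v x = i ∧ seg L v x = L i := by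
    obtain ⟨z, w, h⟩ := exists_other_vertices i
    exact ⟨k4src i, k4tgt i, z, w, h.1, h.2.1, h.2.2.1, h.2.2.2.1, h.2.2.2.2.1, h.2.2.2.2.2.1,
      h.2.2.2.2.2.2, seg_src_tgt L i⟩
  have hidx : ∀ p q, p ≠ q → ¬ (p = v ∧ q = x) → ¬ (p = x ∧ q = v) → k4idx p q ≠ i := by
    intro p q hpq h1 h2 he
    exact (k4idx_injective p q v x hpq hvx (he.trans hi.symm)).elim h1 h2
  have hha : (seg L v x).head? = some a := by rw [hLi, ← hhead]; rfl
  have hlb : (seg L v x).getLast? = some b := by rw [hLi, ← hlast, hlast']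
  have hhb : (seg L x v).head? = some b := by
    rw [← seg_reverse L hvx, List.head?_reverse, hlb]
  have ha := List.mem_of_head? hha
  have hb := List.mem_of_getLast? hlb
  -- the vertices of `I` are not adjacent to corners, and are no corners
  have hadj : ∀ p q, p ≠ q → k4idx p q ≠ i → ∀ x ∈ I, ∀ y ∈ seg L p q, G.Adj x y →
      (seg L p q).head? ≠ some y ∧ (seg L p q).getLast? ≠ some y := by
    intro p q hpq hpi x hx y hy hxy
    have := hint' x hx _ hpi y (mem_seg.1 hy)
    constructor
    · exact fun h1 => this (seg_end (Or.inl h1)) hxy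
    · exact fun h1 => this (seg_end (Or.inr h1)) hxy
  have hcor1 : ∀ p q, p ≠ q → k4idx p q ≠ i → ∀ x ∈ I, (seg L p q).head? ≠ some x := by
    intro p q hpq hpi x hx hx'
    obtain ⟨r, hr1, hr2, hr3⟩ := exists_k4idx_ne i p q hpq hpi
    have hs := seg_star h hpq hr1 hr2
    have hne := seg_ne_nil h p r
    have hhd := List.head?_eq_some_head hne
    have hmem := List.mem_of_head? hhd
    exact (hadj p r hr1 hr3 x hx _ hmem ((hs x (List.mem_of_head? hx') _ hmem).2.2
      (by simp [hx', hhd]))).1 hhd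
  have hcor : ∀ p q, p ≠ q → k4idx p q ≠ i → ∀ x ∈ I, (seg L p q).head? ≠ some x ∧
      (seg L p q).getLast? ≠ some x := by
    intro p q hpq hpi x hx
    refine ⟨hcor1 p q hpq hpi x hx, ?_⟩
    have := hcor1 q p hpq.symm (by rwa [k4idx_comm]) x hx
    rwa [← seg_reverse L hpq, List.head?_reverse] at this
  have ezv := hidx z v hvz.symm (by grind) (by grind)
  have evw := hidx v w hvw (by grind) (by grind)
  have ezx := hidx z x hxz.symm (by grind) (by grind)
  have exw := hidx x w hxw (by grind) (by grind)
  have ezw := hidx z w hzw (by grind) (by grind)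
  -- the ends of `L i`
  have sv : ∀ q, q ≠ v → q ≠ x → ∀ c ∈ seg L v x, ∀ y ∈ seg L v q, c ≠ y ∧
      (G.Adj c y → c = a) := by
    intro q hqv hqx c hc y hy
    have hs := seg_star h hvx hqv.symm hqx.symm c hc y hy
    refine ⟨hs.1, fun hcy => ?_⟩
    have := hs.2.1 hcy
    simp only [hha, Option.some_inj, true_and, false_and, or_false] at this
    exact this.1.symm
  have sx : ∀ q, q ≠ v → q ≠ x → ∀ c ∈ seg L v x, ∀ y ∈ seg L x q, c ≠ y ∧
      (G.Adj c y → c = b) := by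
    intro q hqv hqx c hc y hy
    have hs := seg_star h hvx.symm hqx.symm hqv.symm c (by
      rw [← seg_reverse L hvx]; simpa using hc) y hy
    refine ⟨hs.1, fun hcy => ?_⟩
    have := hs.2.1 hcy
    simp only [hhb, Option.some_inj, true_and, false_and, or_false] at this
    exact this.1.symm
  have so : ∀ c ∈ seg L v x, ∀ y ∈ seg L z w, c ≠ y ∧ ¬ G.Adj c y :=
    anti_iff.1 (seg_opp h hvx hzw hvz hvw hxz hxw)
  have mem_rev : ∀ p q, p ≠ q → ∀ y, y ∈ seg L p q → y ∈ seg L q p := by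
    intro p q hpq y hy
    rw [← seg_reverse L hpq]; simpa using hy
  -- Without the path of `vx`, the vertices `z` and `w` become the triangles of a prism; its paths
  -- go through `v`, through `x`, and directly.
  set A₁ := seg L z v ++ seg L v w with hA1
  set A₂ := seg L z x ++ seg L x w with hA2
  set A₃ := seg L z w with hA3
  have i1 : IndPath G A₁ := seg_append_indPath h hvz.symm hvw hzw
  have i2 : IndPath G A₂ := seg_append_indPath h hxz.symm hxw hzw
  have i3 : IndPath G A₃ := seg_indPath h _ _
  obtain ⟨c12, c13⟩ := seg_theta h hvx hvz hvw hxz hxw hzw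
  obtain ⟨-, c23⟩ := seg_theta h hvx.symm hxz hxw hvz hvw hzw
  have e1 : A₁.head? = (seg L z v).head? ∧ A₁.getLast? = (seg L v w).getLast? := by
    rw [hA1, List.getLast?_append_of_ne_nil _ (seg_ne_nil h _ _),
      List.head?_append_of_ne_nil _ (seg_ne_nil h _ _)]
    exact ⟨rfl, rfl⟩
  have e2 : A₂.head? = (seg L z x).head? ∧ A₂.getLast? = (seg L x w).getLast? := by
    rw [hA2, List.getLast?_append_of_ne_nil _ (seg_ne_nil h _ _),
      List.head?_append_of_ne_nil _ (seg_ne_nil h _ _)]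
    exact ⟨rfl, rfl⟩
  have p1 := List.length_pos_iff.2 (seg_ne_nil h z v)
  have p2 := List.length_pos_iff.2 (seg_ne_nil h v w)
  have p3 := List.length_pos_iff.2 (seg_ne_nil h z x)
  have p4 := List.length_pos_iff.2 (seg_ne_nil h x w)
  have l1 : A₁.length = (seg L z v).length + (seg L v w).length := by simp [hA1]
  have l2 : A₂.length = (seg L z x).length + (seg L x w).length := by simp [hA2]
  have l3 : A₃.length = (seg L z w).length := rfl
  have hsum := sum_length_k4 L hvx hvz hvw hxz hxw hzw
  rw [← hLi] at hlen
  simp only [List.length_cons, List.length_append, List.length_nil] at hlen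
  -- every vertex of `A₁` and `A₂` against an end
  have va : ∀ y ∈ A₁, ∀ c ∈ seg L v x, c ≠ y ∧ (G.Adj c y → c = a) := by
    intro y hy c hc
    rcases List.mem_append.1 hy with hy | hy
    · exact sv z hvz.symm hxz.symm c hc y (mem_rev _ _ hvz.symm y hy)
    · exact sv w hvw.symm hxw.symm c hc y hy
  have vb : ∀ y ∈ A₂, ∀ c ∈ seg L v x, c ≠ y ∧ (G.Adj c y → c = b) := by
    intro y hy c hc
    rcases List.mem_append.1 hy with hy | hy
    · exact sx z hvz.symm hxz.symm c hc y (mem_rev _ _ hxz.symm y hy)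
    · exact sx w hvw.symm hxw.symm c hc y hy
  have kA1 : ∀ x ∈ I, A₁.head? ≠ some x ∧ A₁.getLast? ≠ some x := fun x hx => by
    rw [e1.1, e1.2]
    exact ⟨(hcor _ _ hvz.symm ezv x hx).1, (hcor _ _ hvw evw x hx).2⟩
  have kA2 : ∀ x ∈ I, A₂.head? ≠ some x ∧ A₂.getLast? ≠ some x := fun x hx => by
    rw [e2.1, e2.2]
    exact ⟨(hcor _ _ hxz.symm ezx x hx).1, (hcor _ _ hxw exw x hx).2⟩
  have kA3 : ∀ x ∈ I, A₃.head? ≠ some x ∧ A₃.getLast? ≠ some x := hcor _ _ hzw ezw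
  have nA1 : ∀ x ∈ I, ∀ y ∈ A₁, G.Adj x y → A₁.head? ≠ some y ∧ A₁.getLast? ≠ some y := by
    intro x hx y hy hxy
    rw [e1.1, e1.2]
    exact ⟨fun h1 => (hadj _ _ hvz.symm ezv x hx y (List.mem_of_head? h1) hxy).1 h1,
      fun h1 => (hadj _ _ hvw evw x hx y (List.mem_of_getLast? h1) hxy).2 h1⟩
  have nA2 : ∀ x ∈ I, ∀ y ∈ A₂, G.Adj x y → A₂.head? ≠ some y ∧ A₂.getLast? ≠ some y := by
    intro x hx y hy hxy
    rw [e2.1, e2.2]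
    exact ⟨fun h1 => (hadj _ _ hxz.symm ezx x hx y (List.mem_of_head? h1) hxy).1 h1,
      fun h1 => (hadj _ _ hxw exw x hx y (List.mem_of_getLast? h1) hxy).2 h1⟩
  have nA3 : ∀ x ∈ I, ∀ y ∈ A₃, G.Adj x y → A₃.head? ≠ some y ∧ A₃.getLast? ≠ some y :=
    hadj _ _ hzw ezw
  -- The new path is attached to `A₁` by `a` and to `A₂` by `b`. If its interior sees `A₂` or `A₃`,
  -- then `a :: I` is already connecting; otherwise the interior sees `A₁`, and `I ++ [b]` connects
  -- with the roles of `A₁` and `A₂` exchanged. Either way one vertex is saved, against minimality.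
  by_cases hW : ∃ x ∈ I, ∃ y ∈ A₂ ++ A₃, G.Adj x y
  · have hI' : IndPath G (a :: I) := by
      rw [← List.cons_append] at hQ
      exact hQ.left
    have hu : ∃ x ∈ a :: I, ∃ y ∈ A₁, G.Adj x y := by
      have hhd := List.head?_eq_some_head (seg_ne_nil h v w)
      have hmem := List.mem_of_head? hhd
      exact ⟨a, by simp, _, List.mem_append_right _ hmem,
        (seg_star h hvx hvw hxw a ha _ hmem).2.2 (by simp [hha, hhd])⟩
    obtain ⟨M, hM, hM6, hMl⟩ := exists_k4_of_connecting hG i1 i2 i3 hI' c12 c13 c23 (by omega)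
      (List.ne_nil_of_length_pos (by omega)) (seg_ne_nil h _ _)
      (by
        rintro x (_ | ⟨_, hx⟩)
        · exact ⟨fun h1 => (va _ (List.mem_of_head? h1) a ha).1 rfl,
            fun h1 => (va _ (List.mem_of_getLast? h1) a ha).1 rfl⟩
        · exact kA1 x hx)
      (by
        rintro x (_ | ⟨_, hx⟩)
        · exact ⟨fun h1 => (vb _ (List.mem_of_head? h1) a ha).1 rfl,
            fun h1 => (vb _ (List.mem_of_getLast? h1) a ha).1 rfl⟩
        · exact kA2 x hx)
      (by
        rintro x (_ | ⟨_, hx⟩)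
        · exact ⟨fun h1 => (so a ha _ (List.mem_of_head? h1)).1 rfl,
            fun h1 => (so a ha _ (List.mem_of_getLast? h1)).1 rfl⟩
        · exact kA3 x hx)
      (by
        rintro x (_ | ⟨_, hx⟩) y hy hxy
        · exact absurd ((vb y hy a ha).2 hxy) hne
        · exact nA2 x hx y hy hxy)
      (by
        rintro x (_ | ⟨_, hx⟩) y hy hxy
        · exact absurd hxy (so a ha y hy).2
        · exact nA3 x hx y hy hxy)
      hu (hW.imp fun x hx => ⟨by simp [hx.1], hx.2⟩)
    have := hmin M hM hM6
    simp only [List.length_cons] at hMl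
    omega
  · have hI' : IndPath G (I ++ [b]) := hQ.1
    have hu : ∃ x ∈ I ++ [b], ∃ y ∈ A₂, G.Adj x y := by
      have hhd := List.head?_eq_some_head (seg_ne_nil h x w)
      have hmem := List.mem_of_head? hhd
      exact ⟨b, by simp, _, List.mem_append_right _ hmem,
        (seg_star h hvx.symm hxw hvw b (List.mem_of_head? hhb) _ hmem).2.2 (by simp [hhb, hhd])⟩
    have hU : ∃ x ∈ I, ∃ y ∈ A₁, G.Adj x y := by
      obtain ⟨p, q, hpq, hpj⟩ : ∃ p q : Fin 4, p ≠ q ∧ k4idx p q = j :=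
        ⟨_, _, (k4src_lt_tgt j).ne, k4idx_src_tgt j⟩
      have hA : ∀ y, y ∈ L j → y ∈ A₁ ∨ y ∈ A₂ ++ A₃ := by
        intro y hy
        rcases k4idx_cases v x z w hvx hvz hvw hxz hxw hzw j with h | h | h | h | h | h
        · exact absurd (h.trans hi) hj
        all_goals
          subst h
          simp [hA1, hA2, hA3, mem_seg, hy]
      have hadj' : ∃ y ∈ L j, G.Adj x₀ y := by
        by_cases hxy' : x₀ = y₀
        · subst hxy'
          subst hpj
          obtain ⟨y, hy, hxy⟩ := (seg_indPath h p q).exists_adj_of_ne_head (mem_seg.2 hy₀)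
            (hcor p q hpq hj x₀ hxI).1
          exact ⟨y, mem_seg.1 hy, hxy⟩
        · exact ⟨y₀, hy₀, hxy hxy'⟩
      obtain ⟨y, hy, hxy⟩ := hadj'
      rcases hA y hy with h1 | h1
      · exact ⟨x₀, hxI, y, h1, hxy⟩
      · exact absurd ⟨x₀, hxI, y, h1, hxy⟩ hW
    obtain ⟨M, hM, hM6, hMl⟩ := exists_k4_of_connecting hG i2 i1 i3 hI' c12.symm c23 c13 (by omega)
      (List.ne_nil_of_length_pos (by omega)) (seg_ne_nil h _ _)
      (by
        intro x hx
        rcases List.mem_append.1 hx with hx | hx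
        · exact kA2 x hx
        · obtain rfl := List.mem_singleton.1 hx
          exact ⟨fun h1 => (vb _ (List.mem_of_head? h1) _ hb).1 rfl,
            fun h1 => (vb _ (List.mem_of_getLast? h1) _ hb).1 rfl⟩)
      (by
        intro x hx
        rcases List.mem_append.1 hx with hx | hx
        · exact kA1 x hx
        · obtain rfl := List.mem_singleton.1 hx
          exact ⟨fun h1 => (va _ (List.mem_of_head? h1) _ hb).1 rfl,
            fun h1 => (va _ (List.mem_of_getLast? h1) _ hb).1 rfl⟩)
      (by
        intro x hx
        rcases List.mem_append.1 hx with hx | hx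
        · exact kA3 x hx
        · obtain rfl := List.mem_singleton.1 hx
          exact ⟨fun h1 => (so _ hb _ (List.mem_of_head? h1)).1 rfl,
            fun h1 => (so _ hb _ (List.mem_of_getLast? h1)).1 rfl⟩)
      (by
        intro x hx y hy hxy
        rcases List.mem_append.1 hx with hx | hx
        · exact nA1 x hx y hy hxy
        · obtain rfl := List.mem_singleton.1 hx
          exact absurd ((va y hy _ hb).2 hxy) hne.symm)
      (by
        intro x hx y hy hxy
        rcases List.mem_append.1 hx with hx | hx
        · exact nA3 x hx y hy hxy
        · obtain rfl := List.mem_singleton.1 hx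
          exact absurd hxy (so _ hb y hy).2)
      hu (by
        obtain ⟨x, hx, y, hy, hxy⟩ := hU
        exact ⟨x, by simp [hx], y, by simp [hy], hxy⟩)
    have := hmin M hM hM6
    simp only [List.length_append, List.length_cons, List.length_nil] at hMl
    omega

end K4Segments

/-! ### Translation between lists and walks, and the exchange property of prisms. -/

section Walks

variable {V : Type*} {G : SimpleGraph V}

theorem indPath_support_iff {a b : V} {w : G.Walk a b} : IndPath G w.support ↔
    w.IsPath ∧ ∀ x ∈ w.support, ∀ y ∈ w.support, G.Adj x y → s(x, y) ∈ w.edges := by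
  induction w with
  | nil => simp [IndPath]
  | @cons u v b h p ih =>
    rw [SimpleGraph.Walk.support_cons, indPath_cons, ih, SimpleGraph.Walk.cons_isPath_iff]
    have hh : p.support.head? = some v := by
      rw [← SimpleGraph.Walk.cons_tail_support]; rfl
    rw [hh]
    constructor
    · rintro ⟨⟨h1, h2⟩, h3⟩
      have hu : u ∉ p.support := fun hu => (h3 u hu).1 rfl
      refine ⟨⟨h1, hu⟩, ?_⟩
      intro x hx y hy hxy
      rw [SimpleGraph.Walk.edges_cons, List.mem_cons]
      have key : ∀ z ∈ p.support, G.Adj u z → z = v := fun z hz huz => by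
        simpa [eq_comm] using (h3 z hz).2.1 huz
      rcases List.mem_cons.1 hx with hx | hx <;> rcases List.mem_cons.1 hy with hy | hy
      · exact absurd (hx.trans hy.symm) hxy.ne
      · rw [hx] at hxy ⊢
        exact Or.inl (by rw [key y hy hxy])
      · rw [hy] at hxy ⊢
        exact Or.inl (by rw [key x hx hxy.symm, Sym2.eq_swap])
      · exact Or.inr (h2 x hx y hy hxy)
    · rintro ⟨⟨h1, hu⟩, h2⟩
      refine ⟨⟨h1, fun x hx y hy hxy => ?_⟩, fun y hy => ⟨fun he => hu (he ▸ hy), ?_⟩⟩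
      · have := h2 x (by simp [hx]) y (by simp [hy]) hxy
        rw [SimpleGraph.Walk.edges_cons, List.mem_cons] at this
        refine this.resolve_left fun he => ?_
        rw [Sym2.eq_iff] at he
        rcases he with ⟨rfl, -⟩ | ⟨-, rfl⟩
        · exact hu hx
        · exact hu hy
      · constructor
        · intro hxy
          have := h2 u (by simp) y (by simp [hy]) hxy
          rw [SimpleGraph.Walk.edges_cons, List.mem_cons] at this
          rcases this with he | he
          · rw [Sym2.eq_iff] at he
            rcases he with ⟨-, rfl⟩ | ⟨rfl, rfl⟩
            · rfl
            · rfl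
          · exact absurd (p.fst_mem_support_of_mem_edges he) hu
        · intro he
          simp only [Option.some_inj] at he
          exact he ▸ h

theorem IndPath.exists_walk {l : List V} (hl : IndPath G l) {a b : V} (ha : l.head? = some a)
    (hb : l.getLast? = some b) : ∃ w : G.Walk a b, w.support = l := by
  induction l generalizing a with
  | nil => simp at ha
  | cons x t ih =>
    obtain rfl : x = a := by simpa using ha
    cases t with
    | nil =>
      obtain rfl : x = b := by simpa using hb
      exact ⟨.nil, rfl⟩
    | cons y t =>
      obtain ⟨w, hw⟩ := ih hl.1 rfl (by simpa using hb)
      exact ⟨.cons ((hl.2 y (by simp)).2.2 rfl) w, by simp [hw]⟩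

theorem head?_support {a b : V} (w : G.Walk a b) : w.support.head? = some a := by
  rw [← SimpleGraph.Walk.cons_tail_support]; rfl

theorem getLast?_support {a b : V} (w : G.Walk a b) : w.support.getLast? = some b := by
  rw [List.getLast?_eq_some_getLast w.support_ne_nil, SimpleGraph.Walk.getLast_support]

/-- `IsTheta` also admits paths with a single vertex, where the triangles would meet; `a i ≠ b i`
excludes exactly these. -/
theorem formsPrism_iff {a b : Fin 3 → V} {P : ∀ i : Fin 3, G.Walk (a i) (b i)} :
    FormsPrism G a b P ↔ IsTheta G (fun i => (P i).support) ∧ ∀ i, a i ≠ b i := by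
  constructor
  · intro h
    refine ⟨⟨fun i => (P i).support_ne_nil, fun i => ?_, fun i j hij x hx y hy => ⟨?_, ?_⟩⟩,
      fun i => h.triangles_disjoint i i⟩
    · refine indPath_support_iff.2 ⟨h.isPath i, fun x hx y hy hxy => ?_⟩
      simpa using (h.adj_iff i i x hx y hy).1 hxy
    · rintro rfl
      exact h.paths_disjoint i j hij x hx hy
    · rw [h.adj_iff i j x hx y hy, head?_support, head?_support, getLast?_support,
        getLast?_support]
      simp [hij, eq_comm]
  · rintro ⟨h, hab⟩
    refine ⟨fun i => (indPath_support_iff.1 (h.indPath i)).1, fun i j => ?_, fun i j hij x hx hy =>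
      (h.crossing hij).disjoint hx hy, fun i j x hx y hy => ?_⟩
    · by_cases hij : i = j
      · subst hij; exact hab i
      · intro he
        have hm : ∀ x, x = b j → x ∈ (P j).support := by
          rintro x rfl; exact (P j).end_mem_support
        exact (h.crossing hij).disjoint (P i).start_mem_support (hm _ he)
    · by_cases hij : i = j
      · subst hij
        have := (indPath_support_iff.1 (h.indPath i)).2 x hx y hy
        simp only [true_and, ne_eq, not_true_eq_false, false_and, or_false]
        exact ⟨this, fun he => (P i).adj_of_mem_edges he⟩
      · rw [((h.crossing hij) x hx y hy).2, head?_support, head?_support, getLast?_support,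
          getLast?_support]
        simp [hij, eq_comm]

/-- Any two paths of a prism form a hole, so all three have the same parity. -/
theorem IsTheta.even_add (hG : ¬ HasOddHole G) {L : Fin 3 → List V} (h : IsTheta G L)
    (h2 : ∀ i, 2 ≤ (L i).length) (i j : Fin 3) : Even ((L i).length + (L j).length) := by
  by_cases hij : i = j
  · subst hij; exact Even.add_self _
  · refine even_add_length_of_hole hG (h.indPath i) (h.indPath j) (h.crossing hij) (h.ne_nil i)
      (h.ne_nil j) ?_
    have := h2 i
    have := h2 j
    omega

/-- A prism all of whose paths have an even number of vertices is an odd prism. -/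
theorem IsTheta.inducesOddPrism {L : Fin 3 → List V} (h : IsTheta G L)
    (he : ∀ i, Even (L i).length) : InducesOddPrism G {x | ∃ i, x ∈ L i} := by
  choose P hP using fun i => (h.indPath i).exists_walk (List.head?_eq_some_head (h.ne_nil i))
    (List.getLast?_eq_some_getLast (h.ne_nil i))
  have hl : ∀ i, (P i).length + 1 = (L i).length := fun i => by
    rw [← SimpleGraph.Walk.length_support, hP]
  refine ⟨_, _, P, formsPrism_iff.2 ⟨by simpa only [hP] using h, fun i hab => ?_⟩, fun i => ?_, ?_⟩
  · have h1 := hl i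
    have hp := (indPath_support_iff.1 (hP i ▸ h.indPath i)).1
    have h0 : (P i).length = 0 := by
      have : ∀ {x y : V} (w : G.Walk x y), w.IsPath → x = y → w.length = 0 := by
        rintro x y w hw rfl
        exact SimpleGraph.Walk.length_eq_zero_iff.2 (SimpleGraph.Walk.isPath_iff_nil.1 hw)
      exact this _ hp hab
    have := he i
    rw [← h1, h0] at this
    simp at this
  · have := he i
    rw [← hl i] at this
    grind
  · simp [hP]

theorem support_update {a b : Fin 3 → V} (P : ∀ i : Fin 3, G.Walk (a i) (b i)) (i : Fin 3)
    (Q : G.Walk (a i) (b i)) : (fun j => (Function.update P i Q j).support) =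
      Function.update (fun j => (P j).support) i Q.support := by
  ext1 j
  by_cases hj : j = i
  · subst hj; simp
  · simp [hj]

/-- Replacing a path of a prism by a chordless path. -/
theorem FormsPrism.update (hG : ¬ HasOddHole G)
    (hK : ∀ L, LineModel G k4src k4tgt L → ¬ 6 < ∑ e, (L e).length) {a b : Fin 3 → V}
    {P : ∀ i : Fin 3, G.Walk (a i) (b i)} (h : FormsPrism G a b P) (i : Fin 3)
    (Q : G.Walk (a i) (b i)) (hQ : Q.IsPath) (hQc : Q.IsChordless)
    (hint : ∀ x ∈ Q.support, x ≠ a i → x ≠ b i → ∀ j, j ≠ i → ¬ G.Adj x (a j) ∧ ¬ G.Adj x (b j)) :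
    FormsPrism G a b (Function.update P i Q) ∧
      (((∀ j, Odd (P j).length) ∧ ∀ j, Odd (Function.update P i Q j).length) ∨
        ((∀ j, Even (P j).length) ∧ ∀ j, Even (Function.update P i Q j).length)) := by
  obtain ⟨hT, hab⟩ := formsPrism_iff.1 h
  have len : ∀ {x y : V} (w : G.Walk x y), x ≠ y → 2 ≤ w.support.length := by
    intro x y w hxy
    rw [SimpleGraph.Walk.length_support]
    have : w.length ≠ 0 := fun h0 => hxy (SimpleGraph.Walk.eq_of_length_eq_zero h0)
    omega
  have hQi : IndPath G Q.support :=
    indPath_support_iff.2 ⟨hQ, fun x hx y hy hxy => hQc.mem_edges hx hy hxy⟩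
  have hT' := hT.update hG hK (i := i) (len _ (hab i)) hQi
    (by rw [head?_support, head?_support]) (by rw [getLast?_support, getLast?_support]) (by
      intro x hx h1 h2 j hj y hy hyj
      rw [head?_support, Ne, Option.some_inj] at h1
      rw [getLast?_support, Ne, Option.some_inj] at h2
      rw [head?_support, getLast?_support, Option.some_inj, Option.some_inj] at hyj
      have := hint x hx (Ne.symm h1) (Ne.symm h2) j hj
      rcases hyj with rfl | rfl
      · exact this.1
      · exact this.2)
  rw [← support_update] at hT'
  refine ⟨formsPrism_iff.2 ⟨hT', hab⟩, ?_⟩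
  have e1 := hT.even_add hG (fun i => len _ (hab i))
  have e2 := hT'.even_add hG (fun i => len _ (hab i))
  simp only [SimpleGraph.Walk.length_support] at e1 e2
  -- A path that is not replaced belongs to both prisms and carries the parity over.
  obtain ⟨j, hj⟩ : ∃ j : Fin 3, j ≠ i := (by decide : ∀ i : Fin 3, ∃ j : Fin 3, j ≠ i) i
  have hjj : Function.update P i Q j = P j := by simp [hj]
  rcases Nat.even_or_odd (P j).length with hp | hp
  · refine Or.inr ⟨fun k => ?_, fun k => ?_⟩
    · have := e1 k j
      grind
    · have := e2 k j
      rw [hjj] at this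
      grind
  · refine Or.inl ⟨fun k => ?_, fun k => ?_⟩
    · have := e1 k j
      grind
    · have := e2 k j
      rw [hjj] at this
      grind

end Walks

/-! ### Odd prisms inside line graphs of subdivisions of `K₄`. -/

section OddPrisms

variable {V : Type*} {G : SimpleGraph V}

/-- The edges are numbered 01, 02, 03, 12, 13, 23, so that opposite edges are exchanged by
`Fin.rev`. -/
theorem k4idx_others : ∀ e : Fin 6, ∃ v x z w : Fin 4, v ≠ x ∧ v ≠ z ∧ v ≠ w ∧ x ≠ z ∧ x ≠ w ∧
    z ≠ w ∧ k4idx z w = e ∧ k4idx v x = e.rev := by decide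

theorem k4idx_cases_ne : ∀ v x z w : Fin 4, v ≠ x → v ≠ z → v ≠ w → x ≠ z → x ≠ w → z ≠ w → ∀ j,
    j ≠ k4idx v x ↔ j = k4idx z v ∨ j = k4idx v w ∨ j = k4idx z x ∨ j = k4idx x w ∨
      j = k4idx z w := by decide

/-- Deleting one of the six paths of the line graph of a subdivision of `K₄` leaves a prism. -/
theorem LineModel.inducesOddPrism {L : Fin 6 → List V} (h : LineModel G k4src k4tgt L)
    {v x z w : Fin 4} (h1 : v ≠ x) (h2 : v ≠ z) (h3 : v ≠ w) (h4 : x ≠ z) (h5 : x ≠ w)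
    (h6 : z ≠ w) (e0 : Even (seg L z w).length)
    (e1 : Even ((seg L z v).length + (seg L v w).length))
    (e2 : Even ((seg L z x).length + (seg L x w).length)) :
    InducesOddPrism G {y | ∃ f, f ≠ k4idx v x ∧ y ∈ L f} := by
  obtain ⟨c12, c13⟩ := seg_theta h h1 h2 h3 h4 h5 h6
  obtain ⟨-, c23⟩ := seg_theta h h1.symm h4 h5 h2 h3 h6
  have hT : IsTheta G ![seg L z v ++ seg L v w, seg L z x ++ seg L x w, seg L z w] := by
    refine LineModel.of_lt ?_ ?_ ?_
    · simp [Fin.forall_fin_succ, seg_ne_nil h]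
    · simp [Fin.forall_fin_succ, seg_append_indPath h h2.symm h3 h6,
        seg_append_indPath h h4.symm h5 h6, seg_indPath h]
    · simp [Fin.forall_fin_succ, c12, c13, c23]
  have := hT.inducesOddPrism (by simp [Fin.forall_fin_succ, e0, e1, e2])
  convert this using 3 with y
  simp only [k4idx_cases_ne v x z w h1 h2 h3 h4 h5 h6, Fin.exists_fin_succ, or_and_right, exists_or,
    exists_eq_left]
  simp [mem_seg, or_assoc]

/-- In a graph without odd holes, a path with an even number of vertices in the line graph of a
subdivision of `K₄` gives an odd prism that avoids the opposite path. -/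
theorem LineModel.inducesOddPrism_of_even (hG : ¬ HasOddHole G) {L : Fin 6 → List V}
    (h : LineModel G k4src k4tgt L) {e : Fin 6} (he : Even (L e).length) :
    InducesOddPrism G {y | ∃ f, f ≠ e.rev ∧ y ∈ L f} := by
  obtain ⟨v, x, z, w, h1, h2, h3, h4, h5, h6, rfl, h8⟩ := k4idx_others e
  rw [← h8]
  rw [← length_seg] at he
  have hp := fun p q => List.length_pos_iff.2 (seg_ne_nil h p q)
  have key : ∀ v x, v ≠ x → v ≠ z → v ≠ w → x ≠ z → x ≠ w →
      Even ((seg L z v).length + (seg L v w).length) := by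
    intro v x h1 h2 h3 h4 h5
    -- The way from `z` to `w` through `v` closes a hole with the direct path, whose number of
    -- vertices is even.
    have := even_add_length_of_hole hG (seg_append_indPath h h2.symm h3 h6) (seg_indPath h z w)
      (seg_theta h h1 h2 h3 h4 h5 h6).2 (by simp [seg_ne_nil h]) (seg_ne_nil h _ _) (by
        have := hp z v
        have := hp v w
        have := hp z w
        rw [List.length_append]
        grind)
    rw [List.length_append] at this
    grind
  exact h.inducesOddPrism h1 h2 h3 h4 h5 h6 he (key v x h1 h2 h3 h4 h5)
    (key x v h1.symm h4 h5 h2 h3)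

/-- In a graph without odd holes, the line graph of a proper subdivision of `K₄` has a path with
an even number of vertices. -/
theorem LineModel.exists_even (hG : ¬ HasOddHole G) {L : Fin 6 → List V}
    (h : LineModel G k4src k4tgt L) (h6 : 6 < ∑ e, (L e).length) : ∃ e, Even (L e).length := by
  by_contra! hodd
  obtain ⟨e, he⟩ : ∃ e, 1 < (L e).length := by
    by_contra! hle
    have := Finset.sum_le_sum fun e (_ : e ∈ Finset.univ) => hle e
    simp at this
    omega
  obtain ⟨v, x, z, w, h1, h2, h3, h4, h5, h6, rfl, h8⟩ := k4idx_others e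
  have o1 := hodd (k4idx z v)
  have o2 := hodd (k4idx v w)
  have o3 := hodd (k4idx z w)
  rw [← length_seg] at o1 o2 o3 he
  -- If all six numbers were odd, the triangle `z`, `v`, `w` of `K₄` would give a hole of odd
  -- length; the path of `zw` has more than one vertex, so this is not a triangle of the graph.
  have := even_add_length_of_hole hG (seg_append_indPath h h2.symm h3 h6) (seg_indPath h z w)
      (seg_theta h h1 h2 h3 h4 h5 h6).2 (by simp [seg_ne_nil h]) (seg_ne_nil h _ _) (by
        rw [List.length_append]
        grind)
  rw [List.length_append] at this
  grind

end OddPrisms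

/-! ### Subdivisions of `K₄` with prescribed lengths, and their line graphs. -/

section Subdivisions

/-- The vertices of the subdivision of `K₄` whose paths have the lengths `len e`. -/
abbrev K4Vertex (len : Fin 6 → ℕ) : Type := Fin 4 ⊕ {p : Fin 6 × ℕ // 0 < p.2 ∧ p.2 < len p.1}

/-- The `k`-th vertex of the path of the edge `e` of `K₄`. -/
def k4Point (len : Fin 6 → ℕ) (e : Fin 6) (k : ℕ) : K4Vertex len :=
  if h : 0 < k ∧ k < len e then Sum.inr ⟨(e, k), h⟩ else Sum.inl (if k = 0 then k4src e else k4tgt e)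

variable {len : Fin 6 → ℕ}

theorem k4Point_eq_iff {e f : Fin 6} {i j : ℕ} (hi : i ≤ len e) (hj : j ≤ len f) (hef : e ≠ f) :
    k4Point len e i = k4Point len f j ↔ (i = 0 ∨ i = len e) ∧ (j = 0 ∨ j = len f) ∧
      (if i = 0 then k4src e else k4tgt e) = if j = 0 then k4src f else k4tgt f := by
  unfold k4Point
  split_ifs with h1 h2 <;> simp <;> grind

theorem k4Point_inj {e : Fin 6} {i j : ℕ} (hi : i ≤ len e) (hj : j ≤ len e) :
    k4Point len e i = k4Point len e j ↔ i = j := by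
  have := (k4src_lt_tgt e).ne
  unfold k4Point
  split_ifs with h1 h2 <;> simp <;> grind

/-- The subdivision of `K₄` whose paths have the lengths `len e`. -/
def k4Graph (len : Fin 6 → ℕ) : SimpleGraph (K4Vertex len) where
  Adj x y := ∃ e k, k < len e ∧ s(x, y) = s(k4Point len e k, k4Point len e (k + 1))
  symm := ⟨fun x y ⟨e, k, hk, h⟩ => ⟨e, k, hk, by rw [Sym2.eq_swap, h]⟩⟩
  loopless := ⟨fun x ⟨e, k, hk, h⟩ => by
    have h2 : k4Point len e k = k4Point len e (k + 1) := by
      rw [Sym2.eq_iff] at h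
      grind
    rw [k4Point_inj (by omega) (by omega)] at h2
    omega⟩

theorem k4Graph_exists_walk (e : Fin 6) (m : ℕ) (hm : m ≤ len e) :
    ∃ w : (k4Graph len).Walk (k4Point len e 0) (k4Point len e m),
      w.support = (List.range (m + 1)).map (k4Point len e) ∧
      w.edges = (List.range m).map fun k => s(k4Point len e k, k4Point len e (k + 1)) := by
  induction m with
  | zero => exact ⟨.nil, by simp, by simp⟩
  | succ m ih =>
    obtain ⟨w, h1, h2⟩ := ih (by omega)
    have ha : (k4Graph len).Adj (k4Point len e m) (k4Point len e (m + 1)) := ⟨e, m, by omega, rfl⟩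
    refine ⟨w.concat ha, ?_, ?_⟩
    · rw [SimpleGraph.Walk.support_concat, h1, List.range_succ (n := m + 1)]
      simp
    · rw [SimpleGraph.Walk.edges_concat, h2, List.range_succ (n := m)]
      simp

theorem k4Graph_forms (hpos : ∀ e, 0 < len e) : ∃ Q : ∀ e : K4Edge,
    (k4Graph len).Walk (Sum.inl e.1.1) (Sum.inl e.1.2),
    FormsK4Subdivision (k4Graph len) (Sum.inl : Fin 4 → K4Vertex len) Q ∧
      ∀ e, (Q e).length = len (k4idx e.1.1 e.1.2) := by
  have hidx : ∀ e f : K4Edge, e ≠ f → k4idx e.1.1 e.1.2 ≠ k4idx f.1.1 f.1.2 := by decide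
  have hs : ∀ e : K4Edge, k4src (k4idx e.1.1 e.1.2) = e.1.1 := by decide
  have ht : ∀ e : K4Edge, k4tgt (k4idx e.1.1 e.1.2) = e.1.2 := by decide
  have h0 : ∀ e, k4Point len e 0 = Sum.inl (k4src e) := by simp [k4Point]
  have h1 : ∀ e, k4Point len e (len e) = Sum.inl (k4tgt e) := fun e => by
    simp [k4Point, (hpos e).ne']
  have hsur : ∀ e : Fin 6, ∃ f : K4Edge, k4idx f.1.1 f.1.2 = e := by decide
  have hex : ∀ e : K4Edge, ∃ w : (k4Graph len).Walk (Sum.inl e.1.1) (Sum.inl e.1.2),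
      w.support = (List.range (len (k4idx e.1.1 e.1.2) + 1)).map (k4Point len (k4idx e.1.1 e.1.2)) ∧
      w.edges = (List.range (len (k4idx e.1.1 e.1.2))).map fun k =>
        s(k4Point len (k4idx e.1.1 e.1.2) k, k4Point len (k4idx e.1.1 e.1.2) (k + 1)) := by
    intro e
    have := k4Graph_exists_walk (len := len) (k4idx e.1.1 e.1.2) _ le_rfl
    rwa [h0, h1, hs, ht] at this
  choose Q hQ1 hQ2 using hex
  refine ⟨Q, ⟨Sum.inl_injective, fun e => ?_, fun e f hef x hx hy => ?_, fun x => ?_,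
    fun x y hxy => ?_⟩, fun e => ?_⟩
  · rw [SimpleGraph.Walk.isPath_def, hQ1, List.nodup_map_iff_inj_on List.nodup_range]
    intro i hi j hj hij
    rw [List.mem_range] at hi hj
    exact (k4Point_inj (by omega) (by omega)).1 hij
  · rw [hQ1, List.mem_map] at hx hy
    obtain ⟨i, hi, rfl⟩ := hx
    obtain ⟨j, hj, hij⟩ := hy
    rw [List.mem_range] at hi hj
    have := (k4Point_eq_iff (by omega) (by omega) (hidx e f hef)).1 hij.symm
    constructor
    · rcases this.1 with h | h
      · left; rw [h, h0, hs]
      · right; rw [h, h1, ht]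
    · rw [← hij]
      rcases this.2.1 with h | h
      · left; rw [h, h0, hs]
      · right; rw [h, h1, ht]
  · rcases x with v | ⟨⟨e, k⟩, hk⟩
    · have : ∀ v : Fin 4, ∃ e : K4Edge, v = e.1.1 ∨ v = e.1.2 := by decide
      obtain ⟨e, rfl | rfl⟩ := this v
      · exact ⟨e, (Q e).start_mem_support⟩
      · exact ⟨e, (Q e).end_mem_support⟩
    · obtain ⟨f, rfl⟩ := hsur e
      refine ⟨f, ?_⟩
      rw [hQ1, List.mem_map]
      exact ⟨k, by simp at hk ⊢; omega, by simp [k4Point, hk]⟩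
  · obtain ⟨e, k, hk, h⟩ := hxy
    obtain ⟨f, rfl⟩ := hsur e
    refine ⟨f, ?_⟩
    rw [hQ2, List.mem_map]
    exact ⟨k, by simpa using hk, h.symm⟩
  · rw [← SimpleGraph.Walk.length_edges, hQ2]
    simp

variable {V : Type*} {G : SimpleGraph V}

/-- The edge between the points `k` and `k + 1` of the path `e` is sent to the `k`-th vertex of `L
e`. Edges on different paths meet only in a branch vertex, which is what the end conditions of
`Cross` record. -/
theorem LineModel.isIndContained {L : Fin 6 → List V} (h : LineModel G k4src k4tgt L) :
    (k4Graph fun e => (L e).length).lineGraph.IsIndContained G := by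
  set len : Fin 6 → ℕ := fun e => (L e).length with hlen
  have hex : ∀ x : (k4Graph len).edgeSet, ∃ e k, k < len e ∧
      x.1 = s(k4Point len e k, k4Point len e (k + 1)) := by
    rintro ⟨x, hx⟩
    induction x with
    | _ a b => exact hx
  choose E K hK hE using hex
  have hlt : ∀ x, K x < (L (E x)).length := hK
  have hadj : ∀ x y, (k4Graph len).lineGraph.Adj x y ↔ x ≠ y ∧ ∃ i j, (i = K x ∨ i = K x + 1) ∧
      (j = K y ∨ j = K y + 1) ∧ k4Point len (E x) i = k4Point len (E y) j := by
    intro x y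
    rw [SimpleGraph.lineGraph_adj_iff_exists]
    refine and_congr_right fun _ => ?_
    rw [hE x, hE y]
    simp only [Sym2.mem_iff]
    constructor
    · rintro ⟨v, h1, h2⟩
      rcases h1 with rfl | rfl <;> rcases h2 with h2 | h2
      · exact ⟨_, _, Or.inl rfl, Or.inl rfl, h2⟩
      · exact ⟨_, _, Or.inl rfl, Or.inr rfl, h2⟩
      · exact ⟨_, _, Or.inr rfl, Or.inl rfl, h2⟩
      · exact ⟨_, _, Or.inr rfl, Or.inr rfl, h2⟩
    · rintro ⟨i, j, h1, h2, h3⟩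
      refine ⟨k4Point len (E x) i, ?_, ?_⟩
      · exact h1.imp (congrArg _) (congrArg _)
      · rw [h3]
        exact h2.imp (congrArg _) (congrArg _)
  have heq : ∀ x y, E x = E y → K x = K y → x = y := by
    intro x y h1 h2
    apply Subtype.ext
    rw [hE x, hE y, h1, h2]
  have hd : ∀ x y, E x ≠ E y → (L (E x))[K x]'(hlt x) ≠ (L (E y))[K y]'(hlt y) := fun x y hxy =>
    (h.cross _ _ hxy _ (List.getElem_mem _) _ (List.getElem_mem _)).1
  refine ⟨⟨⟨fun x => (L (E x))[K x]'(hlt x), fun x y hxy => ?_⟩, fun {x y} => ?_⟩⟩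
  · by_cases he : E x = E y
    · refine heq x y he ?_
      have hy := hlt y
      simp only [he] at hxy
      exact ((h.indPath (E y)).nodup.getElem_inj_iff).1 hxy
    · exact absurd hxy (hd x y he)
  · change G.Adj ((L (E x))[K x]'(hlt x)) ((L (E y))[K y]'(hlt y)) ↔ _
    rw [hadj]
    have hx := hlt x
    have hy := hlt y
    by_cases he : E x = E y
    · have := (indPath_iff_getElem.1 (h.indPath (E y))).2 (K x) (K y) (he ▸ hx) hy
      simp only [he]
      rw [this]
      constructor
      · intro h1
        refine ⟨fun hxy => by subst hxy; omega, ?_⟩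
        rcases h1 with h1 | h1
        · exact ⟨_, _, Or.inr rfl, Or.inl rfl, by rw [h1]⟩
        · exact ⟨_, _, Or.inl rfl, Or.inr rfl, by rw [h1]⟩
      · rintro ⟨hne, i, j, hi, hj, hij⟩
        have hne' : K x ≠ K y := fun hk => hne (heq x y he hk)
        rw [he] at hx
        rw [k4Point_inj (by simp only [hlen]; omega) (by simp only [hlen]; omega)] at hij
        omega
    · have hc := (h.cross _ _ he _ (List.getElem_mem hx) _ (List.getElem_mem hy)).2
      have hh : ∀ z, (L (E z)).head? = some ((L (E z))[K z]'(hlt z)) ↔ K z = 0 := by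
        intro z
        rw [List.head?_eq_getElem?, List.getElem?_eq_getElem (by have := hlt z; omega),
          Option.some_inj, (h.indPath _).nodup.getElem_inj_iff, eq_comm]
      have ht : ∀ z, (L (E z)).getLast? = some ((L (E z))[K z]'(hlt z)) ↔
          K z + 1 = (L (E z)).length := by
        intro z
        have := hlt z
        rw [List.getLast?_eq_getElem?, List.getElem?_eq_getElem (by omega),
          Option.some_inj, (h.indPath _).nodup.getElem_inj_iff]
        omega
      rw [hc, hh, hh, ht, ht]
      have hpt : ∀ i j, (i = K x ∨ i = K x + 1) → (j = K y ∨ j = K y + 1) →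
          (k4Point len (E x) i = k4Point len (E y) j ↔ _) := fun i j hi hj =>
        k4Point_eq_iff (by simp only [hlen]; omega) (by simp only [hlen]; omega) he
      have hxy : x ≠ y := fun hxy => he (hxy ▸ rfl)
      simp only [ne_eq, hxy, not_false_eq_true, true_and]
      constructor
      · rintro (⟨h1, h2, h3⟩ | ⟨h1, h2, h3⟩ | ⟨h1, h2, h3⟩ | ⟨h1, h2, h3⟩)
        · refine ⟨_, _, Or.inl rfl, Or.inl rfl, (hpt _ _ (Or.inl rfl) (Or.inl rfl)).2 ?_⟩
          simp [h1, h2, h3]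
        · refine ⟨_, _, Or.inl rfl, Or.inr rfl, (hpt _ _ (Or.inl rfl) (Or.inr rfl)).2 ?_⟩
          simp [h1, h2, h3, hlen, h.ne_nil]
        · refine ⟨_, _, Or.inr rfl, Or.inl rfl, (hpt _ _ (Or.inr rfl) (Or.inl rfl)).2 ?_⟩
          simp [h1, h2, h3, hlen, h.ne_nil]
        · refine ⟨_, _, Or.inr rfl, Or.inr rfl, (hpt _ _ (Or.inr rfl) (Or.inr rfl)).2 ?_⟩
          simp [h1, h2, h3, hlen, h.ne_nil]
      · rintro ⟨i, j, hi, hj, hij⟩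
        obtain ⟨h1, h2, h3⟩ := (hpt i j hi hj).1 hij
        simp only [hlen] at h1 h2
        split_ifs at h3 with h4 h5 h5
        · exact Or.inl ⟨h3, by omega, by omega⟩
        · exact Or.inr (Or.inl ⟨h3, by omega, by omega⟩)
        · exact Or.inr (Or.inr (Or.inl ⟨h3, by omega, by omega⟩))
        · exact Or.inr (Or.inr (Or.inr ⟨h3, by omega, by omega⟩))

/-- More than 6 vertices on six paths force one path with at least two, that is, an edge of `K₄`
that is really subdivided. -/
theorem LineModel.hasLineGraphOfProperK4Subdivision {L : Fin 6 → List V}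
    (h : LineModel G k4src k4tgt L) (h6 : 6 < ∑ e, (L e).length) :
    HasLineGraphOfProperK4Subdivision G := by
  have hpos : ∀ e, 0 < (L e).length := fun e => List.length_pos_iff.2 (h.ne_nil e)
  obtain ⟨Q, hQ, hl⟩ := k4Graph_forms (len := fun e => (L e).length) hpos
  refine ⟨_, _, ⟨_, Q, hQ, ?_⟩, h.isIndContained⟩
  obtain ⟨e, he⟩ : ∃ e, 1 < (L e).length := by
    by_contra! hle
    have := Finset.sum_le_sum fun e (_ : e ∈ Finset.univ) => hle e
    simp at this
    omega
  have hsur : ∀ e : Fin 6, ∃ f : K4Edge, k4idx f.1.1 f.1.2 = e := by decide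
  obtain ⟨f, rfl⟩ := hsur e
  exact ⟨f, by rw [hl]; exact he⟩

end Subdivisions

/-! ### Line graphs of given subdivisions, and the bipartite case. -/

section BipartiteSubdivisions

variable {W : Type*} {R : SimpleGraph W}

/-- The edges of a walk, as vertices of the line graph. -/
def lineList {a b : W} (w : R.Walk a b) : List R.edgeSet :=
  List.ofFn fun k : Fin w.length => ⟨s(w.getVert k, w.getVert (k + 1)), w.adj_getVert_succ k.2⟩

theorem length_lineList {a b : W} (w : R.Walk a b) : (lineList w).length = w.length := by
  simp [lineList]

theorem getElem_lineList {a b : W} (w : R.Walk a b) (k : ℕ) (hk : k < (lineList w).length) :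
    ((lineList w)[k] : Sym2 W) = s(w.getVert k, w.getVert (k + 1)) := by
  simp [lineList]

theorem getVert_inj {a b : W} {w : R.Walk a b} (hw : w.IsPath) {i j : ℕ} (hi : i ≤ w.length)
    (hj : j ≤ w.length) : w.getVert i = w.getVert j ↔ i = j :=
  ⟨fun h => hw.getVert_injOn hi hj h, fun h => by rw [h]⟩

theorem lineGraph_adj_getElem {a b a' b' : W} {w : R.Walk a b} {w' : R.Walk a' b'} {i j : ℕ}
    (hi : i < (lineList w).length) (hj : j < (lineList w').length) :
    R.lineGraph.Adj (lineList w)[i] (lineList w')[j] ↔ (lineList w)[i] ≠ (lineList w')[j] ∧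
      ∃ k l, (k = i ∨ k = i + 1) ∧ (l = j ∨ l = j + 1) ∧ w.getVert k = w'.getVert l := by
  rw [SimpleGraph.lineGraph_adj_iff_exists, getElem_lineList, getElem_lineList]
  simp only [Sym2.mem_iff]
  refine and_congr_right fun _ => ⟨?_, ?_⟩
  · rintro ⟨v, rfl | rfl, h | h⟩
    · exact ⟨_, _, Or.inl rfl, Or.inl rfl, h⟩
    · exact ⟨_, _, Or.inl rfl, Or.inr rfl, h⟩
    · exact ⟨_, _, Or.inr rfl, Or.inl rfl, h⟩
    · exact ⟨_, _, Or.inr rfl, Or.inr rfl, h⟩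
  · rintro ⟨k, l, h1, h2, h⟩
    refine ⟨w.getVert k, h1.imp (congrArg _) (congrArg _), ?_⟩
    rw [h]
    exact h2.imp (congrArg _) (congrArg _)

theorem indPath_lineList {a b : W} {w : R.Walk a b} (hw : w.IsPath) :
    IndPath R.lineGraph (lineList w) := by
  have hne : ∀ i j (hi : i < (lineList w).length) (hj : j < (lineList w).length),
      (lineList w)[i] = (lineList w)[j] ↔ i = j := by
    intro i j hi hj
    rw [← Subtype.coe_inj, getElem_lineList, getElem_lineList, Sym2.eq_iff]
    rw [length_lineList] at hi hj
    rw [getVert_inj hw (by omega) (by omega), getVert_inj hw (by omega) (by omega),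
      getVert_inj hw (by omega) (by omega), getVert_inj hw (by omega) (by omega)]
    omega
  refine indPath_iff_getElem.2 ⟨List.nodup_iff_injective_get.2 fun i j hij => ?_,
    fun i j hi hj => ?_⟩
  · exact Fin.ext ((hne i j i.2 j.2).1 (by simpa using hij))
  · rw [lineGraph_adj_getElem, Ne, hne]
    rw [length_lineList] at hi hj
    constructor
    · rintro ⟨h1, k, l, hk, hl, h⟩
      rw [getVert_inj hw (by omega) (by omega)] at h
      omega
    · rintro (h | h)
      · exact ⟨by omega, i + 1, j, by simp, by simp, by rw [h]⟩
      · exact ⟨by omega, i, j + 1, by simp, by simp, by rw [h]⟩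

/-- The edges of a path, in their order, are an induced path of the line graph. Different paths meet
only in branch vertices (`hcr`), so their edges are incident only at the ends. -/
theorem FormsK4Subdivision.lineModel {c : Fin 4 → W}
    {Q : ∀ e : K4Edge, R.Walk (c e.1.1) (c e.1.2)} (h : FormsK4Subdivision R c Q) :
    LineModel R.lineGraph k4src k4tgt
      fun e => lineList (Q ⟨(k4src e, k4tgt e), k4src_lt_tgt e⟩) := by
  set P : ∀ e : Fin 6, R.Walk (c (k4src e)) (c (k4tgt e)) :=
    fun e => Q ⟨(k4src e, k4tgt e), k4src_lt_tgt e⟩ with hP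
  change LineModel R.lineGraph k4src k4tgt fun e => lineList (P e)
  have hpath : ∀ e, (P e).IsPath := fun e => h.isPath _
  have hpos : ∀ e, 0 < (P e).length := fun e => Nat.pos_of_ne_zero fun h0 =>
    (k4src_lt_tgt e).ne (h.branch_injective (SimpleGraph.Walk.eq_of_length_eq_zero h0))
  have hedge : ∀ e f : Fin 6, e ≠ f → (⟨(k4src e, k4tgt e), k4src_lt_tgt e⟩ : K4Edge) ≠
      ⟨(k4src f, k4tgt f), k4src_lt_tgt f⟩ := by decide
  have hinj : ∀ e f : Fin 6, e ≠ f → ¬ (k4src e = k4src f ∧ k4tgt e = k4tgt f) ∧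
      ¬ (k4src e = k4tgt f ∧ k4tgt e = k4src f) := by decide
  have h0 : ∀ e i, i ≤ (P e).length → ((P e).getVert i = c (k4src e) ↔ i = 0) := fun e i hi => by
    have := getVert_inj (hpath e) hi (Nat.zero_le _)
    rwa [SimpleGraph.Walk.getVert_zero] at this
  have h1 : ∀ e i, i ≤ (P e).length → ((P e).getVert i = c (k4tgt e) ↔ i = (P e).length) :=
    fun e i hi => by
      have := getVert_inj (hpath e) hi le_rfl
      rwa [SimpleGraph.Walk.getVert_length] at this
  have hcr : ∀ e f, e ≠ f → ∀ i j, i ≤ (P e).length → j ≤ (P f).length →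
      ((P e).getVert i = (P f).getVert j ↔ (k4src e = k4src f ∧ i = 0 ∧ j = 0) ∨
        (k4src e = k4tgt f ∧ i = 0 ∧ j = (P f).length) ∨
        (k4tgt e = k4src f ∧ i = (P e).length ∧ j = 0) ∨
        (k4tgt e = k4tgt f ∧ i = (P e).length ∧ j = (P f).length)) := by
    intro e f hef i j hi hj
    constructor
    · intro hij
      have hd := h.internally_disjoint _ _ (hedge e f hef) _ ((P e).getVert_mem_support i)
        (hij ▸ (P f).getVert_mem_support j)
      obtain ⟨k1, k2⟩ := hd
      have k2' : (P f).getVert j = c (k4src f) ∨ (P f).getVert j = c (k4tgt f) := by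
        rw [← hij]; exact k2
      rcases k1 with k1 | k1 <;> rcases k2' with k2 | k2
      · exact Or.inl ⟨h.branch_injective (k1.symm.trans (hij.trans k2)), (h0 e i hi).1 k1,
          (h0 f j hj).1 k2⟩
      · exact Or.inr (Or.inl ⟨h.branch_injective (k1.symm.trans (hij.trans k2)), (h0 e i hi).1 k1,
          (h1 f j hj).1 k2⟩)
      · exact Or.inr (Or.inr (Or.inl ⟨h.branch_injective (k1.symm.trans (hij.trans k2)),
          (h1 e i hi).1 k1, (h0 f j hj).1 k2⟩))
      · exact Or.inr (Or.inr (Or.inr ⟨h.branch_injective (k1.symm.trans (hij.trans k2)),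
          (h1 e i hi).1 k1, (h1 f j hj).1 k2⟩))
    · rintro (⟨h, rfl, rfl⟩ | ⟨h, rfl, rfl⟩ | ⟨h, rfl, rfl⟩ | ⟨h, rfl, rfl⟩)
      all_goals simp [h]
  have hpos' : ∀ e, 0 < (lineList (P e)).length := fun e => by simpa [length_lineList] using hpos e
  refine ⟨fun e => List.ne_nil_of_length_pos (hpos' e), fun e => indPath_lineList (hpath e),
    fun e f hef x hx y hy => ?_⟩
  obtain ⟨i, hi, rfl⟩ := List.mem_iff_getElem.1 hx
  obtain ⟨j, hj, rfl⟩ := List.mem_iff_getElem.1 hy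
  have hh : ∀ e i (hi : i < (lineList (P e)).length),
      (lineList (P e)).head? = some (lineList (P e))[i] ↔ i = 0 := by
    intro e i hi
    rw [List.head?_eq_getElem?, List.getElem?_eq_getElem (by omega), Option.some_inj,
      (indPath_lineList (hpath e)).nodup.getElem_inj_iff, eq_comm]
  have ht : ∀ e i (hi : i < (lineList (P e)).length),
      (lineList (P e)).getLast? = some (lineList (P e))[i] ↔ i + 1 = (P e).length := by
    intro e i hi
    rw [List.getLast?_eq_getElem?, List.getElem?_eq_getElem (by omega), Option.some_inj,
      (indPath_lineList (hpath e)).nodup.getElem_inj_iff, length_lineList]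
    rw [length_lineList] at hi
    omega
  have hne : (lineList (P e))[i] ≠ (lineList (P f))[j] := by
    rw [Ne, ← Subtype.coe_inj, getElem_lineList, getElem_lineList, Sym2.eq_iff]
    rw [length_lineList] at hi hj
    have := hinj e f hef
    rw [hcr e f hef _ _ (by omega) (by omega), hcr e f hef _ _ (by omega) (by omega),
      hcr e f hef _ _ (by omega) (by omega), hcr e f hef _ _ (by omega) (by omega)]
    omega
  refine ⟨hne, ?_⟩
  rw [lineGraph_adj_getElem, hh, hh, ht, ht]
  simp only [ne_eq, hne, not_false_eq_true, true_and]
  rw [length_lineList] at hi hj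
  constructor
  · rintro ⟨k, l, hk, hl, hkl⟩
    rw [hcr e f hef k l (by omega) (by omega)] at hkl
    omega
  · rintro (⟨h, h1, h2⟩ | ⟨h, h1, h2⟩ | ⟨h, h1, h2⟩ | ⟨h, h1, h2⟩)
    · exact ⟨i, j, by simp, by simp, (hcr e f hef _ _ (by omega) (by omega)).2 (by omega)⟩
    · exact ⟨i, j + 1, by simp, by simp, (hcr e f hef _ _ (by omega) (by omega)).2 (by omega)⟩
    · exact ⟨i + 1, j, by simp, by simp, (hcr e f hef _ _ (by omega) (by omega)).2 (by omega)⟩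
    · exact ⟨i + 1, j + 1, by simp, by simp, (hcr e f hef _ _ (by omega) (by omega)).2 (by omega)⟩

/-- The line graph of a bipartite subdivision of `K₄` contains an odd prism. -/
theorem IsK4Subdivision.hasOddPrism_lineGraph (h : IsK4Subdivision R) (hR : R.IsBipartite) :
    HasOddPrism R.lineGraph := by
  obtain ⟨c, Q, hQ⟩ := h
  have C : R.Coloring Bool := hR.toColoring (by simp)
  -- Two of the four branch vertices have the same colour; all paths of the subdivision between them
  -- have even length, hence an even number of vertices in the line graph.
  have hpig : ∀ f : Fin 4 → Bool, ∃ v x z w : Fin 4, v ≠ x ∧ v ≠ z ∧ v ≠ w ∧ x ≠ z ∧ x ≠ w ∧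
      z ≠ w ∧ f z = f w := by decide
  obtain ⟨v, x, z, w, h1, h2, h3, h4, h5, h6, hzw⟩ := hpig fun v => C (c v)
  have hL := hQ.lineModel
  set L := fun e => lineList (Q ⟨(k4src e, k4tgt e), k4src_lt_tgt e⟩) with hLdef
  have hpar : ∀ p q, p ≠ q → (Even (seg L p q).length ↔ C (c p) = C (c q)) := by
    intro p q hpq
    have := C.even_length_iff_congr (Q ⟨(k4src (k4idx p q), k4tgt (k4idx p q)), k4src_lt_tgt _⟩)
    rw [length_seg, hLdef]
    simp only [length_lineList]
    rw [this, ← Bool.eq_iff_iff]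
    simp only [k4src_idx p q hpq, k4tgt_idx p q hpq]
    split_ifs
    · rfl
    · exact eq_comm
  refine ⟨_, hL.inducesOddPrism h1 h2 h3 h4 h5 h6 ((hpar z w h6).2 hzw) ?_ ?_⟩
  · rw [Nat.even_add, hpar _ _ h2.symm, hpar _ _ h3]
    grind
  · rw [Nat.even_add, hpar _ _ h4.symm, hpar _ _ h5]
    grind

end BipartiteSubdivisions

/-! ### Total correctness of programs with bounds on time and word size. -/

section RamLogic

/-- The expression evaluates to numbers at most `e.need B` if registers and cells hold at most
`B`. -/
def RamExpr.need (B : ℕ) : RamExpr → ℕ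
  | .lit k => k
  | .reg _ => B
  | .load addr => addr.need B + B
  | .bin _ e₁ e₂ => e₁.need B + e₂.need B + e₁.need B * e₂.need B

/-- A word size that suffices if registers and cells hold at most `B`. -/
def RamProg.need (B : ℕ) : RamProg → ℕ
  | .skip => 0
  | .assign _ e => e.need B
  | .store a e => a.need B + e.need B
  | .seq p q => p.need B + q.need B
  | .ite e p q => e.need B + p.need B + q.need B
  | .loop e p => e.need B + p.need B

/-- The number of steps, if every loop makes at most `N` rounds. -/
def RamProg.time (N : ℕ) : RamProg → ℕ
  | .skip => 1
  | .assign _ e => e.cost + 1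
  | .store a e => a.cost + e.cost + 1
  | .seq p q => p.time N + q.time N
  | .ite e p q => e.cost + 1 + (p.time N + q.time N)
  | .loop e p => (N + 1) * (e.cost + 1) + N * p.time N

/-- The nesting depth of the loops. -/
def RamProg.depth : RamProg → ℕ
  | .skip => 0
  | .assign _ _ => 0
  | .store _ _ => 0
  | .seq p q => max p.depth q.depth
  | .ite _ p q => max p.depth q.depth
  | .loop _ p => p.depth + 1

/-- The program assigns to the register. -/
def RamProg.Writes : RamProg → ℕ → Prop
  | .skip, _ => False
  | .assign i _, j => j = i
  | .store _ _, _ => False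
  | .seq p q, j => p.Writes j ∨ q.Writes j
  | .ite _ p q, j => p.Writes j ∨ q.Writes j
  | .loop _ p, j => p.Writes j

/-- All registers and cells hold at most `B`. -/
def RamState.Bdd (B : ℕ) (s : RamState) : Prop :=
  (∀ i, s.reg i ≤ B) ∧ ∀ a, s.mem a ≤ B

/-- The state after an assignment. -/
def RamState.setReg (s : RamState) (i v : ℕ) : RamState := ⟨Function.update s.reg i v, s.mem⟩

/-- The state after a store. -/
def RamState.setMem (s : RamState) (a v : ℕ) : RamState := ⟨s.reg, Function.update s.mem a v⟩

@[simp] theorem RamState.setReg_reg_self (s : RamState) (i v : ℕ) : (s.setReg i v).reg i = v := by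
  simp [RamState.setReg]

theorem RamState.setReg_reg (s : RamState) (i v j : ℕ) :
    (s.setReg i v).reg j = if j = i then v else s.reg j := by
  simp [RamState.setReg, Function.update_apply]

@[simp] theorem RamState.setReg_mem (s : RamState) (i v : ℕ) : (s.setReg i v).mem = s.mem := rfl


theorem RamState.setMem_mem (s : RamState) (a v b : ℕ) :
    (s.setMem a v).mem b = if b = a then v else s.mem b := by
  simp [RamState.setMem, Function.update_apply]

theorem RamState.Bdd.setReg {B : ℕ} {s : RamState} (h : s.Bdd B) {i v : ℕ} (hv : v ≤ B) :
    (s.setReg i v).Bdd B := by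
  refine ⟨fun j => ?_, h.2⟩
  rw [RamState.setReg_reg]
  split_ifs
  exacts [hv, h.1 j]

theorem RamState.Bdd.setMem {B : ℕ} {s : RamState} (h : s.Bdd B) {a v : ℕ} (hv : v ≤ B) :
    (s.setMem a v).Bdd B := by
  refine ⟨h.1, fun b => ?_⟩
  rw [RamState.setMem_mem]
  split_ifs
  exacts [hv, h.2 b]

/-- One bound for all four operations keeps `RamExpr.need` free of case distinctions. -/
theorem RamOp.apply_le (op : RamOp) {x y a b : ℕ} (hx : x ≤ a) (hy : y ≤ b) :
    op.apply x y ≤ a + b + a * b := by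
  have h := Nat.mul_le_mul hx hy
  cases op
  · simp only [RamOp.apply]; omega
  · simp only [RamOp.apply]; omega
  · simp only [RamOp.apply]; omega
  · have := Nat.div_le_self x y
    simp only [RamOp.apply]; omega

theorem RamExpr.eval_le_need {B : ℕ} {s : RamState} (h : s.Bdd B) (e : RamExpr) :
    e.eval s ≤ e.need B := by
  induction e with
  | lit k => exact le_rfl
  | reg i => exact h.1 i
  | load a => exact (h.2 _).trans (Nat.le_add_left _ _)
  | bin op a b iha ihb => exact op.apply_le iha ihb

theorem RamExpr.fits {B W : ℕ} {s : RamState} (h : s.Bdd B) {e : RamExpr} (hW : e.need B ≤ W) :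
    e.Fits W s := by
  induction e with
  | lit k => exact hW
  | reg i => exact (h.1 i).trans hW
  | load a ih =>
    exact ⟨ih ((Nat.le_add_right _ _).trans hW), (h.2 _).trans ((Nat.le_add_left _ _).trans hW)⟩
  | bin op a b iha ihb =>
    have : a.need B + b.need B + a.need B * b.need B ≤ W := hW
    exact ⟨iha (by omega), ihb (by omega),
      (op.apply_le (a.eval_le_need h) (b.eval_le_need h)).trans hW⟩

theorem RamExec.reg_eq {W : ℕ} {p : RamProg} {s s' : RamState} {t : ℕ} (h : RamExec W p s s' t)
    {i : ℕ} (hi : ¬ p.Writes i) : s'.reg i = s.reg i := by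
  induction h with
  | skip => rfl
  | assign j e s he =>
    simp only [RamProg.Writes] at hi
    simp [hi]
  | store => rfl
  | seq p q s₁ s₂ s₃ t₁ t₂ _ _ ihp ihq =>
    simp only [RamProg.Writes, not_or] at hi
    rw [ihq hi.2, ihp hi.1]
  | ite_true e p q s s' t he h _ ih =>
    simp only [RamProg.Writes, not_or] at hi
    exact ih hi.1
  | ite_false e p q s s' t he h _ ih =>
    simp only [RamProg.Writes, not_or] at hi
    exact ih hi.2
  | loop_true e p s₁ s₂ s₃ t₁ t₂ he h _ _ ih₁ ih₂ =>
    rw [ih₂ hi, ih₁ hi]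
  | loop_false => rfl

/-- Started in the state `s`, the program halts within `T` steps with the postcondition `Q`, and
the contents of the registers and cells remain bounded by `B`. -/
def RunsIn (B T : ℕ) (p : RamProg) (s : RamState) (Q : RamState → Prop) : Prop :=
  s.Bdd B → ∀ W, p.need B ≤ W → ∃ s' t, RamExec W p s s' t ∧ t ≤ T ∧ s'.Bdd B ∧ Q s'

/-- The version of `RunsIn` in which every loop makes at most `N` rounds. -/
def Runs (B N : ℕ) (p : RamProg) (s : RamState) (Q : RamState → Prop) : Prop :=
  RunsIn B (p.time N) p s Q

variable {B N T T' : ℕ} {p q : RamProg} {s : RamState} {Q Q' : RamState → Prop} {e a : RamExpr}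

theorem RunsIn.mono (h : RunsIn B T p s Q) (hT : T ≤ T') (hQ : ∀ s', Q s' → Q' s') :
    RunsIn B T' p s Q' := by
  intro hs W hW
  obtain ⟨s', t, h1, h2, h3, h4⟩ := h hs W hW
  exact ⟨s', t, h1, h2.trans hT, h3, hQ _ h4⟩

theorem Runs.mono (h : Runs B N p s Q) (hQ : ∀ s', Q s' → Q' s') : Runs B N p s Q' :=
  RunsIn.mono h le_rfl hQ

theorem RunsIn.frame (h : RunsIn B T p s Q) :
    RunsIn B T p s fun s' => Q s' ∧ ∀ i, ¬ p.Writes i → s'.reg i = s.reg i := by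
  intro hs W hW
  obtain ⟨s', t, h1, h2, h3, h4⟩ := h hs W hW
  exact ⟨s', t, h1, h2, h3, h4, fun i hi => h1.reg_eq hi⟩

theorem Runs.frame (h : Runs B N p s Q) :
    Runs B N p s fun s' => Q s' ∧ ∀ i, ¬ p.Writes i → s'.reg i = s.reg i :=
  RunsIn.frame h

theorem Runs.skip (h : Q s) : Runs B N .skip s Q :=
  fun hs _ _ => ⟨s, 1, .skip s, le_rfl, hs, h⟩

theorem Runs.assign {i : ℕ} (hB : e.eval s ≤ B) (h : Q (s.setReg i (e.eval s))) :
    Runs B N (.assign i e) s Q :=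
  fun hs _ hW => ⟨_, _, .assign i e s (RamExpr.fits hs hW), le_rfl, hs.setReg hB, h⟩

theorem Runs.store (hB : e.eval s ≤ B) (h : Q (s.setMem (a.eval s) (e.eval s))) :
    Runs B N (.store a e) s Q :=
  fun hs _ hW => ⟨_, _, .store a e s (RamExpr.fits hs ((Nat.le_add_right _ _).trans hW))
    (RamExpr.fits hs ((Nat.le_add_left _ _).trans hW)), le_rfl, hs.setMem hB, h⟩

theorem RunsIn.seq (h : RunsIn B T p s fun s' => RunsIn B T' q s' Q) :
    RunsIn B (T + T') (.seq p q) s Q := by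
  intro hs W hW
  obtain ⟨s', t, h1, h2, h3, h4⟩ := h hs W ((Nat.le_add_right _ _).trans hW)
  obtain ⟨s'', t', h1', h2', h3', h4'⟩ := h4 h3 W ((Nat.le_add_left _ _).trans hW)
  exact ⟨s'', t + t', .seq _ _ _ _ _ _ _ h1 h1', by omega, h3', h4'⟩

theorem Runs.seq (h : Runs B N p s fun s' => Runs B N q s' Q) : Runs B N (.seq p q) s Q :=
  RunsIn.seq h

theorem Runs.ite (h1 : e.eval s ≠ 0 → Runs B N p s Q) (h2 : e.eval s = 0 → Runs B N q s Q) :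
    Runs B N (.ite e p q) s Q := by
  intro hs W hW
  have hn : e.need B + p.need B + q.need B ≤ W := hW
  have ht : (RamProg.ite e p q).time N = e.cost + 1 + (p.time N + q.time N) := rfl
  by_cases he : e.eval s = 0
  · obtain ⟨s', t, k1, k2, k3, k4⟩ := h2 he hs W (by omega)
    exact ⟨s', _, .ite_false _ _ _ _ _ _ (RamExpr.fits hs (by omega)) he k1, by omega, k3, k4⟩
  · obtain ⟨s', t, k1, k2, k3, k4⟩ := h1 he hs W (by omega)
    exact ⟨s', _, .ite_true _ _ _ _ _ _ (RamExpr.fits hs (by omega)) he k1, by omega, k3, k4⟩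

/-- The loop in which the register `r` runs through the numbers below `b`. -/
def RamProg.forLoop (r : ℕ) (b : RamExpr) (p : RamProg) : RamProg :=
  .seq (.assign r (.lit 0)) (.loop (.bin .sub b (.reg r))
    (.seq p (.assign r (.bin .add (.reg r) (.lit 1)))))

theorem RamProg.writes_forLoop {r : ℕ} {b : RamExpr} {i : ℕ} :
    (RamProg.forLoop r b p).Writes i ↔ i = r ∨ p.Writes i := by
  simp only [RamProg.forLoop, RamProg.Writes]
  tauto

/-- Induction on the number `m` of rounds that are left. The increment takes 4 steps, and the test
takes `b.cost + 3` steps and is made once more than the body. `S` is what keeps the bound `b`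
constant. -/
theorem RunsIn.loop_from {r K : ℕ} {b : RamExpr} {I : ℕ → RamState → Prop} (hK : K ≤ B)
    {S : RamState → Prop} (hS : ∀ s', S s' → ∀ v, S (s'.setReg r v))
    (hb : ∀ s', S s' → b.eval s' = K)
    (hbody : ∀ i < K, ∀ s', s'.reg r = i → S s' → I i s' →
      RunsIn B T p s' fun s'' => S s'' ∧ s''.reg r = i ∧ I (i + 1) (s''.setReg r (i + 1)))
    (m : ℕ) (hm : m ≤ K) (hr : s.reg r = K - m) (hs : S s) (h : I (K - m) s) :
    RunsIn B (m * (T + 4) + (m + 1) * (b.cost + 3)) (.loop (.bin .sub b (.reg r))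
      (.seq p (.assign r (.bin .add (.reg r) (.lit 1))))) s (I K) := by
  induction m generalizing s with
  | zero =>
    intro hB W hW
    refine ⟨s, _, .loop_false _ _ _ (RamExpr.fits hB ((Nat.le_add_right _ _).trans hW)) ?_, ?_, hB,
      by simpa using h⟩
    · simp [RamExpr.eval, RamOp.apply, hb s hs, hr]
    · simp [RamExpr.cost]
  | succ m ih =>
    intro hB W hW
    have hW' : (RamExpr.bin .sub b (.reg r)).need B +
      (p.need B + (RamExpr.bin .add (.reg r) (.lit 1)).need B) ≤ W := hW
    have h1 : RunsIn B (T + 4) (.seq p (.assign r (.bin .add (.reg r) (.lit 1)))) s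
        fun s' => S s' ∧ s'.reg r = K - m ∧ I (K - m) s' := by
      refine RunsIn.seq (RunsIn.mono (hbody _ (by omega) s hr hs h) le_rfl fun s' hs' => ?_)
      have he : (RamExpr.bin .add (.reg r) (.lit 1)).eval s' = K - m := by
        simp only [RamExpr.eval, RamOp.apply, hs'.2.1]
        omega
      refine RunsIn.mono (Runs.assign (N := 0) (by omega)
        (Q := fun s' => S s' ∧ s'.reg r = K - m ∧ I (K - m) s') ?_) le_rfl fun _ h => h
      rw [he]
      refine ⟨hS _ hs'.1 _, by simp, ?_⟩
      have := hs'.2.2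
      rwa [show K - (m + 1) + 1 = K - m by omega] at this
    obtain ⟨s', t, k1, k2, k3, k4, k5, k6⟩ := h1 hB W (by
      change p.need B + (RamExpr.bin .add (.reg r) (.lit 1)).need B ≤ W; omega)
    obtain ⟨s'', t', l1, l2, l3, l4⟩ := ih (by omega) k5 k4 k6 k3 W hW
    refine ⟨s'', _, .loop_true _ _ _ _ _ _ _ (RamExpr.fits hB (by omega)) ?_ k1 l1, ?_, l3, l4⟩
    · simp only [RamExpr.eval, RamOp.apply, hb s hs, hr]
      omega
    · simp only [RamExpr.cost]
      have e1 : (m + 1) * (T + 4) = m * (T + 4) + (T + 4) := by ring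
      have e2 : (m + 1 + 1) * (b.cost + 3) = (m + 1) * (b.cost + 3) + (b.cost + 3) := by ring
      omega

/-- The number of rounds enters the time explicitly. This is needed for the loop over all guesses,
which makes far more rounds than the uniform bound of `Runs` allows. The summand 2 is the initial
assignment. -/
theorem RunsIn.forLoop {r K : ℕ} {b : RamExpr} (I : ℕ → RamState → Prop) (hK : K ≤ B)
    (hr : ¬ p.Writes r)
    (hb : ∀ s', (∀ i, ¬ (RamProg.forLoop r b p).Writes i → s'.reg i = s.reg i) → b.eval s' = K)
    (h0 : I 0 (s.setReg r 0))
    (hbody : ∀ i < K, ∀ s', s'.reg r = i →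
      (∀ i, ¬ (RamProg.forLoop r b p).Writes i → s'.reg i = s.reg i) → I i s' →
      RunsIn B T p s' fun s'' => I (i + 1) (s''.setReg r (i + 1))) :
    RunsIn B (2 + (K * (T + 4) + (K + 1) * (b.cost + 3))) (.forLoop r b p) s fun s' =>
      I K s' ∧ ∀ i, ¬ (RamProg.forLoop r b p).Writes i → s'.reg i = s.reg i := by
  have hset : ∀ s' : RamState,
      (∀ i, ¬ (RamProg.forLoop r b p).Writes i → s'.reg i = s.reg i) → ∀ v,
      ∀ i, ¬ (RamProg.forLoop r b p).Writes i → (s'.setReg r v).reg i = s.reg i := by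
    intro s' hs' v i hi
    rw [RamState.setReg_reg, if_neg, hs' i hi]
    exact fun h => hi (RamProg.writes_forLoop.2 (Or.inl h))
  refine RunsIn.frame (RunsIn.seq (Runs.assign (N := 0) (Nat.zero_le _) ?_))
  refine RunsIn.loop_from (S := fun s' => ∀ i, ¬ (RamProg.forLoop r b p).Writes i →
    s'.reg i = s.reg i) hK hset hb ?_ K le_rfl (by simp [RamExpr.eval])
    (hset s (fun _ _ => rfl) _) (by simpa [RamExpr.eval] using h0)
  intro i hi s' h1 h2 h3
  refine (hbody i hi s' h1 h2 h3).frame.mono le_rfl fun s'' h => ⟨fun j hj => ?_, ?_, h.1⟩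
  · rw [h.2 j fun hw => hj (RamProg.writes_forLoop.2 (Or.inr hw)), h2 j hj]
  · rw [h.2 r hr, h1]

theorem Runs.forLoop {r K : ℕ} {b : RamExpr} (I : ℕ → RamState → Prop) (hK : K ≤ B) (hN : K ≤ N)
    (hr : ¬ p.Writes r)
    (hb : ∀ s', (∀ i, ¬ (RamProg.forLoop r b p).Writes i → s'.reg i = s.reg i) → b.eval s' = K)
    (h0 : I 0 (s.setReg r 0))
    (hbody : ∀ i < K, ∀ s', s'.reg r = i →
      (∀ i, ¬ (RamProg.forLoop r b p).Writes i → s'.reg i = s.reg i) → I i s' →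
      Runs B N p s' fun s'' => I (i + 1) (s''.setReg r (i + 1))) :
    Runs B N (.forLoop r b p) s fun s' =>
      I K s' ∧ ∀ i, ¬ (RamProg.forLoop r b p).Writes i → s'.reg i = s.reg i := by
  refine RunsIn.mono (RunsIn.forLoop I hK hr hb h0 hbody) ?_ fun _ h => h
  simp only [RamProg.forLoop, RamProg.time, RamExpr.cost]
  have e1 := Nat.mul_le_mul_right (p.time N + 4) hN
  have e2 := Nat.mul_le_mul_right (b.cost + 3) hN
  have e3 : (N + 1) * (b.cost + 1 + 1 + 1) = N * (b.cost + 3) + (b.cost + 3) := by ring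
  have e4 : (K + 1) * (b.cost + 3) = K * (b.cost + 3) + (b.cost + 3) := by ring
  have e5 : N * (p.time N + (1 + 1 + 1 + 1)) = N * (p.time N + 4) := by ring
  omega

/-- The programs `f 0`, …, `f (k - 1)` one after the other. -/
def RamProg.seqRange (f : ℕ → RamProg) : ℕ → RamProg
  | 0 => .skip
  | k + 1 => .seq (seqRange f k) (f k)

theorem RamProg.writes_seqRange {f : ℕ → RamProg} {k i : ℕ}
    (h : (RamProg.seqRange f k).Writes i) : ∃ j < k, (f j).Writes i := by
  induction k with
  | zero => exact h.elim
  | succ k ih =>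
    rcases h with h | h
    · obtain ⟨j, hj, h⟩ := ih h
      exact ⟨j, by omega, h⟩
    · exact ⟨k, by omega, h⟩

theorem RamProg.depth_seqRange {f : ℕ → RamProg} {k d : ℕ} (h : ∀ j, (f j).depth ≤ d) :
    (RamProg.seqRange f k).depth ≤ d := by
  induction k with
  | zero => exact Nat.zero_le _
  | succ k ih => exact max_le ih (h k)

theorem Runs.seqRange {f : ℕ → RamProg} {k : ℕ} (I : ℕ → RamState → Prop) (h0 : I 0 s)
    (h : ∀ j < k, ∀ s', I j s' → Runs B N (f j) s' (I (j + 1))) :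
    Runs B N (RamProg.seqRange f k) s (I k) := by
  induction k with
  | zero => exact Runs.skip h0
  | succ k ih => exact Runs.seq ((ih fun j hj => h j (by omega)).mono (h k (by omega)))

theorem RamExpr.exists_need_le (e : RamExpr) : ∃ C k, ∀ B, e.need B ≤ C * (B + 1) ^ k := by
  induction e with
  | lit k => exact ⟨k, 0, fun B => by simp [RamExpr.need]⟩
  | reg i => exact ⟨1, 1, fun B => by simp [RamExpr.need]⟩
  | load a ih =>
    obtain ⟨C, k, h⟩ := ih
    refine ⟨C + 1, k + 1, fun B => ?_⟩
    have := h B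
    have h1 : (B + 1) ^ k ≥ 1 := Nat.one_le_pow _ _ (by omega)
    have h2 : C * (B + 1) ^ k ≤ C * (B + 1) ^ (k + 1) :=
      Nat.mul_le_mul_left _ (Nat.pow_le_pow_right (by omega) (by omega))
    have h3 : B ≤ (B + 1) ^ (k + 1) := by
      rw [pow_succ]; nlinarith
    simp only [RamExpr.need]
    linarith
  | bin op a b iha ihb =>
    obtain ⟨C, k, h⟩ := iha
    obtain ⟨D, l, h'⟩ := ihb
    refine ⟨C + D + C * D, k + l, fun B => ?_⟩
    have h2 : C * (B + 1) ^ k ≤ C * (B + 1) ^ (k + l) :=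
      Nat.mul_le_mul_left _ (Nat.pow_le_pow_right (by omega) (by omega))
    have h3 : D * (B + 1) ^ l ≤ D * (B + 1) ^ (k + l) :=
      Nat.mul_le_mul_left _ (Nat.pow_le_pow_right (by omega) (by omega))
    have h4 := Nat.mul_le_mul (h B) (h' B)
    have h5 : C * (B + 1) ^ k * (D * (B + 1) ^ l) = C * D * (B + 1) ^ (k + l) := by ring
    have := h B
    have := h' B
    simp only [RamExpr.need]
    linarith

theorem exists_add_le {f g : ℕ → ℕ} (hf : ∃ C k, ∀ B, f B ≤ C * (B + 1) ^ k)
    (hg : ∃ C k, ∀ B, g B ≤ C * (B + 1) ^ k) : ∃ C k, ∀ B, f B + g B ≤ C * (B + 1) ^ k := by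
  obtain ⟨C, k, h⟩ := hf
  obtain ⟨D, l, h'⟩ := hg
  refine ⟨C + D, k + l, fun B => ?_⟩
  have h2 : C * (B + 1) ^ k ≤ C * (B + 1) ^ (k + l) :=
    Nat.mul_le_mul_left _ (Nat.pow_le_pow_right (by omega) (by omega))
  have h3 : D * (B + 1) ^ l ≤ D * (B + 1) ^ (k + l) :=
    Nat.mul_le_mul_left _ (Nat.pow_le_pow_right (by omega) (by omega))
  have := h B
  have := h' B
  linarith

/-- Words of polynomial size, hence of `O(log n)` bits, suffice when the stored values are
polynomially bounded. -/
theorem RamProg.exists_need_le (p : RamProg) : ∃ C k, ∀ B, p.need B ≤ C * (B + 1) ^ k := by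
  induction p with
  | skip => exact ⟨0, 0, fun B => by simp [RamProg.need]⟩
  | assign i e => exact e.exists_need_le
  | store a e => exact exists_add_le a.exists_need_le e.exists_need_le
  | seq p q ihp ihq => exact exists_add_le ihp ihq
  | ite e p q ihp ihq => exact exists_add_le (exists_add_le e.exists_need_le ihp) ihq
  | loop e p ih => exact exists_add_le e.exists_need_le ih

/-- Each level of nesting contributes one factor `N + 1`. -/
theorem RamProg.exists_time_le (p : RamProg) : ∃ C, ∀ N, p.time N ≤ C * (N + 1) ^ p.depth := by
  have hm : ∀ {C k l N : ℕ}, k ≤ l → C * (N + 1) ^ k ≤ C * (N + 1) ^ l := fun h =>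
    Nat.mul_le_mul_left _ (Nat.pow_le_pow_right (by omega) h)
  induction p with
  | skip => exact ⟨1, fun N => by simp [RamProg.time, RamProg.depth]⟩
  | assign i e => exact ⟨e.cost + 1, fun N => by simp [RamProg.time, RamProg.depth]⟩
  | store a e => exact ⟨a.cost + e.cost + 1, fun N => by simp [RamProg.time, RamProg.depth]⟩
  | seq p q ihp ihq =>
    obtain ⟨C, h⟩ := ihp
    obtain ⟨D, h'⟩ := ihq
    refine ⟨C + D, fun N => ?_⟩
    have := (h N).trans (hm (le_max_left p.depth q.depth))
    have := (h' N).trans (hm (le_max_right p.depth q.depth))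
    simp only [RamProg.time, RamProg.depth]
    linarith
  | ite e p q ihp ihq =>
    obtain ⟨C, h⟩ := ihp
    obtain ⟨D, h'⟩ := ihq
    refine ⟨e.cost + 1 + (C + D), fun N => ?_⟩
    have := (h N).trans (hm (le_max_left p.depth q.depth))
    have := (h' N).trans (hm (le_max_right p.depth q.depth))
    have := hm (C := e.cost + 1) (N := N) (Nat.zero_le (max p.depth q.depth))
    simp only [RamProg.time, RamProg.depth]
    simp only [pow_zero, mul_one] at this
    linarith
  | loop e p ih =>
    obtain ⟨C, h⟩ := ih
    refine ⟨e.cost + 1 + C, fun N => ?_⟩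
    have h1 := hm (C := e.cost + 1) (N := N) (show 1 ≤ p.depth + 1 by omega)
    have h2 : N * p.time N ≤ (N + 1) * (C * (N + 1) ^ p.depth) :=
      Nat.mul_le_mul (by omega) (h N)
    have h3 : (N + 1) * (C * (N + 1) ^ p.depth) = C * (N + 1) ^ (p.depth + 1) := by ring
    have h4 : (N + 1) * (e.cost + 1) = (e.cost + 1) * (N + 1) ^ 1 := by ring
    simp only [RamProg.time, RamProg.depth]
    linarith

end RamLogic

/-! ### Memory layout, tests, and the search for a vertex. -/

section RamArrays

/-- The expression tests for equality. -/
def eqE (a b : RamExpr) : RamExpr :=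
  .bin .sub (.lit 1) (.bin .add (.bin .sub a b) (.bin .sub b a))

/-- The expression tests for zero. -/
def notE (a : RamExpr) : RamExpr := .bin .sub (.lit 1) a

/-- The expression is nonzero if both expressions are. -/
def andE (a b : RamExpr) : RamExpr := .bin .mul a b

/-- The address of a cell of the `j`-th array behind the adjacency matrix. -/
def arrAddr (j : ℕ) (a : RamExpr) : RamExpr :=
  .bin .add (.bin .add (.bin .mul (.reg 0) (.reg 0)) (.bin .mul (.lit j) (.reg 0))) a

/-- An entry of the `j`-th array behind the adjacency matrix. -/
def arrE (j : ℕ) (a : RamExpr) : RamExpr := .load (arrAddr j a)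

/-- An entry of the adjacency matrix. -/
def adjE (a b : RamExpr) : RamExpr := .load (.bin .add (.bin .mul a (.reg 0)) b)

variable {n : ℕ} {G : SimpleGraph (Fin n)} {A : ℕ → Fin n → ℕ} {s : RamState}

theorem eval_eqE (a b : RamExpr) :
    (eqE a b).eval s = if a.eval s = b.eval s then 1 else 0 := by
  simp only [eqE, RamExpr.eval, RamOp.apply]
  split_ifs <;> omega

theorem eval_notE (a : RamExpr) : (notE a).eval s = if a.eval s = 0 then 1 else 0 := by
  simp only [notE, RamExpr.eval, RamOp.apply]
  split_ifs <;> omega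

theorem eval_eqE_le (a b : RamExpr) : (eqE a b).eval s ≤ 1 := by
  rw [eval_eqE]; split_ifs <;> omega

theorem eval_notE_le (a : RamExpr) : (notE a).eval s ≤ 1 := by
  rw [eval_notE]; split_ifs <;> omega

theorem eval_andE_ne (a b : RamExpr) :
    (andE a b).eval s ≠ 0 ↔ a.eval s ≠ 0 ∧ b.eval s ≠ 0 := by
  simp [andE, RamExpr.eval, RamOp.apply]

theorem eval_eqE_ne (a b : RamExpr) : (eqE a b).eval s ≠ 0 ↔ a.eval s = b.eval s := by
  simp [eval_eqE]

theorem eval_notE_ne (a : RamExpr) : (notE a).eval s ≠ 0 ↔ a.eval s = 0 := by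
  simp [eval_notE]

open Classical in
/-- The state holds the graph, and behind its adjacency matrix the arrays `A j`. -/
structure Holds (G : SimpleGraph (Fin n)) (A : ℕ → Fin n → ℕ) (s : RamState) : Prop where
  size : s.reg 0 = n
  adj : ∀ u v : Fin n, s.mem ((u : ℕ) * n + (v : ℕ)) = if G.Adj u v then 1 else 0
  arr : ∀ j (v : Fin n), s.mem (n * n + j * n + (v : ℕ)) = A j v

/-- Changing one entry of one array. -/
def setArr (A : ℕ → Fin n → ℕ) (j : ℕ) (v : Fin n) (x : ℕ) : ℕ → Fin n → ℕ :=
  fun i w => if i = j ∧ w = v then x else A i w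

theorem Holds.setReg (h : Holds G A s) {i : ℕ} (hi : i ≠ 0) (x : ℕ) : Holds G A (s.setReg i x) :=
  ⟨by rw [RamState.setReg_reg, if_neg hi.symm, h.size], h.adj, h.arr⟩

/-- Division with remainder by `n`: an address determines its array, or row, and its position there.
-/
theorem mul_add_inj {i j : ℕ} {v w : Fin n} (h : i * n + (v : ℕ) = j * n + (w : ℕ)) :
    i = j ∧ v = w := by
  have hn : 0 < n := v.pos
  have h1 : (n * i + (v : ℕ)) / n = i := by
    rw [Nat.mul_add_div hn, Nat.div_eq_of_lt v.2, add_zero]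
  have h2 : (n * j + (w : ℕ)) / n = j := by
    rw [Nat.mul_add_div hn, Nat.div_eq_of_lt w.2, add_zero]
  have hij : i = j := by
    rw [← h1, ← h2, mul_comm n i, mul_comm n j, h]
  subst hij
  exact ⟨rfl, Fin.ext (by omega)⟩

theorem Holds.setMem (h : Holds G A s) (j : ℕ) (v : Fin n) (x : ℕ) :
    Holds G (setArr A j v x) (s.setMem (n * n + j * n + (v : ℕ)) x) := by
  have key : ∀ i (w : Fin n), n * n + i * n + (w : ℕ) = n * n + j * n + (v : ℕ) ↔
      i = j ∧ w = v := by
    intro i w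
    constructor
    · intro he
      exact mul_add_inj (by omega)
    · rintro ⟨rfl, rfl⟩; rfl
  refine ⟨h.size, fun u w => ?_, fun i w => ?_⟩
  · rw [RamState.setMem_mem, if_neg, h.adj]
    intro he
    have h1 : (u : ℕ) * n + (w : ℕ) < n * n := by
      have := Nat.mul_le_mul_right n (Nat.succ_le_of_lt u.2)
      have := w.2
      rw [Nat.succ_mul] at *
      omega
    omega
  · rw [RamState.setMem_mem, h.arr, setArr]
    simp only [key]

theorem Holds.eval_arrAddr (h : Holds G A s) {a : RamExpr} {v : Fin n} (ha : a.eval s = v) (j : ℕ) :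
    (arrAddr j a).eval s = n * n + j * n + (v : ℕ) := by
  simp [arrAddr, RamExpr.eval, RamOp.apply, h.size, ha]

theorem Holds.eval_arrE (h : Holds G A s) {a : RamExpr} {v : Fin n} (ha : a.eval s = v) (j : ℕ) :
    (arrE j a).eval s = A j v := by
  rw [arrE, RamExpr.eval, h.eval_arrAddr ha, h.arr]

theorem Holds.eval_adjE (h : Holds G A s) {a b : RamExpr} {u v : Fin n} (ha : a.eval s = u)
    (hb : b.eval s = v) : (adjE a b).eval s ≠ 0 ↔ G.Adj u v := by
  have : (adjE a b).eval s = s.mem ((u : ℕ) * n + (v : ℕ)) := by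
    simp [adjE, RamExpr.eval, RamOp.apply, h.size, ha, hb]
  rw [this, h.adj]
  split_ifs with h <;> simp [h]

variable {B N : ℕ} {Q : RamState → Prop} {a e : RamExpr}

theorem Holds.storeArr (h : Holds G A s) {j : ℕ} {v : Fin n} (ha : a.eval s = v)
    (hB : e.eval s ≤ B) (hQ : ∀ s', Holds G (setArr A j v (e.eval s)) s' → s'.reg = s.reg → Q s') :
    Runs B N (.store (arrAddr j a) e) s Q := by
  refine Runs.store hB ?_
  rw [h.eval_arrAddr ha]
  exact hQ _ (h.setMem j v _) rfl

/-- Search a vertex `u` with a property: register `7` becomes `u + 1`, or `0` if there is none. -/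
def searchProg (cond : RamExpr) : RamProg :=
  .seq (.assign 7 (.lit 0)) (.forLoop 6 (.reg 0)
    (.ite cond (.assign 7 (.bin .add (.reg 6) (.lit 1))) .skip))

theorem writes_searchProg {cond : RamExpr} {i : ℕ} :
    (searchProg cond).Writes i ↔ i = 6 ∨ i = 7 := by
  simp only [searchProg, RamProg.Writes, RamProg.writes_forLoop]
  tauto

theorem Holds.search (h : Holds G A s) (hB : n + 1 ≤ B) (hN : n ≤ N) {cond : RamExpr}
    (c : Fin n → Prop) (hc : ∀ s', Holds G A s' → (∀ j, j ≠ 6 → j ≠ 7 → s'.reg j = s.reg j) →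
      ∀ u : Fin n, s'.reg 6 = u → (cond.eval s' ≠ 0 ↔ c u)) :
    Runs B N (searchProg cond) s fun s' => Holds G A s' ∧
      ((s'.reg 7 = 0 ∧ ∀ u, ¬ c u) ∨ ∃ u, c u ∧ s'.reg 7 = u + 1) ∧
      ∀ j, j ≠ 6 → j ≠ 7 → s'.reg j = s.reg j := by
  refine Runs.mono (Runs.frame (p := searchProg cond) (Q := fun s' => Holds G A s' ∧
      ((s'.reg 7 = 0 ∧ ∀ u, ¬ c u) ∨ ∃ u, c u ∧ s'.reg 7 = u + 1)) ?_) fun s' hs' =>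
    ⟨hs'.1.1, hs'.1.2, fun j h6 h7 => hs'.2 j (by simp [writes_searchProg, h6, h7])⟩
  refine Runs.seq (Runs.assign (Nat.zero_le _) ?_)
  refine Runs.mono (Runs.forLoop (K := n) (fun i s' => Holds G A s' ∧
    ((s'.reg 7 = 0 ∧ ∀ u : Fin n, (u : ℕ) < i → ¬ c u) ∨ ∃ u, c u ∧ s'.reg 7 = u + 1)) (by omega)
    hN (by simp [RamProg.Writes]) ?_ ?_ ?_) fun s' hs' => ⟨hs'.1.1, hs'.1.2.imp (fun h =>
      ⟨h.1, fun u => h.2 u u.2⟩) id⟩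
  · intro s' hs'
    rw [RamExpr.eval, hs' 0 (by simp [RamProg.writes_forLoop, RamProg.Writes])]
    simp [RamState.setReg_reg, h.size]
  · refine ⟨(h.setReg (by omega) _).setReg (by omega) _, Or.inl ⟨?_, by simp⟩⟩
    simp [RamState.setReg_reg, RamExpr.eval]
  · rintro i hi s' hr hfr ⟨hs', hi'⟩
    have hc' := hc s' hs' (fun j h6 h7 => by
      rw [hfr j (by simp [RamProg.writes_forLoop, RamProg.Writes, h6, h7])]
      simp [RamState.setReg_reg, h7]) ⟨i, hi⟩ hr
    -- A later hit overwrites an earlier one, so the invariant claims only some vertex with the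
    -- property.
    refine Runs.ite (fun he => Runs.assign ?_ ⟨?_, Or.inr ⟨⟨i, hi⟩, hc'.1 he, ?_⟩⟩)
      (fun he => Runs.skip ⟨hs'.setReg (by omega) _, ?_⟩)
    · simp only [RamExpr.eval, RamOp.apply, hr]; omega
    · exact (hs'.setReg (by omega) _).setReg (by omega) _
    · simp [RamState.setReg_reg, RamExpr.eval, RamOp.apply, hr]
    · refine hi'.imp (fun h => ⟨?_, fun u hu hcu => ?_⟩) (fun ⟨u, h1, h2⟩ => ⟨u, h1, ?_⟩)
      · simpa [RamState.setReg_reg] using h.1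
      · rcases Nat.lt_succ_iff_lt_or_eq.1 hu with h1 | h1
        · exact h.2 u h1 hcu
        · have : u = ⟨i, hi⟩ := Fin.ext h1
          subst this
          exact hc'.2 hcu he
      · simpa [RamState.setReg_reg] using h2

end RamArrays

/-! ### Breadth-first levels and shortest induced paths. -/

section Levels

variable {V : Type*} {G : SimpleGraph V}

/-- After `d` rounds of a breadth-first search from `x` in which only the vertices of `S` may be
entered: `L v` is `0` if `v` has not been reached, and one more than its distance otherwise. -/
structure IsLevel (G : SimpleGraph V) (S : Set V) (x : V) (d : ℕ) (L : V → ℕ) : Prop where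
  one_iff : ∀ v, L v = 1 ↔ v = x
  le : ∀ v, L v ≤ d + 1
  pred : ∀ v k, L v = k + 2 → v ∈ S ∧ ∃ u, G.Adj u v ∧ L u = k + 1
  step : ∀ u v, G.Adj u v → v ∈ S → L u ≠ 0 → L u ≤ d → L v ≠ 0 ∧ L v ≤ L u + 1

variable {S : Set V} {x y : V} {d : ℕ} {L L' : V → ℕ}

open Classical in
theorem isLevel_zero (hL : ∀ v, L v = if v = x then 1 else 0) : IsLevel G S x 0 L := by
  refine ⟨fun v => ?_, fun v => ?_, fun v k h => ?_, fun u v _ _ h0 h1 => by omega⟩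
  · rw [hL]; split_ifs with h <;> simp [h]
  · rw [hL]; split_ifs <;> simp
  · rw [hL] at h; split_ifs at h; omega

open Classical in
-- Levels once given never change, and new ones are all `d + 2`. So only for neighbours of vertices
-- of level `d + 1` does the new round add to `step`.
theorem IsLevel.succ (h : IsLevel G S x d L) (hL' : ∀ v, L' v =
    if L v = 0 ∧ v ∈ S ∧ ∃ u, G.Adj u v ∧ L u = d + 1 then d + 2 else L v) :
    IsLevel G S x (d + 1) L' := by
  have hsame : ∀ v, L v ≠ 0 → L' v = L v := fun v hv => by rw [hL', if_neg fun h => hv h.1]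
  have hold : ∀ v, L' v ≤ d + 1 → L' v = L v := by
    intro v hv
    rw [hL'] at hv ⊢
    split_ifs at hv ⊢
    · omega
    · rfl
  refine ⟨fun v => ?_, fun v => ?_, fun v k hv => ?_, fun u v huv hv h0 hd => ?_⟩
  · rw [← h.one_iff]
    constructor
    · intro hv
      rw [← hold v (by omega), hv]
    · intro hv
      rw [hsame v (by omega), hv]
  · have := h.le v
    rw [hL']
    split_ifs <;> omega
  · by_cases hv' : L' v = L v
    · obtain ⟨h1, u, h2, h3⟩ := h.pred v k (hv' ▸ hv)
      exact ⟨h1, u, h2, by rw [hsame u (by omega), h3]⟩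
    · rw [hL'] at hv
      split_ifs at hv with hc
      · obtain ⟨-, h1, u, h2, h3⟩ := hc
        refine ⟨h1, u, h2, ?_⟩
        rw [hsame u (by omega)]
        omega
      · exact absurd (by rw [hL', if_neg hc]) hv'
  · have hu := hold u hd
    rw [hu] at h0 hd ⊢
    by_cases hv0 : L v = 0
    · by_cases hd' : L u ≤ d
      · exact absurd hv0 (h.step u v huv hv h0 hd').1
      · have : L' v = d + 2 := by rw [hL', if_pos ⟨hv0, hv, u, huv, by omega⟩]
        omega
    · rw [hsame v hv0]
      refine ⟨hv0, ?_⟩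
      by_cases hd' : L u ≤ d
      · exact (h.step u v huv hv h0 hd').2
      · have := h.le v
        omega

/-- Along the list the levels increase one by one. -/
def Ascends (G : SimpleGraph V) (S : Set V) (L : V → ℕ) : List V → Prop
  | [] => True
  | u :: t => Ascends G S L t ∧ ∀ w, t.head? = some w → G.Adj u w ∧ L w = L u + 1 ∧ w ∈ S

theorem Ascends.lt {u : V} {t : List V} (h : Ascends G S L (u :: t)) : ∀ w ∈ t,
    w ∈ S ∧ L u < L w ∧ (L w = L u + 1 → t.head? = some w) := by
  induction t generalizing u with
  | nil => simp
  | cons v t ih =>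
    have h1 := h.2 v rfl
    intro w hw
    rcases List.mem_cons.1 hw with rfl | hw
    · exact ⟨h1.2.2, by omega, fun _ => rfl⟩
    · have h2 := ih h.1 w hw
      exact ⟨h2.1, by omega, fun _ => by omega⟩

theorem Ascends.length {u y : V} {t : List V} (h : Ascends G S L (u :: t))
    (hy : (u :: t).getLast? = some y) : L y = L u + t.length := by
  induction t generalizing u with
  | nil => simp at hy; simp [hy]
  | cons v t ih =>
    have h1 := h.2 v rfl
    have h2 := ih h.1 (by simpa using hy)
    rw [h2, h1.2.1, List.length_cons]
    omega

/-- Along an edge into `S` the level rises by at most one, so a vertex of the path has no neighbour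
further along except its successor. -/
theorem Ascends.indPath (hL : IsLevel G S x d L) {t : List V} (h : Ascends G S L t)
    (h0 : ∀ u, t.head? = some u → L u ≠ 0) : IndPath G t := by
  induction t with
  | nil => trivial
  | cons u t ih =>
    have hu : L u ≠ 0 := h0 u rfl
    refine ⟨ih h.1 fun w hw => ?_, fun w hw => ?_⟩
    · have := h.2 w hw
      omega
    · have hlt := h.lt w hw
      refine ⟨fun he => by rw [he] at hlt; omega, fun huw => ?_, fun hw => (h.2 w hw).1⟩
      have := hL.le w
      have := (hL.step u w huw hlt.1 hu (by omega)).2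
      exact hlt.2.2 (by omega)

/-- An induced path from `x` to `y` whose interior vertices are not marked and have no neighbours
with marks other than `μ`. -/
structure Connects (G : SimpleGraph V) (m : V → ℕ) (μ : ℕ) (x y : V) (X : List V) : Prop where
  indPath : IndPath G X
  head : X.head? = some x
  last : X.getLast? = some y
  free : ∀ v ∈ X, v ≠ x → v ≠ y → m v = 0 ∧ ∀ u, G.Adj v u → m u ≠ 0 → m u = μ

/-- The vertices that may be entered in the search of a path to `y`. -/
def freeSet (G : SimpleGraph V) (m : V → ℕ) (μ : ℕ) (y : V) : Set V :=
  {v | v = y ∨ m v = 0 ∧ ∀ u, G.Adj v u → m u ≠ 0 → m u = μ}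

/-- Along a connecting path the level at position `k` is at most `k + 1`. The path has no
repetitions, so `Fintype.card V` rounds reach its end. Thus the search finds a path whenever there
is one, and no other is shorter. -/
theorem IsLevel.le_length {m : V → ℕ} {μ : ℕ} [Fintype V]
    (hL : IsLevel G (freeSet G m μ y) x (Fintype.card V) L) {X : List V}
    (hX : Connects G m μ x y X) : L y ≠ 0 ∧ L y ≤ X.length := by
  have hn := hX.indPath.nodup
  have hc := hn.length_le_card
  obtain ⟨-, ha⟩ := indPath_iff_getElem.1 hX.indPath
  have hpos : X ≠ [] := fun h => by simpa [h] using hX.head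
  have hp := List.length_pos_iff.2 hpos
  have h0 : X[0] = x := by
    have := hX.head
    rw [List.head?_eq_getElem?, List.getElem?_eq_getElem hp] at this
    simpa using this
  have key : ∀ k (hk : k < X.length), L X[k] ≠ 0 ∧ L X[k] ≤ k + 1 := by
    intro k
    induction k with
    | zero =>
      intro hk
      rw [h0, (hL.one_iff x).2 rfl]
      simp
    | succ k ih =>
      intro hk
      obtain ⟨h1, h2⟩ := ih (by omega)
      have hx : X[k + 1] ≠ x := by
        rw [← h0, Ne, hn.getElem_inj_iff]
        omega
      have hS : X[k + 1] ∈ freeSet G m μ y := by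
        by_cases hy : X[k + 1] = y
        · exact Or.inl hy
        · exact Or.inr (hX.free _ (List.getElem_mem hk) hx hy)
      have := hL.step X[k] X[k + 1] ((ha k (k + 1) (by omega) hk).2 (Or.inl rfl)) hS h1 (by omega)
      omega
  have hl : X[X.length - 1] = y := by
    have := hX.last
    rw [List.getLast?_eq_getElem?, List.getElem?_eq_getElem (by omega)] at this
    simpa using this
  have := key (X.length - 1) (by omega)
  rw [hl] at this
  omega

theorem Ascends.connects {m : V → ℕ} {μ : ℕ} (hL : IsLevel G (freeSet G m μ y) x d L)
    {t : List V} (h : Ascends G (freeSet G m μ y) L (x :: t))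
    (hy : (x :: t).getLast? = some y) : Connects G m μ x y (x :: t) := by
  have hx := (hL.one_iff x).2 rfl
  refine ⟨h.indPath hL fun u hu => ?_, rfl, hy, fun v hv hvx hvy => ?_⟩
  · simp only [List.head?_cons, Option.some_inj] at hu
    subst hu
    omega
  · rcases List.mem_cons.1 hv with hv | hv
    · exact absurd hv hvx
    · exact (h.lt v hv).1.resolve_left hvy

end Levels

/-! ### The program for shortest paths: preparation and rounds. -/

section PathProgram

/-- Array `3` becomes the characteristic vector of the vertices that may be entered, and array `2`
the levels before the first round. -/
def initProg (ex ey : RamExpr) (μ : ℕ) : RamProg :=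
  .forLoop 5 (.reg 0) (.seq
    (searchProg (andE (adjE (.reg 5) (.reg 6))
      (andE (arrE 1 (.reg 6)) (notE (eqE (arrE 1 (.reg 6)) (.lit μ))))))
    (.seq (.store (arrAddr 3 (.reg 5))
        (.bin .add (eqE (.reg 5) ey) (andE (notE (arrE 1 (.reg 5))) (notE (.reg 7)))))
      (.store (arrAddr 2 (.reg 5)) (eqE (.reg 5) ex))))

/-- The rounds of the breadth-first search. -/
def roundsProg : RamProg :=
  .forLoop 4 (.reg 0) (.forLoop 5 (.reg 0)
    (.ite (andE (notE (arrE 2 (.reg 5))) (arrE 3 (.reg 5)))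
      (.seq (searchProg (andE (adjE (.reg 6) (.reg 5))
          (eqE (arrE 2 (.reg 6)) (.bin .add (.reg 4) (.lit 1)))))
        (.ite (.reg 7) (.store (arrAddr 2 (.reg 5)) (.bin .add (.reg 4) (.lit 2))) .skip))
      .skip))

/-- The path is traced back and marked in array `1`. -/
def traceProg (ey : RamExpr) (μ : ℕ) : RamProg :=
  .seq (.assign 8 ey) (.forLoop 4 (.reg 0)
    (.ite (.bin .sub (arrE 2 (.reg 8)) (.lit 1))
      (.seq (searchProg (andE (adjE (.reg 6) (.reg 8))
          (eqE (.bin .add (arrE 2 (.reg 6)) (.lit 1)) (arrE 2 (.reg 8)))))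
        (.seq (.assign 8 (.bin .sub (.reg 7) (.lit 1))) (.store (arrAddr 1 (.reg 8)) (.lit μ))))
      .skip))

/-- Search a shortest path and mark it; its number of vertices is stored in a register. -/
def pathProg (ex ey : RamExpr) (μ c : ℕ) : RamProg :=
  .seq (initProg ex ey μ) (.seq roundsProg (.seq (.assign c (arrE 2 ey))
    (.seq (.assign 3 (notE (notE (.reg c)))) (traceProg ey μ))))

variable {n : ℕ} {G : SimpleGraph (Fin n)} {A : ℕ → Fin n → ℕ} {s : RamState} {B N : ℕ}

/-- The value of the expression is the vertex, and depends on the registers `0` and `1` only. -/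
def IsVertex (s : RamState) (e : RamExpr) (v : Fin n) : Prop :=
  ∀ s' : RamState, s'.reg 0 = s.reg 0 → s'.reg 1 = s.reg 1 → e.eval s' = v

theorem IsVertex.congr {e : RamExpr} {v : Fin n} (h : IsVertex s e v) {s' : RamState}
    (h0 : s'.reg 0 = s.reg 0) (h1 : s'.reg 1 = s.reg 1) : IsVertex s' e v :=
  fun s'' h0' h1' => h s'' (h0'.trans h0) (h1'.trans h1)

theorem Holds.init (h : Holds G A s) (hB : n + 2 ≤ B) (hN : n ≤ N) {ex ey : RamExpr} {x y : Fin n}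
    (hx : IsVertex s ex x) (hy : IsVertex s ey y) (μ : ℕ) :
    Runs B N (initProg ex ey μ) s fun s' => ∃ A', Holds G A' s' ∧ A' 0 = A 0 ∧ A' 1 = A 1 ∧
      (∀ v, A' 3 v ≠ 0 ↔ v ∈ freeSet G (A 1) μ y) ∧ ∀ v, A' 2 v = if v = x then 1 else 0 := by
  refine Runs.mono (Runs.forLoop (K := n) (fun i s' => ∃ A', Holds G A' s' ∧ A' 0 = A 0 ∧
    A' 1 = A 1 ∧ ∀ v : Fin n, (v : ℕ) < i → (A' 3 v ≠ 0 ↔ v ∈ freeSet G (A 1) μ y) ∧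
      A' 2 v = if v = x then 1 else 0) (by omega) hN ?_ ?_ ?_ ?_) ?_
  · simp [RamProg.Writes, writes_searchProg]
  · intro s' hs'
    rw [RamExpr.eval, hs' 0 (by simp [RamProg.writes_forLoop, RamProg.Writes, writes_searchProg]),
      h.size]
  · exact ⟨A, h.setReg (by omega) _, rfl, rfl, by simp⟩
  · rintro i hi s' hr hfr ⟨A', hA, hA0, hA1, hi'⟩
    have f1 : s'.reg 1 = s.reg 1 :=
      hfr 1 (by simp [RamProg.writes_forLoop, RamProg.Writes, writes_searchProg])
    refine Runs.seq (Runs.mono (hA.search (by omega) hN (fun u => G.Adj ⟨i, hi⟩ u ∧ A 1 u ≠ 0 ∧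
      A 1 u ≠ μ) fun t ht hft u hu => ?_) ?_)
    · rw [eval_andE_ne, eval_andE_ne, eval_notE_ne, ← not_ne_iff, eval_eqE_ne,
        ht.eval_adjE (a := .reg 5) (b := .reg 6) (u := ⟨i, hi⟩) (v := u)
          (by simp [RamExpr.eval, hft, hr]) hu, ht.eval_arrE (a := .reg 6) (v := u) hu, hA1]
      rfl
    · rintro t ⟨ht, hres, hft⟩
      have e5 : (RamExpr.reg 5).eval t = (⟨i, hi⟩ : Fin n) := by simp [RamExpr.eval, hft, hr]
      have e0 : t.reg 0 = s.reg 0 := by rw [ht.size, h.size]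
      have e1 : t.reg 1 = s.reg 1 := by rw [hft 1 (by omega) (by omega), f1]
      have key : (RamExpr.bin .add (eqE (.reg 5) ey)
          (andE (notE (arrE 1 (.reg 5))) (notE (.reg 7)))).eval t ≠ 0 ↔
          ⟨i, hi⟩ ∈ freeSet G (A 1) μ y := by
        have h1 : ∀ a b : RamExpr, (RamExpr.bin .add a b).eval t ≠ 0 ↔ a.eval t ≠ 0 ∨ b.eval t ≠ 0 := by
          intro a b
          simp only [RamExpr.eval, RamOp.apply]
          omega
        rw [h1, eval_andE_ne, eval_eqE_ne, eval_notE_ne, eval_notE_ne, ht.eval_arrE e5, e5,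
          hy t e0 e1, hA1, freeSet, Set.mem_ofPred_eq, Fin.val_inj]
        refine or_congr_right (and_congr_right fun _ => ?_)
        change t.reg 7 = 0 ↔ _
        constructor
        · intro h7 u hu hmu
          rcases hres with hres | ⟨u', -, hres⟩
          · by_contra hne
            exact hres.2 u ⟨hu, hmu, hne⟩
          · omega
        · intro hall
          rcases hres with hres | ⟨u', h2, -⟩
          · exact hres.1
          · exact absurd (hall u' h2.1 h2.2.1) h2.2.2
      have hle : (RamExpr.bin .add (eqE (.reg 5) ey)
          (andE (notE (arrE 1 (.reg 5))) (notE (.reg 7)))).eval t ≤ B := by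
        have h1 := eval_eqE_le (s := t) (.reg 5) ey
        have h2 := Nat.mul_le_mul (eval_notE_le (s := t) (arrE 1 (.reg 5)))
          (eval_notE_le (s := t) (.reg 7))
        simp only [andE, RamExpr.eval, RamOp.apply] at h1 h2 ⊢
        omega
      refine Runs.seq (ht.storeArr e5 hle fun t₁ ht₁ hr₁ => ?_)
      have e5' : (RamExpr.reg 5).eval t₁ = (⟨i, hi⟩ : Fin n) := by
        simpa [RamExpr.eval, hr₁] using e5
      have hxe : (eqE (.reg 5) ex).eval t₁ = if (⟨i, hi⟩ : Fin n) = x then 1 else 0 := by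
        rw [eval_eqE, e5', hx t₁ (by rw [hr₁, e0]) (by rw [hr₁, e1])]
        simp only [← Fin.val_inj]
      refine ht₁.storeArr e5' (by rw [hxe]; split_ifs <;> omega) fun t₂ ht₂ _ =>
        ⟨_, ht₂.setReg (by omega) _, ?_, ?_, fun v hv => ?_⟩
      · funext v; simp [setArr, hA0]
      · funext v; simp [setArr, hA1]
      · by_cases hvi : v = ⟨i, hi⟩
        · subst hvi
          refine ⟨?_, ?_⟩
          · rw [← key]
            simp [setArr]
          · simpa [setArr] using hxe
        · have : (v : ℕ) < i := by
            have : (v : ℕ) ≠ i := fun h => hvi (Fin.ext h)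
            omega
          simpa [setArr, hvi] using hi' v this
  · rintro s' ⟨⟨A', h1, h2, h3, h4⟩, -⟩
    exact ⟨A', h1, h2, h3, fun v => (h4 v v.2).1, fun v => (h4 v v.2).2⟩

theorem Holds.round (h : Holds G A s) (hB : n + 2 ≤ B) (hN : n ≤ N) {S : Set (Fin n)}
    (hS : ∀ v, A 3 v ≠ 0 ↔ v ∈ S) {x : Fin n} {d : ℕ} (hd : s.reg 4 = d) (hdn : d < n)
    (hL : IsLevel G S x d (A 2)) :
    Runs B N (.forLoop 5 (.reg 0)
      (.ite (andE (notE (arrE 2 (.reg 5))) (arrE 3 (.reg 5)))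
        (.seq (searchProg (andE (adjE (.reg 6) (.reg 5))
            (eqE (arrE 2 (.reg 6)) (.bin .add (.reg 4) (.lit 1)))))
          (.ite (.reg 7) (.store (arrAddr 2 (.reg 5)) (.bin .add (.reg 4) (.lit 2))) .skip))
        .skip)) s fun s' => ∃ A', Holds G A' s' ∧ A' 0 = A 0 ∧ A' 1 = A 1 ∧ A' 3 = A 3 ∧
      IsLevel G S x (d + 1) (A' 2) := by
  classical
  set f : Fin n → ℕ := fun v =>
    if A 2 v = 0 ∧ v ∈ S ∧ ∃ u, G.Adj u v ∧ A 2 u = d + 1 then d + 2 else A 2 v with hf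
  refine Runs.mono (Runs.forLoop (K := n) (fun i s' => ∃ A', Holds G A' s' ∧ A' 0 = A 0 ∧
    A' 1 = A 1 ∧ A' 3 = A 3 ∧ ∀ v : Fin n, A' 2 v = if (v : ℕ) < i then f v else A 2 v)
    (by omega) hN ?_ ?_ ?_ ?_) ?_
  · simp [RamProg.Writes, writes_searchProg]
  · intro s' hs'
    rw [RamExpr.eval, hs' 0 (by simp [RamProg.writes_forLoop, RamProg.Writes, writes_searchProg]),
      h.size]
  · exact ⟨A, h.setReg (by omega) _, rfl, rfl, rfl, by simp⟩
  · rintro i hi s' hr hfr ⟨A', hA, hA0, hA1, hA3, hA2⟩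
    have f4 : s'.reg 4 = d := by
      rw [hfr 4 (by simp [RamProg.writes_forLoop, RamProg.Writes, writes_searchProg]), hd]
    have e5 : (RamExpr.reg 5).eval s' = (⟨i, hi⟩ : Fin n) := hr
    have hAi : A' 2 ⟨i, hi⟩ = A 2 ⟨i, hi⟩ := by rw [hA2, if_neg (by simp)]
    have hfin : A' 2 ⟨i, hi⟩ = f ⟨i, hi⟩ → ∀ s₁, Holds G A' s₁ → ∃ A'', Holds G A''
        (s₁.setReg 5 (i + 1)) ∧ A'' 0 = A 0 ∧ A'' 1 = A 1 ∧ A'' 3 = A 3 ∧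
        ∀ v : Fin n, A'' 2 v = if (v : ℕ) < i + 1 then f v else A 2 v := by
      intro he s₁ hs₁
      refine ⟨A', hs₁.setReg (by omega) _, hA0, hA1, hA3, fun v => ?_⟩
      by_cases hvi : v = ⟨i, hi⟩
      · subst hvi; rw [he, if_pos (by simp)]
      · have : (v : ℕ) ≠ i := fun h => hvi (Fin.ext h)
        rw [hA2]
        congr 1
        rw [eq_iff_iff]
        omega
    refine Runs.ite (fun hc => ?_) (fun hc => ?_)
    · rw [eval_andE_ne, eval_notE_ne, hA.eval_arrE e5, hA.eval_arrE e5, hAi, hA3, hS] at hc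
      refine Runs.seq (Runs.mono (hA.search (by omega) hN (fun u => G.Adj u ⟨i, hi⟩ ∧
        A 2 u = d + 1) fun t ht hft u hu => ?_) ?_)
      · have hlev : A' 2 u = d + 1 ↔ A 2 u = d + 1 := by
          rw [hA2]
          split_ifs with hui
          · simp only [hf]
            split_ifs with hcc
            · omega
            · rfl
          · rfl
        rw [eval_andE_ne, eval_eqE_ne, ht.eval_adjE (a := .reg 6) (b := .reg 5) (u := u)
          (v := ⟨i, hi⟩) hu (by simp [RamExpr.eval, hft, hr]),
          ht.eval_arrE (a := .reg 6) (v := u) hu, ← hlev]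
        simp [RamExpr.eval, RamOp.apply, hft, f4]
      · rintro t ⟨ht, hres, hft⟩
        have e5' : (RamExpr.reg 5).eval t = (⟨i, hi⟩ : Fin n) := by simp [RamExpr.eval, hft, hr]
        refine Runs.ite (fun h7 => ?_) (fun h7 => Runs.skip (hfin ?_ t ht))
        · rcases hres with hres | ⟨u, hu, -⟩
          · exact absurd hres.1 h7
          · have hval : (RamExpr.bin .add (.reg 4) (.lit 2)).eval t = d + 2 := by
              simp [RamExpr.eval, RamOp.apply, hft, f4]
            refine ht.storeArr e5' (by omega) fun t₁ ht₁ _ => ?_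
            rw [hval] at ht₁
            refine ⟨_, ht₁.setReg (by omega) _, ?_, ?_, ?_, fun v => ?_⟩
            · funext v; simp [setArr, hA0]
            · funext v; simp [setArr, hA1]
            · funext v; simp [setArr, hA3]
            · by_cases hvi : v = ⟨i, hi⟩
              · subst hvi
                simp only [setArr, and_self, if_true, Nat.lt_succ_self, hf]
                rw [if_pos ⟨hc.1, hc.2, u, hu⟩]
              · have : (v : ℕ) ≠ i := fun h => hvi (Fin.ext h)
                simp only [setArr, hvi, and_false, if_false]
                rw [hA2]
                congr 1
                rw [eq_iff_iff]
                omega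
        · rcases hres with hres | ⟨u, -, hu⟩
          · rw [hAi]
            simp only [hf]
            rw [if_neg]
            rintro ⟨-, -, u, hu⟩
            exact hres.2 u hu
          · have : t.reg 7 = 0 := h7
            omega
    · refine Runs.skip (hfin ?_ s' hA)
      rw [hAi]
      simp only [hf]
      rw [if_neg]
      rintro ⟨h1, h2, -⟩
      refine absurd hc ?_
      rw [← ne_eq, eval_andE_ne, eval_notE_ne, hA.eval_arrE e5, hA.eval_arrE e5, hAi, hA3, hS]
      exact ⟨h1, h2⟩
  · rintro s' ⟨⟨A', h1, h2, h3, h4, h5⟩, -⟩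
    refine ⟨A', h1, h2, h3, h4, hL.succ fun v => ?_⟩
    rw [h5, if_pos v.2]
    simp only [hf]
    congr

theorem Holds.rounds (h : Holds G A s) (hB : n + 2 ≤ B) (hN : n ≤ N) {S : Set (Fin n)}
    (hS : ∀ v, A 3 v ≠ 0 ↔ v ∈ S) {x : Fin n} (hx : ∀ v, A 2 v = if v = x then 1 else 0) :
    Runs B N roundsProg s fun s' => ∃ A', Holds G A' s' ∧ A' 0 = A 0 ∧ A' 1 = A 1 ∧
      IsLevel G S x n (A' 2) := by
  refine Runs.mono (Runs.forLoop (K := n) (fun i s' => ∃ A', Holds G A' s' ∧ A' 0 = A 0 ∧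
    A' 1 = A 1 ∧ A' 3 = A 3 ∧ IsLevel G S x i (A' 2)) (by omega) hN ?_ ?_ ?_ ?_) ?_
  · simp [RamProg.writes_forLoop, RamProg.Writes, writes_searchProg]
  · intro s' hs'
    rw [RamExpr.eval, hs' 0 (by simp [RamProg.writes_forLoop, RamProg.Writes, writes_searchProg]),
      h.size]
  · refine ⟨A, h.setReg (by omega) _, rfl, rfl, rfl, isLevel_zero fun v => ?_⟩
    rw [hx]
    congr
  · rintro i hi s' hr hfr ⟨A', hA, hA0, hA1, hA3, hL⟩
    refine (hA.round hB hN (by simpa [hA3] using hS) hr hi hL).mono ?_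
    rintro t ⟨A'', h1, h2, h3, h4, h5⟩
    exact ⟨A'', h1.setReg (by omega) _, h2.trans hA0, h3.trans hA1, h4.trans hA3, h5⟩
  · rintro s' ⟨⟨A', h1, h2, h3, -, h4⟩, -⟩
    exact ⟨A', h1, h2, h3, h4⟩

end PathProgram

/-! ### Tracing the path back, and the complete path search. -/

section PathSearch

variable {n : ℕ} {G : SimpleGraph (Fin n)} {A : ℕ → Fin n → ℕ} {s : RamState} {B N : ℕ}

/-- Every vertex of level at least 2 has a neighbour one level below. Only these predecessors are
marked; `y` bears the mark already. -/
theorem Holds.trace (h : Holds G A s) (hB : n + 2 ≤ B) (hN : n ≤ N) {S : Set (Fin n)}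
    {x y : Fin n} {ey : RamExpr} (hy : IsVertex s ey y) {μ : ℕ} (hμ : μ ≤ B) (hm : A 1 y = μ)
    (hL : IsLevel G S x n (A 2)) :
    Runs B N (traceProg ey μ) s fun s' => ∃ A', Holds G A' s' ∧ A' 0 = A 0 ∧ (A 2 y ≠ 0 →
      ∃ t, Ascends G S (A 2) (x :: t) ∧ (x :: t).getLast? = some y ∧
        ∀ v, A' 1 v = if v ∈ x :: t then μ else A 1 v) := by
  have hyv : ey.eval s = y := hy s rfl rfl
  refine Runs.seq (Runs.assign (by have := y.2; omega) ?_)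
  -- After `i` rounds the level has dropped by `i` or is at most 1. Levels are at most `n + 1`, so
  -- `n` rounds lead to `x`. If `y` has level 0, the truncated subtraction makes every test fail.
  refine Runs.mono (Runs.forLoop (K := n) (fun i s' => ∃ A', Holds G A' s' ∧ A' 0 = A 0 ∧
    A' 2 = A 2 ∧ ∃ u t, s'.reg 8 = (u : Fin n) ∧ Ascends G S (A 2) (u :: t) ∧
      (u :: t).getLast? = some y ∧ (A 2 u ≤ 1 ∨ A 2 u + i = A 2 y) ∧ (A 2 y ≠ 0 → A 2 u ≠ 0) ∧
      ∀ v, A' 1 v = if v ∈ u :: t then μ else A 1 v) (by omega) hN ?_ ?_ ?_ ?_) ?_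
  · simp [RamProg.Writes, writes_searchProg]
  · intro s' hs'
    rw [RamExpr.eval, hs' 0 (by simp [RamProg.writes_forLoop, RamProg.Writes, writes_searchProg]),
      RamState.setReg_reg, if_neg (by omega), h.size]
  · refine ⟨A, (h.setReg (by omega) _).setReg (by omega) _, rfl, rfl, y, [], ?_, ?_, rfl,
      Or.inr rfl, id, fun v => ?_⟩
    · simp [RamState.setReg_reg, hyv]
    · simp [Ascends]
    · split_ifs with hv
      · rw [List.mem_singleton.1 hv, hm]
      · rfl
  · rintro i hi s' hr hfr ⟨A', hA, hA0, hA2, u, t, hu, ht, hl, hlev, hne, hA1⟩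
    have e8 : (RamExpr.reg 8).eval s' = u := hu
    have htest : (RamExpr.bin .sub (arrE 2 (.reg 8)) (.lit 1)).eval s' = A 2 u - 1 := by
      have := hA.eval_arrE e8 2
      simp only [RamExpr.eval, RamOp.apply] at this ⊢
      rw [this, hA2]
    refine Runs.ite (fun hc => ?_) fun hc => ?_
    · rw [htest] at hc
      obtain ⟨k, hk⟩ : ∃ k, A 2 u = k + 2 := ⟨A 2 u - 2, by omega⟩
      obtain ⟨huS, w, hwu, hwk⟩ := hL.pred u k hk
      refine Runs.seq (Runs.mono (hA.search (by omega) hN (fun w => G.Adj w u ∧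
        A 2 w + 1 = A 2 u) fun t' ht' hft w hw => ?_) ?_)
      · have e1 := ht'.eval_arrE (a := .reg 6) (v := w) hw 2
        rw [eval_andE_ne, eval_eqE_ne, ht'.eval_adjE (a := .reg 6) (b := .reg 8) (u := w) (v := u)
          hw (by simp [RamExpr.eval, hft, hu]), ht'.eval_arrE (a := .reg 8) (v := u)
          (by simp [RamExpr.eval, hft, hu])]
        change _ ∧ (arrE 2 (.reg 6)).eval t' + 1 = _ ↔ _
        rw [e1, hA2]
      · rintro t' ⟨ht', hres, hft⟩
        rcases hres with hres | ⟨u', hu', h7⟩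
        · exact absurd ⟨hwu, by omega⟩ (hres.2 w)
        · have hval : (RamExpr.bin .sub (.reg 7) (.lit 1)).eval t' = u' := by
            simp [RamExpr.eval, RamOp.apply, h7]
          refine Runs.seq (Runs.assign (by have := u'.2; omega) ?_)
          refine Holds.storeArr (ht'.setReg (by omega) _) (v := u')
            (by simp [RamExpr.eval, RamOp.apply, h7]) hμ fun t'' ht'' hr'' => ?_
          refine ⟨_, ht''.setReg (by omega) _, ?_, ?_, u', u :: t, ?_, ⟨ht, fun w hw => ?_⟩,
            by simpa using hl, by omega, fun _ => by omega, fun v => ?_⟩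
          · funext v; simp [setArr, hA0]
          · funext v; simp [setArr, hA2]
          · simp [RamState.setReg_reg, hr'', RamExpr.eval, RamOp.apply, h7]
          · simp only [List.head?_cons, Option.some_inj] at hw
            subst hw
            exact ⟨hu'.1, hu'.2.symm, huS⟩
          · by_cases hv : v = u'
            · simp [setArr, hv, RamExpr.eval]
            · simp [setArr, hv, hA1]
    · rw [htest] at hc
      exact Runs.skip ⟨A', hA.setReg (by omega) _, hA0, hA2, u, t,
        by simpa [RamState.setReg_reg] using hu, ht, hl, Or.inl (by omega), hne, hA1⟩
  · rintro s' ⟨⟨A', hA, hA0, hA2, u, t, hu, ht, hl, hlev, hne, hA1⟩, -⟩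
    refine ⟨A', hA, hA0, fun h0 => ?_⟩
    have := hL.le y
    have := hne h0
    obtain rfl := (hL.one_iff u).1 (by omega)
    exact ⟨t, ht, hl, hA1⟩

/-- Levels start from 1, so the level of `y` is the number of vertices of the path. Registers from 9
on are not used by the search itself. -/
theorem Holds.path (h : Holds G A s) (hB : n + 2 ≤ B) (hN : n ≤ N) {x y : Fin n}
    {ex ey : RamExpr} (hx : IsVertex s ex x) (hy : IsVertex s ey y) {μ : ℕ} (hμ : μ ≤ B)
    (hm : A 1 y = μ) {c : ℕ} (hc : 9 ≤ c) :
    Runs B N (pathProg ex ey μ c) s fun s' => ∃ A', Holds G A' s' ∧ A' 0 = A 0 ∧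
      ((s'.reg 3 = 0 ∧ ∀ X, ¬ Connects G (A 1) μ x y X) ∨
        (s'.reg 3 = 1 ∧ ∃ P, Connects G (A 1) μ x y P ∧
          (∀ X, Connects G (A 1) μ x y X → P.length ≤ X.length) ∧ s'.reg c = P.length ∧
          ∀ v, A' 1 v = if v ∈ P then μ else A 1 v)) := by
  refine Runs.seq (Runs.mono (h.init hB hN hx hy μ).frame ?_)
  rintro s₁ ⟨⟨A₁, h1, h10, h11, h13, h12⟩, hf1⟩
  refine Runs.seq (Runs.mono (h1.rounds hB hN h13 h12).frame ?_)
  rintro s₂ ⟨⟨A₂, h2, h20, h21, hL⟩, hf2⟩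
  have hy2 : IsVertex s₂ ey y := hy.congr (by rw [h2.size, h.size]) (by
    rw [hf2 1 (by simp [roundsProg, RamProg.writes_forLoop, RamProg.Writes, writes_searchProg]),
      hf1 1 (by simp [initProg, RamProg.writes_forLoop, RamProg.Writes, writes_searchProg])])
  have hval : (arrE 2 ey).eval s₂ = A₂ 2 y := h2.eval_arrE (hy2 s₂ rfl rfl) 2
  have hle := hL.le y
  refine Runs.seq (Runs.assign (by omega) (Runs.seq (Runs.assign
    ((eval_notE_le _).trans (by omega)) ?_)))
  rw [hval]
  set s₃ := s₂.setReg c (A₂ 2 y) with hs₃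
  have hok : (notE (notE (.reg c))).eval s₃ = if A₂ 2 y = 0 then 0 else 1 := by
    rw [eval_notE, eval_notE]
    simp only [hs₃, RamExpr.eval, RamState.setReg_reg_self]
    split_ifs <;> simp_all
  rw [hok]
  have hA1 : A₂ 1 = A 1 := h21.trans h11
  have h4 : Holds G A₂ (s₃.setReg 3 (if A₂ 2 y = 0 then 0 else 1)) :=
    (h2.setReg (by omega) _).setReg (by omega) _
  have hy4 : IsVertex (s₃.setReg 3 (if A₂ 2 y = 0 then 0 else 1)) ey y := hy2.congr
    (by rw [h4.size, h2.size]) (by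
      simp [hs₃, RamState.setReg_reg, show 1 ≠ c by omega])
  refine Runs.mono (h4.trace hB hN hy4 hμ (by rw [hA1, hm]) hL).frame ?_
  rintro s₅ ⟨⟨A₅, h5, h50, h5t⟩, hf5⟩
  have w : ∀ i, i = 3 ∨ 9 ≤ i → ¬ (traceProg ey μ).Writes i := by
    intro i hi
    simp only [traceProg, RamProg.writes_forLoop, RamProg.Writes, writes_searchProg, or_false]
    omega
  have r3 : s₅.reg 3 = if A₂ 2 y = 0 then 0 else 1 := by
    rw [hf5 3 (w 3 (Or.inl rfl))]; simp
  have rc : s₅.reg c = A₂ 2 y := by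
    rw [hf5 c (w c (Or.inr hc)), RamState.setReg_reg, if_neg (by omega)]; simp [hs₃]
  have hlen : ∀ X, Connects G (A 1) μ x y X → A₂ 2 y ≠ 0 ∧ A₂ 2 y ≤ X.length := fun X hX =>
    IsLevel.le_length (by simpa using hL) hX
  refine ⟨A₅, h5, by rw [h50, h20, h10], ?_⟩
  by_cases h0 : A₂ 2 y = 0
  · left
    rw [r3, if_pos h0]
    exact ⟨rfl, fun X hX => (hlen X hX).1 h0⟩
  · right
    rw [r3, if_neg h0]
    obtain ⟨t, ht1, ht2, ht3⟩ := h5t h0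
    have hP : A₂ 2 y = (x :: t).length := by
      rw [ht1.length ht2, (hL.one_iff x).2 rfl, List.length_cons]
      omega
    refine ⟨rfl, x :: t, ht1.connects hL ht2, fun X hX => hP ▸ (hlen X hX).2, rc.trans hP, ?_⟩
    simpa only [hA1] using ht3

end PathSearch

/-! ### Finding the paths one after another, and the exchange argument. -/

section Stages

variable {V N : Type*} {G : SimpleGraph V} {k : ℕ} {src tgt : Fin k → N} {cor : Fin k → Bool → V}

/-- The corners `v` and `w` of the paths of `f` and `g` have to be adjacent. -/
def CornersJoined (src tgt : Fin k → N) (cor : Fin k → Bool → V) (f g : Fin k) (v w : V) : Prop :=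
  ∃ σ τ, cond σ (tgt f) (src f) = cond τ (tgt g) (src g) ∧ cor f σ = v ∧ cor g τ = w

/-- The corners of different paths are different, and adjacent where they have to be. -/
def GoodCorners (G : SimpleGraph V) (src tgt : Fin k → N) (cor : Fin k → Bool → V) : Prop :=
  ∀ f g, f ≠ g → ∀ σ τ, cor f σ ≠ cor g τ ∧
    (G.Adj (cor f σ) (cor g τ) ↔ CornersJoined src tgt cor f g (cor f σ) (cor g τ))

/-- The first `e` paths with the corners `cor` have been found, and are marked with the numbers
from `1` on; only the corners of the others are marked. -/
structure Stage (G : SimpleGraph V) (src tgt : Fin k → N) (cor : Fin k → Bool → V) (m : V → ℕ)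
    (e : ℕ) (K : Fin k → List V) : Prop where
  mark : ∀ v (f : Fin k), m v = f + 1 ↔ v ∈ K f
  mark_le : ∀ v, m v ≤ k
  joined : ∀ f g, f ≠ g → ∀ v ∈ K f, ∀ w ∈ K g, (G.Adj v w ↔ CornersJoined src tgt cor f g v w)
  done : ∀ f : Fin k, (f : ℕ) < e → IndPath G (K f) ∧ (K f).head? = some (cor f false) ∧
    (K f).getLast? = some (cor f true)
  todo : ∀ f : Fin k, e ≤ (f : ℕ) → K f = [cor f false, cor f true]

variable {m : V → ℕ} {e : ℕ} {K : Fin k → List V}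

theorem Stage.exists_mem (h : Stage G src tgt cor m e K) {v : V} (hv : m v ≠ 0) :
    ∃ f : Fin k, m v = f + 1 ∧ v ∈ K f := by
  have := h.mark_le v
  have he : m v = (⟨m v - 1, by omega⟩ : Fin k) + 1 := by simp; omega
  exact ⟨_, he, (h.mark _ _).1 he⟩

theorem Stage.cor_mem (h : Stage G src tgt cor m e K) (f : Fin k) (σ : Bool) : cor f σ ∈ K f := by
  by_cases hf : (f : ℕ) < e
  · cases σ
    · exact List.mem_of_head? (h.done f hf).2.1
    · exact List.mem_of_getLast? (h.done f hf).2.2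
  · rw [h.todo f (by omega)]
    cases σ <;> simp

/-- Good corners of different paths are distinct, so the mark of a corner determines its path. -/
theorem Stage.of_corners (hc : GoodCorners G src tgt cor)
    (hm : ∀ v, (∃ f : Fin k, (v = cor f false ∨ v = cor f true) ∧ m v = f + 1) ∨
      (m v = 0 ∧ ∀ f, v ≠ cor f false ∧ v ≠ cor f true)) :
    Stage G src tgt cor m 0 fun f => [cor f false, cor f true] := by
  refine ⟨fun v f => ?_, fun v => ?_, fun f g hfg v hv w hw => ?_, fun f hf => by omega,
    fun _ _ => rfl⟩
  · simp only [List.mem_cons, List.not_mem_nil, or_false]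
    constructor
    · intro hv
      rcases hm v with ⟨g, hg, hg'⟩ | ⟨h0, -⟩
      · obtain rfl : f = g := Fin.ext (by omega)
        exact hg
      · omega
    · intro hv
      rcases hm v with ⟨g, hg, hg'⟩ | ⟨-, h0⟩
      · by_cases hfg : f = g
        · rw [hfg]; exact hg'
        · exfalso
          have h1 := fun σ τ => (hc f g hfg σ τ).1
          rcases hv with rfl | rfl <;> rcases hg with hg | hg
          · exact h1 _ _ hg
          · exact h1 _ _ hg
          · exact h1 _ _ hg
          · exact h1 _ _ hg
      · have := h0 f
        tauto
  · rcases hm v with ⟨g, -, hg'⟩ | ⟨h0, -⟩ <;> omega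
  · simp only [List.mem_cons, List.not_mem_nil, or_false] at hv hw
    rcases hv with rfl | rfl <;> rcases hw with rfl | rfl <;> exact (hc f g hfg _ _).2

theorem Stage.lineModel (h : Stage G src tgt cor m k K) : LineModel G src tgt K := by
  refine ⟨fun f => List.ne_nil_of_mem (h.cor_mem f true), fun f => (h.done f f.2).1,
    fun f g hfg v hv w hw => ⟨?_, ?_⟩⟩
  · rintro rfl
    have h1 := (h.mark v f).2 hv
    have h2 := (h.mark v g).2 hw
    exact hfg (Fin.ext (by omega))
  · rw [h.joined f g hfg v hv w hw, (h.done f f.2).2.1, (h.done f f.2).2.2, (h.done g g.2).2.1,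
      (h.done g g.2).2.2]
    simp [CornersJoined, Bool.exists_bool, or_assoc]

/-- Interior vertices of `P` are unmarked and see no marks of other paths, so `P` meets the other
paths only as its corners do. -/
theorem Stage.succ {f : Fin k} (h : Stage G src tgt cor m f K) {P : List V}
    (hP : Connects G m (f + 1) (cor f false) (cor f true) P) {m' : V → ℕ}
    (hm' : (∀ v ∈ P, m' v = f + 1) ∧ ∀ v, v ∉ P → m' v = m v) :
    Stage G src tgt cor m' (f + 1) (Function.update K f P) := by
  have hc : ∀ σ, cor f σ ∈ P := by
    rintro (_ | _)
    · exact List.mem_of_head? hP.head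
    · exact List.mem_of_getLast? hP.last
  have hPm : ∀ v ∈ P, (∃ σ, v = cor f σ) ∨ (m v = 0 ∧ ∀ u, G.Adj v u → m u ≠ 0 → m u = f + 1) := by
    intro v hv
    by_cases h1 : v = cor f false
    · exact Or.inl ⟨_, h1⟩
    by_cases h2 : v = cor f true
    · exact Or.inl ⟨_, h2⟩
    exact Or.inr (hP.free v hv h1 h2)
  have hcf : ∀ σ, m (cor f σ) = f + 1 := fun σ => (h.mark _ _).2 (h.cor_mem f σ)
  have hPK : ∀ v ∈ P, ∀ g, g ≠ f → v ∉ K g := by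
    intro v hv g hgf hvg
    have hvg := (h.mark v g).2 hvg
    rcases hPm v hv with ⟨σ, rfl⟩ | h1
    · rw [hcf] at hvg
      exact hgf (Fin.ext (by omega))
    · omega
  have hPj : ∀ g, g ≠ f → ∀ v ∈ P, ∀ w ∈ K g, (G.Adj v w ↔ CornersJoined src tgt cor f g v w) := by
    intro g hgf v hv w hw
    rcases hPm v hv with ⟨σ, rfl⟩ | ⟨h1, h2⟩
    · exact h.joined f g hgf.symm _ (h.cor_mem f σ) w hw
    · refine iff_of_false (fun hvw => ?_) ?_
      · have hm := (h.mark w g).2 hw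
        have := h2 w hvw (by omega)
        exact hgf (Fin.ext (by omega))
      · rintro ⟨σ, τ, -, rfl, -⟩
        rw [hcf] at h1
        omega
  refine ⟨fun v g => ?_, fun v => ?_, fun g g' hgg v hv w hw => ?_, fun g hg => ?_, fun g hg => ?_⟩
  · by_cases hgf : g = f
    · subst hgf
      rw [Function.update_self]
      by_cases hv : v ∈ P
      · simp [hm'.1 v hv, hv]
      · rw [hm'.2 v hv, h.mark, h.todo g le_rfl]
        simp only [hv, iff_false, List.mem_cons, List.not_mem_nil, or_false]
        rintro (rfl | rfl)
        · exact hv (hc _)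
        · exact hv (hc _)
    · rw [Function.update_of_ne hgf]
      by_cases hv : v ∈ P
      · rw [hm'.1 v hv]
        refine iff_of_false (fun he => hgf (Fin.ext (by omega))) (hPK v hv g hgf)
      · rw [hm'.2 v hv, h.mark]
  · by_cases hv : v ∈ P
    · rw [hm'.1 v hv]; have := f.2; omega
    · rw [hm'.2 v hv]; exact h.mark_le v
  · by_cases hgf : g = f
    · subst hgf
      rw [Function.update_self] at hv
      rw [Function.update_of_ne hgg.symm] at hw
      exact hPj g' hgg.symm v hv w hw
    · rw [Function.update_of_ne hgf] at hv
      by_cases hgf' : g' = f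
      · subst hgf'
        rw [Function.update_self] at hw
        rw [G.adj_comm, hPj g hgf w hw v hv]
        simp only [CornersJoined]
        grind
      · rw [Function.update_of_ne hgf'] at hw
        exact h.joined g g' hgg v hv w hw
  · by_cases hgf : g = f
    · subst hgf
      rw [Function.update_self]
      exact ⟨hP.indPath, hP.head, hP.last⟩
    · rw [Function.update_of_ne hgf]
      have : (g : ℕ) ≠ f := fun he => hgf (Fin.ext he)
      exact h.done g (by omega)
  · have hgf : g ≠ f := by rintro rfl; omega
    rw [Function.update_of_ne hgf]
    exact h.todo g (by omega)

/-- The paths have the corners `cor`. -/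
def HasCorners (cor : Fin k → Bool → V) (X : Fin k → List V) : Prop :=
  ∀ f, (X f).head? = some (cor f false) ∧ (X f).getLast? = some (cor f true)

theorem HasCorners.mem {X : Fin k → List V} (hX : HasCorners cor X) (f : Fin k) (σ : Bool) :
    cor f σ ∈ X f := by
  cases σ
  · exact List.mem_of_head? (hX f).1
  · exact List.mem_of_getLast? (hX f).2

/-- `CornersJoined` speaks of vertices and not of ends, because the two corners of a path with one
vertex coincide. -/
theorem LineModel.adj_iff {X : Fin k → List V} (h : LineModel G src tgt X)
    (hX : HasCorners cor X) {f g : Fin k} (hfg : f ≠ g) {v w : V} (hv : v ∈ X f) (hw : w ∈ X g) :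
    v ≠ w ∧ (G.Adj v w ↔ CornersJoined src tgt cor f g v w) := by
  refine ⟨(h.cross f g hfg v hv w hw).1, ?_⟩
  rw [(h.cross f g hfg v hv w hw).2, (hX f).1, (hX f).2, (hX g).1, (hX g).2]
  simp [CornersJoined, Bool.exists_bool, or_assoc]

theorem LineModel.goodCorners {X : Fin k → List V} (h : LineModel G src tgt X)
    (hX : HasCorners cor X) : GoodCorners G src tgt cor :=
  fun f g hfg σ τ => h.adj_iff hX hfg (hX.mem f σ) (hX.mem g τ)

/-- The path number `f` of a sought configuration that agrees with the paths found so far is a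
candidate for the search; so the search succeeds, with a path that is not longer. -/
theorem Stage.connects {f : Fin k} (h : Stage G src tgt cor m f K) {X : Fin k → List V}
    (hX : LineModel G src tgt X) (hc : HasCorners cor X) (hXK : ∀ g < f, X g = K g) :
    Connects G m (f + 1) (cor f false) (cor f true) (X f) := by
  have hsub : ∀ g, g ≠ f → ∀ v ∈ K g, v ∈ X g := by
    intro g hgf v hv
    by_cases hg : g < f
    · rw [hXK g hg]; exact hv
    · rw [h.todo g (by simpa using hg)] at hv
      simp only [List.mem_cons, List.not_mem_nil, or_false] at hv
      rcases hv with rfl | rfl <;> exact hc.mem _ _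
  refine ⟨hX.indPath f, (hc f).1, (hc f).2, fun v hv h1 h2 => ⟨?_, fun u hvu hu => ?_⟩⟩
  · by_contra h0
    obtain ⟨g, -, hg⟩ := h.exists_mem h0
    by_cases hgf : g = f
    · subst hgf
      rw [h.todo g le_rfl] at hg
      simp [h1, h2] at hg
    · exact (hX.adj_iff hc (Ne.symm hgf) hv (hsub g hgf v hg)).1 rfl
  · obtain ⟨g, hm, hg⟩ := h.exists_mem hu
    by_cases hgf : g = f
    · rw [hm, hgf]
    · obtain ⟨σ, τ, -, h3, -⟩ := (hX.adj_iff hc (Ne.symm hgf) hv (hsub g hgf u hg)).2.1 hvu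
      cases σ
      · exact absurd h3.symm h1
      · exact absurd h3.symm h2

/-- A class of models that is closed under replacing a path by a connecting path that is not
longer. -/
structure IsClosedClass (G : SimpleGraph V) (src tgt : Fin k → N)
    (C : (Fin k → List V) → Prop) : Prop where
  lineModel : ∀ X, C X → LineModel G src tgt X
  update : ∀ X, C X → ∀ (i : Fin k) (P : List V), IndPath G P → P.head? = (X i).head? →
    P.getLast? = (X i).getLast? → P.length ≤ (X i).length →
    (∀ x ∈ P, P.head? ≠ some x → P.getLast? ≠ some x → ∀ j, j ≠ i → ∀ y ∈ X j,
      (X j).head? = some y ∨ (X j).getLast? = some y → ¬ G.Adj x y) → C (Function.update X i P)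

/-- The exchange step: the path found replaces that of the sought configuration, which then agrees
with the findings on one more path. The corners of all paths are marked from the start, so the
interior of `P` avoids their neighbours, as the exchange property demands. -/
theorem Stage.update {C : (Fin k → List V) → Prop} (hC : IsClosedClass G src tgt C) {f : Fin k}
    (h : Stage G src tgt cor m f K) {X : Fin k → List V} (hX : C X) (hc : HasCorners cor X)
    (hXK : ∀ g < f, X g = K g) {P : List V}
    (hP : Connects G m (f + 1) (cor f false) (cor f true) P) (hl : P.length ≤ (X f).length) :
    C (Function.update X f P) ∧ HasCorners cor (Function.update X f P) ∧
      ∀ g : Fin k, (g : ℕ) < f + 1 → Function.update X f P g = Function.update K f P g := by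
  refine ⟨hC.update X hX f P hP.indPath (hP.head.trans (hc f).1.symm)
    (hP.last.trans (hc f).2.symm) hl fun x hx h1 h2 j hj y hy hy' hxy => ?_, fun g => ?_,
    fun g hg => ?_⟩
  · rw [hP.head, Ne, Option.some_inj] at h1
    rw [hP.last, Ne, Option.some_inj] at h2
    have hfree := (hP.free x hx (Ne.symm h1) (Ne.symm h2)).2 y hxy
    have hyK : y ∈ K j := by
      rw [(hc j).1, (hc j).2, Option.some_inj, Option.some_inj] at hy'
      rcases hy' with rfl | rfl <;> exact h.cor_mem _ _
    have hm := (h.mark y j).2 hyK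
    exact hj (Fin.ext (by have := hfree (by omega); omega))
  · by_cases hgf : g = f
    · subst hgf
      rw [Function.update_self]
      exact ⟨hP.head, hP.last⟩
    · rw [Function.update_of_ne hgf]
      exact hc g
  · by_cases hgf : g = f
    · subst hgf; simp
    · rw [Function.update_of_ne hgf, Function.update_of_ne hgf]
      have : (g : ℕ) ≠ f := fun he => hgf (Fin.ext he)
      exact hXK g (Fin.lt_def.2 (by omega))

end Stages

/-! ### Decoding a guess, checking its corners, and writing the output. -/

section Trials

/-- A power of the register `0`. -/
def powE : ℕ → RamExpr
  | 0 => .lit 1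
  | i + 1 => .bin .mul (powE i) (.reg 0)

/-- The corners of the path number `e`: two of the digits of the register `1`. -/
def cornerE (e : ℕ) (σ : Bool) : RamExpr :=
  .bin .sub (.bin .div (.reg 1) (powE (2 * e + cond σ 1 0)))
    (.bin .mul (.bin .div (.bin .div (.reg 1) (powE (2 * e + cond σ 1 0))) (.reg 0)) (.reg 0))

/-- Conjunction. -/
def allE : List RamExpr → RamExpr
  | [] => .lit 1
  | e :: l => andE e (allE l)

/-- Disjunction. -/
def anyE : List RamExpr → RamExpr
  | [] => .lit 0
  | e :: l => .bin .add e (anyE l)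

/-- The register `5` is a corner of the path number `j`. -/
def isCornerE (j : ℕ) : RamExpr :=
  .bin .add (eqE (.reg 5) (cornerE j false)) (eqE (.reg 5) (cornerE j true))

/-- The mark of the vertex in the register `5`. -/
def markE : ℕ → RamExpr
  | 0 => .lit 0
  | j + 1 => .bin .add (.bin .mul (notE (notE (isCornerE j))) (.lit (j + 1)))
      (.bin .mul (notE (isCornerE j)) (markE j))

variable {N : Type*} {k : ℕ}

open Classical in
/-- Test whether two corners have to be adjacent. -/
noncomputable def joinedE (src tgt : Fin k → N) (f g : Fin k) (c d : RamExpr) : RamExpr :=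
  anyE ([false, true].flatMap fun σ => [false, true].map fun τ =>
    if cond σ (tgt f) (src f) = cond τ (tgt g) (src g) then
      andE (eqE (cornerE f σ) c) (eqE (cornerE g τ) d) else .lit 0)

/-- Test the adjacencies of the corners. -/
noncomputable def checkE (src tgt : Fin k → N) : RamExpr :=
  notE (notE (allE ((List.finRange k).flatMap fun f : Fin k =>
    (List.finRange k).flatMap fun g : Fin k =>
    if f = g then [] else [false, true].flatMap fun σ => [false, true].flatMap fun τ =>
      [notE (eqE (cornerE f σ) (cornerE g τ)), eqE (notE (adjE (cornerE f σ) (cornerE g τ)))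
        (notE (joinedE src tgt f g (cornerE f σ) (cornerE g τ)))])))

/-- Test for evenness. -/
def evenE (a : RamExpr) : RamExpr := eqE a (.bin .mul (.bin .div a (.lit 2)) (.lit 2))

variable {n : ℕ} {G : SimpleGraph (Fin n)} {A : ℕ → Fin n → ℕ} {s : RamState} {B M : ℕ}
  {src tgt : Fin k → N} {cor : Fin k → Bool → Fin n}

theorem eval_powE (i : ℕ) : (powE i).eval s = s.reg 0 ^ i := by
  induction i with
  | zero => rfl
  | succ i ih => rw [pow_succ, ← ih]; rfl

/-- The guess in register 1 is a number in base `n`, and the corners are its digits. -/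
theorem eval_cornerE (e : ℕ) (σ : Bool) :
    (cornerE e σ).eval s = s.reg 1 / s.reg 0 ^ (2 * e + cond σ 1 0) % s.reg 0 := by
  simp only [cornerE, RamExpr.eval, RamOp.apply, eval_powE]
  rw [Nat.mod_eq_sub_div_mul]

theorem eval_allE_ne (l : List RamExpr) : (allE l).eval s ≠ 0 ↔ ∀ e ∈ l, e.eval s ≠ 0 := by
  induction l with
  | nil => simp [allE, RamExpr.eval]
  | cons e l ih => rw [allE, eval_andE_ne, ih, List.forall_mem_cons]

theorem eval_anyE_ne (l : List RamExpr) : (anyE l).eval s ≠ 0 ↔ ∃ e ∈ l, e.eval s ≠ 0 := by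
  induction l with
  | nil => simp [anyE, RamExpr.eval]
  | cons e l ih =>
    rw [List.exists_mem_cons_iff, ← ih]
    simp only [anyE, RamExpr.eval, RamOp.apply]
    omega

theorem eval_evenE_ne (a : RamExpr) : (evenE a).eval s ≠ 0 ↔ Even (a.eval s) := by
  rw [evenE, eval_eqE_ne, Nat.even_iff]
  simp only [RamExpr.eval, RamOp.apply]
  omega

theorem eval_isCornerE_ne (hcor : ∀ f σ, IsVertex s (cornerE (f : Fin k) σ) (cor f σ))
    {v : Fin n} (hv : s.reg 5 = v) (f : Fin k) :
    (isCornerE f).eval s ≠ 0 ↔ v = cor f false ∨ v = cor f true := by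
  have h1 := eval_eqE_ne (s := s) (.reg 5) (cornerE f false)
  have h2 := eval_eqE_ne (s := s) (.reg 5) (cornerE f true)
  rw [hcor f _ s rfl rfl] at h1 h2
  simp only [RamExpr.eval, hv, Fin.val_inj] at h1 h2
  rw [← h1, ← h2]
  simp only [isCornerE, RamExpr.eval, RamOp.apply]
  omega

/-- A common corner of several paths gets the mark of the last one. This does no harm, since such a
guess fails the check of the corners. -/
theorem eval_markE (hcor : ∀ f σ, IsVertex s (cornerE (f : Fin k) σ) (cor f σ))
    {v : Fin n} (hv : s.reg 5 = v) (j : ℕ) (hj : j ≤ k) :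
    (∃ f : Fin k, (f : ℕ) < j ∧ (v = cor f false ∨ v = cor f true) ∧ (markE j).eval s = f + 1) ∨
      ((markE j).eval s = 0 ∧ ∀ f : Fin k, (f : ℕ) < j → v ≠ cor f false ∧ v ≠ cor f true) := by
  induction j with
  | zero => exact Or.inr ⟨rfl, by simp⟩
  | succ j ih =>
    have hc := eval_isCornerE_ne hcor hv ⟨j, hj⟩
    have h1 := eval_notE (s := s) (isCornerE j)
    have h2 := eval_notE (s := s) (notE (isCornerE j))
    by_cases h : (isCornerE j).eval s = 0
    · have he : (markE (j + 1)).eval s = (markE j).eval s := by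
        rw [if_pos h] at h1
        rw [h1] at h2
        simp [markE, RamExpr.eval, RamOp.apply, h1, h2]
      rw [he]
      refine (ih (by omega)).imp (fun ⟨f, h1, h2, h3⟩ => ⟨f, by omega, h2, h3⟩) fun ⟨h1, h2⟩ =>
        ⟨h1, fun f hf => ?_⟩
      rcases Nat.lt_succ_iff_lt_or_eq.1 hf with hf | hf
      · exact h2 f hf
      · obtain rfl : f = ⟨j, hj⟩ := Fin.ext hf
        have := hc.not.1 (by simpa using h)
        tauto
    · refine Or.inl ⟨⟨j, hj⟩, by simp, hc.1 h, ?_⟩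
      rw [if_neg h] at h1
      rw [h1] at h2
      simp [markE, RamExpr.eval, RamOp.apply, h1, h2]

theorem eval_joinedE_ne (hcor : ∀ f σ, IsVertex s (cornerE (f : Fin k) σ) (cor f σ)) (f g : Fin k)
    (σ τ : Bool) : (joinedE src tgt f g (cornerE f σ) (cornerE g τ)).eval s ≠ 0 ↔
      CornersJoined src tgt cor f g (cor f σ) (cor g τ) := by
  have hb : ∀ b : Bool, b ∈ [false, true] := by decide
  rw [joinedE, eval_anyE_ne]
  simp only [List.mem_flatMap, List.mem_map, hb, true_and]
  constructor
  · rintro ⟨e, ⟨σ', τ', rfl⟩, he⟩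
    split_ifs at he with hc
    · rw [eval_andE_ne, eval_eqE_ne, eval_eqE_ne, hcor _ _ s rfl rfl, hcor _ _ s rfl rfl,
        hcor _ _ s rfl rfl, hcor _ _ s rfl rfl, Fin.val_inj, Fin.val_inj] at he
      exact ⟨σ', τ', hc, he⟩
    · exact absurd rfl he
  · rintro ⟨σ', τ', hc, he⟩
    refine ⟨_, ⟨σ', τ', rfl⟩, ?_⟩
    rw [if_pos hc, eval_andE_ne, eval_eqE_ne, eval_eqE_ne, hcor _ _ s rfl rfl,
      hcor _ _ s rfl rfl, hcor _ _ s rfl rfl, hcor _ _ s rfl rfl, Fin.val_inj, Fin.val_inj]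
    exact he

/-- The outer double `notE` in `checkE` normalises the value to 0 or 1, as register 3 requires. -/
theorem eval_checkE (h : Holds G A s)
    (hcor : ∀ f σ, IsVertex s (cornerE (f : Fin k) σ) (cor f σ)) :
    ((checkE src tgt).eval s = 0 ∧ ¬ GoodCorners G src tgt cor) ∨
      ((checkE src tgt).eval s = 1 ∧ GoodCorners G src tgt cor) := by
  have key : (checkE src tgt).eval s ≠ 0 ↔ GoodCorners G src tgt cor := by
    have hb : ∀ b : Bool, b ∈ [false, true] := by decide
    have hone : ∀ f g σ τ, (notE (eqE (cornerE (f : Fin k) σ) (cornerE (g : Fin k) τ))).eval s ≠ 0 ↔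
        cor f σ ≠ cor g τ := by
      intro f g σ τ
      rw [eval_notE_ne, ← not_ne_iff, eval_eqE_ne, hcor _ _ s rfl rfl, hcor _ _ s rfl rfl,
        Fin.val_inj]
    have htwo : ∀ (f g : Fin k) σ τ, (eqE (notE (adjE (cornerE f σ) (cornerE g τ)))
        (notE (joinedE src tgt f g (cornerE f σ) (cornerE g τ)))).eval s ≠ 0 ↔
        (G.Adj (cor f σ) (cor g τ) ↔ CornersJoined src tgt cor f g (cor f σ) (cor g τ)) := by
      intro f g σ τ
      rw [eval_eqE_ne, ← h.eval_adjE (hcor f σ s rfl rfl) (hcor g τ s rfl rfl),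
        ← eval_joinedE_ne hcor, eval_notE, eval_notE]
      split_ifs with h1 h2 h2 <;> simp [h1, h2]
    rw [checkE, eval_notE_ne, ← not_ne_iff, eval_notE_ne, ← ne_eq, eval_allE_ne]
    simp only [List.mem_flatMap, List.mem_finRange, true_and]
    constructor
    · intro hall f g hfg σ τ
      rw [← hone, ← htwo]
      constructor
      · refine hall _ ⟨f, g, ?_⟩
        simp only [hfg, if_false, List.mem_flatMap]
        exact ⟨σ, hb σ, τ, hb τ, by simp⟩
      · refine hall _ ⟨f, g, ?_⟩
        simp only [hfg, if_false, List.mem_flatMap]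
        exact ⟨σ, hb σ, τ, hb τ, by simp⟩
    · rintro hgood e ⟨f, g, he⟩
      split_ifs at he with hfg
      · simp at he
      · simp only [List.mem_flatMap] at he
        obtain ⟨σ, -, τ, -, he⟩ := he
        have := hgood f g hfg σ τ
        rw [← hone, ← htwo] at this
        simp only [List.mem_cons, List.not_mem_nil, or_false] at he
        rcases he with rfl | rfl
        · exact this.1
        · exact this.2
  have hle : (checkE src tgt).eval s ≤ 1 := eval_notE_le _
  rw [← key]
  omega

/-- Mark the corners. -/
def markProg (k : ℕ) : RamProg := .forLoop 5 (.reg 0) (.store (arrAddr 1 (.reg 5)) (markE k))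

/-- Search the paths. -/
def searchPaths (k : ℕ) : RamProg :=
  .seqRange (fun e => .ite (.reg 3)
    (pathProg (cornerE e false) (cornerE e true) (e + 1) (9 + e)) .skip) k

/-- Return the marked vertices without those marked `x`, if the paths in `es` are even. -/
def outputProg (es : List (Fin k)) (x : ℕ) : RamProg :=
  .ite (andE (.reg 3) (allE (es.map fun e : Fin k => evenE (.reg (9 + e)))))
    (.seq (.forLoop 5 (.reg 0) (.store (arrAddr 0 (.reg 5)) (notE (.bin .add
      (notE (arrE 1 (.reg 5))) (eqE (arrE 1 (.reg 5)) (.lit x)))))) (.assign 2 (.lit 1))) .skip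

/-- The output so far is correct. -/
def Output (G : SimpleGraph (Fin n)) (A : ℕ → Fin n → ℕ) (s : RamState) : Prop :=
  s.reg 2 = 0 ∨ s.reg 2 = 1 ∧ InducesOddPrism G {v | A 0 v = 1}

/-- A loop that fills an array. -/
theorem Holds.fill (h : Holds G A s) (hB : n + 2 ≤ B) (hN : n ≤ M) {j : ℕ} {e : RamExpr}
    {f : Fin n → ℕ} (hf : ∀ v, f v ≤ B)
    (he : ∀ s' A', Holds G A' s' → (∀ i, i ≠ j → A' i = A i) → (∀ i, i ≠ 5 → s'.reg i = s.reg i) →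
      ∀ v : Fin n, s'.reg 5 = v → e.eval s' = f v) :
    Runs B M (.forLoop 5 (.reg 0) (.store (arrAddr j (.reg 5)) e)) s fun s' =>
      (∃ A', Holds G A' s' ∧ (∀ i, i ≠ j → A' i = A i) ∧ A' j = f) ∧
        ∀ i, i ≠ 5 → s'.reg i = s.reg i := by
  refine Runs.mono (Runs.forLoop (K := n) (fun i s' => ∃ A', Holds G A' s' ∧
    (∀ i, i ≠ j → A' i = A i) ∧ ∀ v : Fin n, (v : ℕ) < i → A' j v = f v) (by omega) hN ?_ ?_ ?_
    ?_) ?_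
  · simp [RamProg.Writes]
  · intro s' hs'
    rw [RamExpr.eval, hs' 0 (by simp [RamProg.writes_forLoop, RamProg.Writes]), h.size]
  · exact ⟨A, h.setReg (by omega) _, fun _ _ => rfl, by simp⟩
  · rintro i hi s' hr hfr ⟨A', hA, hA', hi'⟩
    have hv : e.eval s' = f ⟨i, hi⟩ := he s' A' hA hA' (fun i hi => hfr i (by
      simp [RamProg.writes_forLoop, RamProg.Writes, hi])) _ hr
    refine hA.storeArr (v := ⟨i, hi⟩) hr (by rw [hv]; exact hf _) fun t ht _ =>
      ⟨_, ht.setReg (by omega) _, fun l hl => ?_, fun v hvi => ?_⟩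
    · funext v; simp [setArr, hl, hA' l hl]
    · by_cases hvi' : v = ⟨i, hi⟩
      · subst hvi'; simp [setArr, hv]
      · have : (v : ℕ) ≠ i := fun h => hvi' (Fin.ext h)
        simp only [setArr, hvi', and_false, if_false]
        exact hi' v (by omega)
  · rintro s' ⟨⟨A', h1, h2, h3⟩, hfr⟩
    exact ⟨⟨A', h1, h2, funext fun v => h3 v v.2⟩, fun i hi => hfr i (by
      simp [RamProg.writes_forLoop, RamProg.Writes, hi])⟩

theorem Holds.output (h : Holds G A s) (hB : n + 2 ≤ B) (hN : n ≤ M) (hO : Output G A s)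
    {es : List (Fin k)} {x : ℕ}
    (hp : s.reg 3 ≠ 0 → (∀ e ∈ es, Even (s.reg (9 + e))) →
      InducesOddPrism G {v | A 1 v ≠ 0 ∧ A 1 v ≠ x}) :
    Runs B M (outputProg es x) s fun s' => ∃ A', Holds G A' s' ∧ A' 1 = A 1 ∧ Output G A' s' ∧
      (∀ i, i ≠ 2 → i ≠ 5 → s'.reg i = s.reg i) ∧ (s.reg 2 = 1 → s'.reg 2 = 1) ∧
      (s.reg 3 ≠ 0 → (∀ e ∈ es, Even (s.reg (9 + e))) → s'.reg 2 = 1) := by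
  classical
  have hcond : (andE (.reg 3) (allE (es.map fun e : Fin k => evenE (.reg (9 + e))))).eval s ≠ 0 ↔
      s.reg 3 ≠ 0 ∧ ∀ e ∈ es, Even (s.reg (9 + e)) := by
    rw [eval_andE_ne, eval_allE_ne]
    simp only [List.forall_mem_map, eval_evenE_ne, RamExpr.eval]
  refine Runs.ite (fun hc => ?_) (fun hc => Runs.skip ⟨A, h, rfl, hO, fun _ _ _ => rfl, id,
    fun h1 h2 => absurd hc (hcond.2 ⟨h1, h2⟩)⟩)
  have hc := hcond.1 hc
  refine Runs.seq (Runs.mono (h.fill hB hN (j := 0)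
    (f := fun v => if A 1 v ≠ 0 ∧ A 1 v ≠ x then 1 else 0) (fun v => by split_ifs <;> omega)
    fun s' A' hA' hA hfr v hv => ?_) ?_)
  · have e1 := hA'.eval_arrE (a := .reg 5) (v := v) hv 1
    rw [hA 1 (by omega)] at e1
    have k1 := eval_notE (s := s') (arrE 1 (.reg 5))
    have k2 := eval_eqE (s := s') (arrE 1 (.reg 5)) (.lit x)
    have k3 := eval_notE (s := s') (.bin .add (notE (arrE 1 (.reg 5)))
      (eqE (arrE 1 (.reg 5)) (.lit x)))
    rw [k3]
    have : (RamExpr.bin .add (notE (arrE 1 (.reg 5))) (eqE (arrE 1 (.reg 5)) (.lit x))).eval s' = 0 ↔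
        A 1 v ≠ 0 ∧ A 1 v ≠ x := by
      simp only [RamExpr.eval, RamOp.apply] at k2 ⊢
      rw [k1, k2, e1]
      split_ifs <;> simp_all
    simp only [this]
  · rintro s₁ ⟨⟨A₁, h1, hA₁, hA0⟩, hfr⟩
    refine Runs.assign (by simp only [RamExpr.eval]; omega) ⟨A₁, h1.setReg (by omega) _,
      hA₁ 1 (by omega), Or.inr ⟨by simp [RamExpr.eval], ?_⟩, fun i h2 h5 => ?_, fun _ => by
        simp [RamExpr.eval], fun _ _ => by simp [RamExpr.eval]⟩
    · convert hp hc.1 hc.2 using 3 with v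
      rw [hA0]
      simp
    · rw [RamState.setReg_reg, if_neg h2, hfr i h5]

end Trials

/-! ### A single guess, and the loop over all guesses. -/

section Phases

/-- Search the paths with given corners, and return an odd prism if they contain one. -/
noncomputable def trialProg {N : Type*} {k : ℕ} (src tgt : Fin k → N) (q : ℕ)
    (es : ℕ → List (Fin k)) (x : ℕ → ℕ) : RamProg :=
  .seq (markProg k) (.seq (.assign 3 (checkE src tgt)) (.seq (searchPaths k)
    (.seqRange (fun j => outputProg (es j) (x j)) q)))

variable {N : Type*} {n k : ℕ} {G : SimpleGraph (Fin n)} {A : ℕ → Fin n → ℕ} {s s' : RamState}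
  {B M : ℕ} {src tgt : Fin k → N} {cor : Fin k → Bool → Fin n} {C : (Fin k → List (Fin n)) → Prop}

theorem writes_pathProg {ex ey : RamExpr} {μ c i : ℕ} (h : (pathProg ex ey μ c).Writes i) :
    (3 ≤ i ∧ i ≤ 8) ∨ i = c := by
  simp only [pathProg, initProg, roundsProg, traceProg, RamProg.writes_forLoop, RamProg.Writes,
    writes_searchProg, or_false] at h
  omega

theorem eval_markE_congr (h : s.reg = s'.reg) (j : ℕ) : (markE j).eval s = (markE j).eval s' := by
  induction j with
  | zero => rfl
  | succ j ih =>
    have hc : (isCornerE j).eval s = (isCornerE j).eval s' := by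
      simp only [isCornerE, eqE, RamExpr.eval, eval_cornerE, h]
    simp only [markE, notE, RamExpr.eval, ih, hc]

theorem Holds.mark (h : Holds G A s) (hB : n + k + 2 ≤ B) (hN : n ≤ M)
    (hcor : ∀ f σ, IsVertex s (cornerE (f : Fin k) σ) (cor f σ)) :
    Runs B M (markProg k) s fun s' => ∃ A', Holds G A' s' ∧ A' 0 = A 0 ∧
      (∀ i, i ≠ 5 → s'.reg i = s.reg i) ∧
      ∀ v, (∃ f : Fin k, (v = cor f false ∨ v = cor f true) ∧ A' 1 v = f + 1) ∨
        (A' 1 v = 0 ∧ ∀ f, v ≠ cor f false ∧ v ≠ cor f true) := by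
  have key : ∀ v : Fin n,
      (∃ f : Fin k, (v = cor f false ∨ v = cor f true) ∧ (markE k).eval (s.setReg 5 v) = f + 1) ∨
        ((markE k).eval (s.setReg 5 v) = 0 ∧ ∀ f, v ≠ cor f false ∧ v ≠ cor f true) := by
    intro v
    refine (eval_markE (s := s.setReg 5 v) (fun f σ => (hcor f σ).congr (by simp [RamState.setReg_reg])
      (by simp [RamState.setReg_reg])) (by simp) k le_rfl).imp (fun ⟨f, _, h2⟩ => ⟨f, h2⟩)
      fun ⟨h1, h2⟩ => ⟨h1, fun f => h2 f f.2⟩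
  refine Runs.mono (h.fill (by omega) hN (j := 1) (f := fun v => (markE k).eval (s.setReg 5 v))
    (fun v => ?_) fun s' A' _ _ hfr v hv => eval_markE_congr (funext fun i => ?_) k) ?_
  · rcases key v with ⟨f, -, h2⟩ | ⟨h1, -⟩
    · have := f.2
      omega
    · omega
  · rw [RamState.setReg_reg]
    split_ifs with hi
    · rw [hi, hv]
    · exact hfr i hi
  · rintro s' ⟨⟨A', h1, h2, h3⟩, hfr⟩
    refine ⟨A', h1, h2 0 (by omega), hfr, fun v => ?_⟩
    rw [h3]
    exact key v

/-- The situation after `e` steps of the search of the paths. -/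
def SearchInv (G : SimpleGraph (Fin n)) (src tgt : Fin k → N) (cor : Fin k → Bool → Fin n)
    (C : (Fin k → List (Fin n)) → Prop) (m : Fin n → ℕ) (e : ℕ) (s : RamState) : Prop :=
  (s.reg 3 = 0 ∧ ¬ ∃ X, C X ∧ HasCorners cor X) ∨
    (s.reg 3 = 1 ∧ ∃ K, Stage G src tgt cor m e K ∧
      (∀ f : Fin k, (f : ℕ) < e → s.reg (9 + f) = (K f).length) ∧
      ((∃ X, C X ∧ HasCorners cor X) →
        ∃ X, C X ∧ HasCorners cor X ∧ ∀ f : Fin k, (f : ℕ) < e → X f = K f))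

/-- If a path search fails, no configuration of the class has these corners. If it succeeds, the
exchange step keeps some such configuration in agreement with the paths found, provided there was
one. -/
theorem Holds.searchPaths (h : Holds G A s) (hB : n + k + 2 ≤ B) (hN : n ≤ M)
    (hcor : ∀ f σ, IsVertex s (cornerE (f : Fin k) σ) (cor f σ))
    (hC : IsClosedClass G src tgt C) (h0 : SearchInv G src tgt cor C (A 1) 0 s) :
    Runs B M (searchPaths k) s fun s' => ∃ A', Holds G A' s' ∧ A' 0 = A 0 ∧
      s'.reg 2 = s.reg 2 ∧ SearchInv G src tgt cor C (A' 1) k s' := by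
  refine Runs.mono (Runs.seqRange (fun e s' => ∃ A', Holds G A' s' ∧ A' 0 = A 0 ∧
    s'.reg 1 = s.reg 1 ∧ s'.reg 2 = s.reg 2 ∧ SearchInv G src tgt cor C (A' 1) e s')
    ⟨A, h, rfl, rfl, rfl, h0⟩ ?_) fun s' ⟨A', h1, h2, _, h3, h4⟩ => ⟨A', h1, h2, h3, h4⟩
  rintro j hj s₁ ⟨A₁, h1, h10, r1, r2, hinv⟩
  refine Runs.ite (fun h3 => ?_) fun h3 => Runs.skip ⟨A₁, h1, h10, r1, r2, ?_⟩
  · rcases hinv with ⟨h3', -⟩ | ⟨-, K, hK, hlen, hX⟩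
    · exact absurd h3' h3
    have e0 : s₁.reg 0 = s.reg 0 := by rw [h1.size, h.size]
    set f : Fin k := ⟨j, hj⟩ with hf
    have hm : A₁ 1 (cor f true) = j + 1 := (hK.mark _ f).2 (hK.cor_mem f true)
    refine Runs.mono (h1.path (by omega) hN ((hcor f false).congr e0 r1)
      ((hcor f true).congr e0 r1) (μ := j + 1) (by omega) hm (c := 9 + j) (by omega)).frame ?_
    rintro s₂ ⟨⟨A₂, h2, h20, hres⟩, hfr⟩
    have hfr' : ∀ i, (i < 3 ∨ 9 ≤ i) → i ≠ 9 + j → s₂.reg i = s₁.reg i := fun i hi hij =>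
      hfr i fun hw => by
        have := writes_pathProg hw
        omega
    refine ⟨A₂, h2, h20.trans h10, by rw [hfr' 1 (by omega) (by omega), r1],
      by rw [hfr' 2 (by omega) (by omega), r2], ?_⟩
    rcases hres with ⟨k3, hno⟩ | ⟨k3, P, hP, hshort, hc, hm2⟩
    · refine Or.inl ⟨k3, fun hst => ?_⟩
      obtain ⟨X, hXC, hXc, hXK⟩ := hX hst
      exact hno _ (hK.connects (f := f) (hC.lineModel X hXC) hXc fun g hg => hXK g hg)
    · refine Or.inr ⟨k3, Function.update K f P, hK.succ (f := f) hP ⟨fun v hv => ?_, fun v hv => ?_⟩,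
        fun g hg => ?_, fun hst => ?_⟩
      · rw [hm2, if_pos hv]
      · rw [hm2, if_neg hv]
      · by_cases hgf : g = f
        · subst hgf
          rw [Function.update_self]
          exact hc
        · have : (g : ℕ) ≠ j := fun he => hgf (Fin.ext he)
          rw [Function.update_of_ne hgf, hfr' _ (by omega) (by omega), hlen g (by omega)]
      · obtain ⟨X, hXC, hXc, hXK⟩ := hX hst
        have hXf := hK.connects (f := f) (hC.lineModel X hXC) hXc fun g hg => hXK g hg
        obtain ⟨k1, k2, k4⟩ := hK.update hC (f := f) hXC hXc (fun g hg => hXK g hg) hP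
          (hshort _ hXf)
        exact ⟨_, k1, k2, k4⟩
  · have h3' : s₁.reg 3 = 0 := h3
    rcases hinv with hinv | ⟨h4, -⟩
    · exact Or.inl hinv
    · omega

/-- Soundness needs only that the paths found form a `LineModel`. Completeness uses the class: after
the last path the findings coincide with a member of it, for which one of the parity tests succeeds.
-/
theorem Holds.trial (h : Holds G A s) (hB : n + k + 2 ≤ B) (hN : n ≤ M)
    (hcor : ∀ f σ, IsVertex s (cornerE (f : Fin k) σ) (cor f σ))
    {q : ℕ} {es : ℕ → List (Fin k)} {x : ℕ → ℕ} (hO : Output G A s)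
    (hsound : ∀ K, LineModel G src tgt K → ∀ j < q, (∀ e ∈ es j, Even (K e).length) →
      InducesOddPrism G {v | ∃ f : Fin k, (f : ℕ) + 1 ≠ x j ∧ v ∈ K f})
    (hC : IsClosedClass G src tgt C)
    (hfin : ∀ X, C X → ∃ j < q, ∀ e ∈ es j, Even (X e).length) :
    Runs B M (trialProg src tgt q es x) s fun s' => ∃ A', Holds G A' s' ∧ Output G A' s' ∧
      (s.reg 2 = 1 → s'.reg 2 = 1) ∧ ((∃ X, C X ∧ HasCorners cor X) → s'.reg 2 = 1) := by
  refine Runs.seq (Runs.mono (h.mark hB hN hcor) ?_)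
  rintro s₁ ⟨A₁, h1, h10, hfr1, hm⟩
  have hcor1 : ∀ f σ, IsVertex s₁ (cornerE (f : Fin k) σ) (cor f σ) := fun f σ =>
    (hcor f σ).congr (hfr1 0 (by omega)) (hfr1 1 (by omega))
  have hcheck := eval_checkE (src := src) (tgt := tgt) h1 hcor1
  refine Runs.seq (Runs.assign (by omega) ?_)
  set s₂ := s₁.setReg 3 ((checkE src tgt).eval s₁) with hs₂
  have h2 : Holds G A₁ s₂ := h1.setReg (by omega) _
  have hcor2 : ∀ f σ, IsVertex s₂ (cornerE (f : Fin k) σ) (cor f σ) := fun f σ =>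
    (hcor1 f σ).congr (by simp [hs₂, RamState.setReg_reg]) (by simp [hs₂, RamState.setReg_reg])
  have h0 : SearchInv G src tgt cor C (A₁ 1) 0 s₂ := by
    rcases hcheck with ⟨hc, hbad⟩ | ⟨hc, hgood⟩
    · exact Or.inl ⟨by simp [hs₂, hc], fun ⟨X, hX, hXc⟩ => hbad ((hC.lineModel X hX).goodCorners hXc)⟩
    · exact Or.inr ⟨by simp [hs₂, hc], _, Stage.of_corners hgood hm, by simp,
        fun ⟨X, hX, hXc⟩ => ⟨X, hX, hXc, by simp⟩⟩
  refine Runs.seq (Runs.mono (h2.searchPaths hB hN hcor2 hC h0) ?_)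
  rintro s₃ ⟨A₃, h3, h30, r2, hinv⟩
  have r2' : s₃.reg 2 = s.reg 2 := by
    rw [r2, hs₂, RamState.setReg_reg, if_neg (by omega), hfr1 2 (by omega)]
  have hO3 : Output G A₃ s₃ := by
    unfold Output at hO ⊢
    rw [r2', h30, h10]
    exact hO
  have hp : ∀ j < q, s₃.reg 3 ≠ 0 → (∀ e ∈ es j, Even (s₃.reg (9 + e))) →
      InducesOddPrism G {v | A₃ 1 v ≠ 0 ∧ A₃ 1 v ≠ x j} := by
    intro j hj h3 hev
    rcases hinv with hinv | ⟨-, K, hK, hlen, -⟩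
    · exact absurd hinv.1 h3
    · convert hsound K hK.lineModel j hj (fun e he => by rw [← hlen e e.2]; exact hev e he) using 3
        with v
      constructor
      · rintro ⟨h1, h2⟩
        obtain ⟨f, h4, h5⟩ := hK.exists_mem h1
        exact ⟨f, by omega, h5⟩
      · rintro ⟨f, h1, h2⟩
        have := (hK.mark v f).2 h2
        omega
  refine Runs.mono (Runs.seqRange (fun j s' => ∃ A', Holds G A' s' ∧ A' 1 = A₃ 1 ∧
    Output G A' s' ∧ (∀ i, i ≠ 2 → i ≠ 5 → s'.reg i = s₃.reg i) ∧ (s₃.reg 2 = 1 → s'.reg 2 = 1) ∧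
    ∀ l < j, s₃.reg 3 ≠ 0 → (∀ e ∈ es l, Even (s₃.reg (9 + e))) → s'.reg 2 = 1)
    ⟨A₃, h3, rfl, hO3, fun _ _ _ => rfl, id, by simp⟩ ?_) ?_
  · rintro j hj s₄ ⟨A₄, h4, h41, hO4, hfr4, hst4, hall⟩
    have e3 : s₄.reg 3 = s₃.reg 3 := hfr4 3 (by omega) (by omega)
    have e9 : ∀ e : ℕ, s₄.reg (9 + e) = s₃.reg (9 + e) := fun e => hfr4 _ (by omega) (by omega)
    refine Runs.mono (h4.output (by omega) hN hO4 (es := es j) (x := x j) ?_) ?_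
    · rw [h41, e3]
      simp only [e9]
      exact hp j hj
    · rintro s₅ ⟨A₅, h5, h51, hO5, hfr5, hst5, hdone⟩
      refine ⟨A₅, h5, h51.trans h41, hO5, fun i h2 h5 => (hfr5 i h2 h5).trans (hfr4 i h2 h5),
        fun hh => hst5 (hst4 hh), fun l hl h3 hev => ?_⟩
      rcases Nat.lt_succ_iff_lt_or_eq.1 hl with hl | rfl
      · exact hst5 (hall l hl h3 hev)
      · exact hdone (by rwa [e3]) (by simpa only [e9] using hev)
  · rintro s₄ ⟨A₄, h4, -, hO4, -, hst4, hall⟩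
    refine ⟨A₄, h4, hO4, fun hh => hst4 (r2'.trans hh), fun hst => ?_⟩
    rcases hinv with hinv | ⟨h3, K, hK, hlen, hX⟩
    · exact absurd hst hinv.2
    · obtain ⟨X, hXC, -, hXK⟩ := hX hst
      obtain ⟨j, hj, hev⟩ := hfin X hXC
      refine hall j hj (by omega) fun e he => ?_
      rw [hlen e e.2, ← hXK e e.2]
      exact hev e he

/-- Registers 0 and 1, with `n` and the number of the guess, survive a trial. -/
theorem writes_trialProg {q : ℕ} {es : ℕ → List (Fin k)} {x : ℕ → ℕ} {i : ℕ}
    (h : (trialProg src tgt q es x).Writes i) : 2 ≤ i := by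
  rcases h with h | h | h | h
  · rw [markProg, RamProg.writes_forLoop] at h
    simp only [RamProg.Writes, or_false] at h
    omega
  · simp only [RamProg.Writes] at h
    omega
  · obtain ⟨j, -, h⟩ := RamProg.writes_seqRange h
    rcases h with h | h
    · have := writes_pathProg h
      omega
    · exact h.elim
  · obtain ⟨j, -, h⟩ := RamProg.writes_seqRange h
    simp only [outputProg, RamProg.Writes, RamProg.writes_forLoop, or_false] at h
    omega

/-- The deepest nesting is that of breadth-first search: rounds, vertices, and the search for a
neighbour. -/
theorem depth_trialProg {q : ℕ} {es : ℕ → List (Fin k)} {x : ℕ → ℕ} :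
    (trialProg src tgt q es x).depth ≤ 3 := by
  refine max_le (by decide : 1 ≤ 3) (max_le (Nat.zero_le _) (max_le ?_ ?_))
  · exact RamProg.depth_seqRange fun j => le_of_eq rfl
  · exact RamProg.depth_seqRange fun j => (by decide : 1 ≤ 3)

/-- Try all choices of the corners. -/
noncomputable def phaseProg (src tgt : Fin k → N) (q : ℕ) (es : ℕ → List (Fin k)) (x : ℕ → ℕ) :
    RamProg := .forLoop 1 (powE (2 * k)) (trialProg src tgt q es x)

/-- Every choice of `2 * k` corners occurs as the base-`n` digits of some number below `n ^ (2 *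
k)`. -/
theorem exists_digits (cor : Fin k → Bool → Fin n) : ∃ t < n ^ (2 * k),
    ∀ f σ, (cor f σ : ℕ) = t / n ^ (2 * (f : ℕ) + cond σ 1 0) % n := by
  set d : Fin (2 * k) → Fin n := fun i => cor ⟨i / 2, by omega⟩ (decide ((i : ℕ) % 2 = 1)) with hd
  refine ⟨finFunctionFinEquiv d, (finFunctionFinEquiv d).2, fun f σ => ?_⟩
  have hi : 2 * (f : ℕ) + cond σ 1 0 < 2 * k := by
    cases σ <;> simp
    omega
  have h := congrFun (finFunctionFinEquiv.symm_apply_apply d) ⟨2 * (f : ℕ) + cond σ 1 0, hi⟩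
  have h' := congrArg Fin.val h
  rw [finFunctionFinEquiv_symm_apply_val] at h'
  rw [h', hd]
  congr 1
  have e1 : (⟨(2 * (f : ℕ) + cond σ 1 0) / 2, by omega⟩ : Fin k) = f := by
    apply Fin.ext
    cases σ <;> simp
    omega
  have e2 : decide ((2 * (f : ℕ) + cond σ 1 0) % 2 = 1) = σ := by
    cases σ <;> simp
  simp only [e1, e2]

theorem Holds.phase (h : Holds G A s) (hB : n + k + 2 ≤ B) (hB' : n ^ (2 * k) ≤ B)
    {q : ℕ} {es : ℕ → List (Fin k)} {x : ℕ → ℕ} (hO : Output G A s)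
    (hsound : ∀ K, LineModel G src tgt K → ∀ j < q, (∀ e ∈ es j, Even (K e).length) →
      InducesOddPrism G {v | ∃ f : Fin k, (f : ℕ) + 1 ≠ x j ∧ v ∈ K f})
    (hC : IsClosedClass G src tgt C)
    (hfin : ∀ X, C X → ∃ j < q, ∀ e ∈ es j, Even (X e).length) :
    RunsIn B (2 + (n ^ (2 * k) * ((trialProg src tgt q es x).time n + 4) +
      (n ^ (2 * k) + 1) * ((powE (2 * k)).cost + 3))) (phaseProg src tgt q es x) s fun s' =>
      ∃ A', Holds G A' s' ∧ Output G A' s' ∧ (s.reg 2 = 1 → s'.reg 2 = 1) ∧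
        ((∃ X, C X) → s'.reg 2 = 1) := by
  have hw : ∀ i, i < 2 → ¬ (trialProg src tgt q es x).Writes i := fun i hi hw => by
    have := writes_trialProg hw
    omega
  have hfr0 : ∀ s' : RamState, (∀ i, ¬ (phaseProg src tgt q es x).Writes i → s'.reg i = s.reg i) →
      s'.reg 0 = n := fun s' hs' => by
    rw [hs' 0 fun h => ?_, h.size]
    rcases RamProg.writes_forLoop.1 h with h | h
    · omega
    · exact hw 0 (by omega) h
  refine RunsIn.mono (RunsIn.forLoop (fun i s' => ∃ A', Holds G A' s' ∧ Output G A' s' ∧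
    (s.reg 2 = 1 → s'.reg 2 = 1) ∧ ∀ t < i, ∀ cor : Fin k → Bool → Fin n,
      (∀ f σ, (cor f σ : ℕ) = t / n ^ (2 * (f : ℕ) + cond σ 1 0) % n) →
      (∃ X, C X ∧ HasCorners cor X) → s'.reg 2 = 1) hB' (hw 1 (by omega)) ?_ ?_ ?_) le_rfl ?_
  · intro s' hs'
    rw [eval_powE, hfr0 s' hs']
  · refine ⟨A, h.setReg (by omega) _, ?_, ?_, by simp⟩
    · simpa [Output, RamState.setReg_reg] using hO
    · simp [RamState.setReg_reg]
  · rintro i hi s' hr hfr ⟨A', hA, hO', hst, hall⟩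
    -- For `n = 0` and `k > 0` the loop has no rounds, so a remainder modulo `n` is a vertex.
    have hpos : Fin k → 0 < n := fun f => Nat.pos_of_ne_zero fun h0 => by
      have := f.2
      rw [h0, Nat.zero_pow (by omega)] at hi
      omega
    set cor : Fin k → Bool → Fin n := fun f σ =>
      ⟨i / n ^ (2 * (f : ℕ) + cond σ 1 0) % n, Nat.mod_lt _ (hpos f)⟩ with hcdef
    have hcor : ∀ f σ, IsVertex s' (cornerE (f : Fin k) σ) (cor f σ) := by
      intro f σ t h0 h1
      rw [eval_cornerE, h0, h1, hr, hA.size]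
    refine Runs.mono (hA.trial hB le_rfl hcor hO' hsound hC hfin) ?_
    rintro t ⟨A'', k1, k2, k3, k4⟩
    have r2 : (t.setReg 1 (i + 1)).reg 2 = t.reg 2 := by simp [RamState.setReg_reg]
    refine ⟨A'', k1.setReg (by omega) _, ?_, ?_, ?_⟩
    · unfold Output
      rw [r2]
      exact k2
    · rw [r2]
      exact fun hh => k3 (hst hh)
    · rw [r2]
      intro t' ht' cor' hcor' hst'
      rcases Nat.lt_succ_iff_lt_or_eq.1 ht' with ht' | rfl
      · exact k3 (hall t' ht' cor' hcor' hst')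
      · have : cor' = cor := funext fun f => funext fun σ => Fin.ext (hcor' f σ)
        exact k4 (this ▸ hst')
  · rintro s' ⟨⟨A', k1, k2, k3, k4⟩, -⟩
    refine ⟨A', k1, k2, k3, fun ⟨X, hX⟩ => ?_⟩
    have hM := hC.lineModel X hX
    set cor : Fin k → Bool → Fin n := fun f σ =>
      cond σ ((X f).getLast (hM.ne_nil f)) ((X f).head (hM.ne_nil f)) with hcdef
    obtain ⟨t, ht, hcor⟩ := exists_digits cor
    exact k4 t ht cor hcor ⟨X, hX, fun f => ⟨List.head?_eq_some_head _,
      List.getLast?_eq_some_getLast _⟩⟩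

end Phases

/-! ### The two classes, the whole program and its running time. -/

section Recognition

variable {V : Type*} {G : SimpleGraph V}

theorem IndPath.length_le_one {l : List V} (h : IndPath G l) (he : l.head? = l.getLast?) :
    l.length ≤ 1 := by
  match l, h with
  | [], _ => simp
  | [_], _ => simp
  | x :: y :: t, h =>
    have hl : (x :: y :: t).getLast? = (y :: t).getLast? := by simp
    rw [hl] at he
    exact absurd rfl (h.2 x (List.mem_of_getLast? he.symm)).1

/-- The smallest line graphs of proper subdivisions of `K₄`. -/
def MinimalK4 (G : SimpleGraph V) (X : Fin 6 → List V) : Prop :=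
  LineModel G k4src k4tgt X ∧ 6 < ∑ e, (X e).length ∧
    ∀ L, LineModel G k4src k4tgt L → 6 < ∑ e, (L e).length →
      ∑ e, (X e).length ≤ ∑ e, (L e).length

theorem exists_minimalK4 {L : Fin 6 → List V} (h : LineModel G k4src k4tgt L)
    (h6 : 6 < ∑ e, (L e).length) : ∃ X, MinimalK4 G X := by
  classical
  have hex : ∃ m, ∃ X, LineModel G k4src k4tgt X ∧ 6 < ∑ e, (X e).length ∧
    ∑ e, (X e).length = m := ⟨_, L, h, h6, rfl⟩
  obtain ⟨X, h1, h2, h3⟩ := Nat.find_spec hex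
  exact ⟨X, h1, h2, fun L hL hL6 => h3 ▸ Nat.find_min' hex ⟨L, hL, hL6, rfl⟩⟩

/-- `LineModel.update_k4` gives the exchange, and the total length does not grow; what remains is
that the result still belongs to a proper subdivision. -/
theorem isClosedClass_minimalK4 (hG : ¬ HasOddHole G) :
    IsClosedClass G k4src k4tgt (MinimalK4 G) := by
  refine ⟨fun X hX => hX.1, fun X ⟨h1, h2, h3⟩ i P hP hhead hlast hlen hint => ?_⟩
  have hL := h1.update_k4 hG h3 hP hhead hlast hlen hint
  have hle : ∀ e, (Function.update X i P e).length ≤ (X e).length := by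
    intro e
    by_cases he : e = i
    · subst he; simpa using hlen
    · simp [he]
  have hsum := Finset.sum_le_sum fun e (_ : e ∈ Finset.univ) => hle e
  -- Otherwise all new paths have one vertex. The ends of the old path `i` then coincide, so it has
  -- one vertex too, and `X` was not proper.
  have h6 : 6 < ∑ e, (Function.update X i P e).length := by
    by_contra hcon
    have hone : ∀ e, (Function.update X i P e).length = 1 := by
      have hge : ∀ e ∈ Finset.univ, 1 ≤ (Function.update X i P e).length := fun e _ =>
        List.length_pos_iff.2 (hL.ne_nil e)
      have heq : ∑ _e : Fin 6, 1 = ∑ e, (Function.update X i P e).length := by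
        have := Finset.sum_le_sum hge
        simp only [Finset.sum_const, Finset.card_univ, Fintype.card_fin, smul_eq_mul] at this ⊢
        omega
      exact fun e => ((Finset.sum_eq_sum_iff_of_le hge).1 heq e (Finset.mem_univ e)).symm
    have hX : ∀ e, (X e).length ≤ 1 := by
      intro e
      by_cases he : e = i
      · subst he
        have h1' := hone e
        rw [Function.update_self] at h1'
        obtain ⟨v, rfl⟩ := List.length_eq_one_iff.1 h1'
        exact (h1.indPath e).length_le_one (hhead.symm.trans hlast)
      · have := hone e
        rw [Function.update_of_ne he] at this
        omega
    have := Finset.sum_le_sum fun e (_ : e ∈ Finset.univ) => hX e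
    simp only [Finset.sum_const, Finset.card_univ, Fintype.card_fin, smul_eq_mul] at this
    omega
  exact ⟨hL, h6, fun L hL' hL6 => hsum.trans (h3 L hL' hL6)⟩

/-- The odd prisms of a graph without line graphs of proper subdivisions of `K₄`. -/
def EvenTheta (G : SimpleGraph V) (X : Fin 3 → List V) : Prop :=
  (∀ L, LineModel G k4src k4tgt L → ¬ 6 < ∑ e, (L e).length) ∧ IsTheta G X ∧
    ∀ i, Even (X i).length

/-- The exchange for prisms needs that there is no line graph of a proper subdivision of `K₄`; this
is part of the class, which is simply empty otherwise. The parity is read off from a path that is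
not replaced. -/
theorem isClosedClass_evenTheta (hG : ¬ HasOddHole G) :
    IsClosedClass G (fun _ => false) (fun _ => true) (EvenTheta G) := by
  refine ⟨fun X hX => hX.2.1, fun X ⟨hK, hX, hev⟩ i P hP hhead hlast hlen hint => ?_⟩
  have h2 : ∀ j, 2 ≤ (X j).length := fun j => by
    have h1 := List.length_pos_iff.2 (hX.ne_nil j)
    have h2 := hev j
    grind
  have hT : IsTheta G (Function.update X i P) := hX.update hG hK (h2 i) hP hhead hlast hint
  -- The ends of `P` are those of an induced path with at least two vertices, hence different.
  have hP2 : 2 ≤ P.length := by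
    by_contra hcon
    have hne : P ≠ [] := by simpa using hT.ne_nil i
    have := List.length_pos_iff.2 hne
    obtain ⟨v, rfl⟩ := List.length_eq_one_iff.1 (show P.length = 1 by omega)
    have := (hX.indPath i).length_le_one (hhead.symm.trans hlast)
    have := h2 i
    omega
  have h2' : ∀ j, 2 ≤ (Function.update X i P j).length := by
    intro j
    by_cases hj : j = i
    · subst hj; simpa using hP2
    · simpa [hj] using h2 j
  refine ⟨hK, hT, fun j => ?_⟩
  obtain ⟨l, hl⟩ : ∃ l : Fin 3, l ≠ i := (by decide : ∀ i : Fin 3, ∃ l : Fin 3, l ≠ i) i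
  have h1 := hT.even_add hG h2' j l
  have h3 := hev l
  rw [Function.update_of_ne hl] at h1
  grind

theorem HasOddPrism.exists_isTheta (h : HasOddPrism G) :
    ∃ X, IsTheta G X ∧ ∀ i, Even (X i).length := by
  obtain ⟨-, a, b, P, hP, hodd, -⟩ := h
  refine ⟨_, (formsPrism_iff.1 hP).1, fun i => ?_⟩
  rw [SimpleGraph.Walk.length_support]
  exact (hodd i).add_one

/-- The search for the line graphs of proper subdivisions of `K₄`. -/
noncomputable def k4Phase : RamProg :=
  phaseProg k4src k4tgt 6 (fun j => if h : j < 6 then [⟨j, h⟩] else []) fun j => 6 - j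

/-- The search for the odd prisms. -/
noncomputable def thetaPhase : RamProg :=
  phaseProg (k := 3) (fun _ => false) (fun _ => true) 1 (fun _ => [0, 1, 2]) fun _ => 0

theorem holds_graphInput {n : ℕ} (G : SimpleGraph (Fin n)) :
    Holds G (fun _ _ => 0) (graphInput G) := by
  classical
  refine ⟨by simp [graphInput], fun u v => ?_, fun j v => ?_⟩
  · simp only [graphInput]
    congr 1
    rw [eq_iff_iff]
    constructor
    · rintro ⟨u', v', h, huv⟩
      obtain ⟨h1, rfl⟩ := mul_add_inj h
      rwa [Fin.ext h1]
    · intro h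
      exact ⟨u, v, rfl, h⟩
  · simp only [graphInput]
    rw [if_neg]
    rintro ⟨u, w, h, -⟩
    have h1 : ((u : ℕ) + 1) * n ≤ n * n := Nat.mul_le_mul_right n u.2
    rw [Nat.succ_mul] at h1
    have := w.2
    omega

/-- At most 12 corners and loops of depth 3 give the exponent 15, which leaves room below 20. -/
theorem phase_time_le {N : Type*} {k : ℕ} (hk : k ≤ 6) (src tgt : Fin k → N) (q : ℕ)
    (es : ℕ → List (Fin k)) (x : ℕ → ℕ) : ∃ C, ∀ n, 2 + (n ^ (2 * k) *
      ((trialProg src tgt q es x).time n + 4) + (n ^ (2 * k) + 1) * ((powE (2 * k)).cost + 3)) ≤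
      C * (n + 1) ^ 20 := by
  obtain ⟨C, hC⟩ := (trialProg src tgt q es x).exists_time_le
  set c := (powE (2 * k)).cost + 3
  refine ⟨2 + (C + 4) + 2 * c, fun n => ?_⟩
  have hp : ∀ {i j : ℕ}, i ≤ j → (n + 1) ^ i ≤ (n + 1) ^ j := fun h =>
    Nat.pow_le_pow_right (by omega) h
  have h1 : n ^ (2 * k) ≤ (n + 1) ^ 12 :=
    (Nat.pow_le_pow_left (by omega) _).trans (hp (by omega))
  have h2 : (trialProg src tgt q es x).time n + 4 ≤ (C + 4) * (n + 1) ^ 3 := by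
    have := (hC n).trans (Nat.mul_le_mul_left C (hp depth_trialProg))
    have := hp (show 0 ≤ 3 by omega)
    linarith
  have h3 := Nat.mul_le_mul h1 h2
  have h4 : (n + 1) ^ 12 * ((C + 4) * (n + 1) ^ 3) = (C + 4) * (n + 1) ^ 15 := by ring
  have h5 := Nat.mul_le_mul_left (C + 4) (hp (show 15 ≤ 20 by omega))
  have h6 : (n ^ (2 * k) + 1) * c ≤ (2 * (n + 1) ^ 20) * c := by
    refine Nat.mul_le_mul_right c ?_
    have := hp (show 12 ≤ 20 by omega)
    have := hp (show 0 ≤ 20 by omega)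
    linarith
  have h7 := hp (show 0 ≤ 20 by omega)
  linarith

theorem exists_oddPrism_program :
    ∃ (p : RamProg) (C k : ℕ), ∀ (n : ℕ) (G : SimpleGraph (Fin n)), ¬ HasOddHole G →
      ∃ (s : RamState) (t : ℕ), RamExec (C * (n + 1) ^ k) p (graphInput G) s t ∧
        t ≤ C * (n + 1) ^ 20 ∧ IsOddPrismAnswer G s := by
  set p : RamProg := .seq k4Phase (.seq thetaPhase (.assign 0 (.reg 2))) with hp
  obtain ⟨C₁, t1⟩ := phase_time_le le_rfl k4src k4tgt 6
    (fun j => if h : j < 6 then [⟨j, h⟩] else []) fun j => 6 - j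
  obtain ⟨C₂, t2⟩ := phase_time_le (k := 3) (by omega) (fun _ => false) (fun _ => true) 1
    (fun _ => [0, 1, 2]) fun _ => 0
  obtain ⟨D, l, hneed⟩ := p.exists_need_le
  refine ⟨p, C₁ + C₂ + 2 + D * (9 ^ 12) ^ l, 12 * l, fun n G hG => ?_⟩
  -- Large enough for the number of a guess, below `n ^ 12`, and for all levels, marks and lengths,
  -- which are at most `n + 6 + 2`.
  set B := (n + 8) ^ 12 with hB
  have hB1 : n + 8 ≤ B := Nat.le_self_pow (by omega) _
  have hB2 : ∀ k ≤ 6, n ^ (2 * k) ≤ B := by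
    intro k hk
    calc n ^ (2 * k) ≤ (n + 8) ^ (2 * k) := Nat.pow_le_pow_left (by omega) _
      _ ≤ (n + 8) ^ 12 := Nat.pow_le_pow_right (by omega) (by omega)
  have hW : p.need B ≤ (C₁ + C₂ + 2 + D * (9 ^ 12) ^ l) * (n + 1) ^ (12 * l) := by
    have h1 : B + 1 ≤ (9 * (n + 1)) ^ 12 := by
      have : (n + 8) ^ 12 < (9 * (n + 1)) ^ 12 := Nat.pow_lt_pow_left (by omega) (by omega)
      omega
    calc p.need B ≤ D * (B + 1) ^ l := hneed B
      _ ≤ D * ((9 * (n + 1)) ^ 12) ^ l := Nat.mul_le_mul_left _ (Nat.pow_le_pow_left h1 _)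
      _ = D * (9 ^ 12) ^ l * (n + 1) ^ (12 * l) := by rw [mul_pow, mul_pow, ← pow_mul (n + 1)]; ring
      _ ≤ _ := Nat.mul_le_mul_right _ (by omega)
  have hbdd : (graphInput G).Bdd B := by
    refine ⟨fun i => ?_, fun a => ?_⟩
    · simp only [graphInput]
      split_ifs <;> omega
    · simp only [graphInput]
      split_ifs <;> omega
  have key : RunsIn B (C₁ * (n + 1) ^ 20 + (C₂ * (n + 1) ^ 20 + 2)) p (graphInput G)
      (IsOddPrismAnswer G) := by
    have hO : Output G (fun _ _ => 0) (graphInput G) := Or.inl (by simp [graphInput])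
    refine RunsIn.seq (RunsIn.mono ((holds_graphInput G).phase (C := MinimalK4 G) (by omega)
      (hB2 _ le_rfl) hO ?_ (isClosedClass_minimalK4 hG) ?_) (t1 n) ?_)
    · intro K hK j hj hev
      -- The path opposite to the `j`-th one has the number `5 - j`, hence the mark `6 - j`, which
      -- the output leaves out.
      convert hK.inducesOddPrism_of_even hG (e := ⟨j, hj⟩) (hev ⟨j, hj⟩ (by simp [hj])) using 6
        with v f
      rw [Ne, Ne, Fin.ext_iff, Fin.val_rev]
      simp only
      omega
    · intro X hX
      obtain ⟨e, he⟩ := hX.1.exists_even hG hX.2.1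
      exact ⟨e, e.2, fun f hf => by simp at hf; rwa [hf]⟩
    · rintro s₁ ⟨A₁, h1, hO1, -, hfound1⟩
      refine RunsIn.seq (RunsIn.mono (h1.phase (C := EvenTheta G) (by omega)
        (hB2 _ (by omega)) hO1 ?_ (isClosedClass_evenTheta hG) ?_) (t2 n) ?_)
      · intro K hK j _ hev
        convert IsTheta.inducesOddPrism hK (fun i => hev i (by fin_cases i <;> simp)) using 4
          with v f
        simp
      · exact fun X hX => ⟨0, by omega, fun i _ => hX.2.2 i⟩
      · rintro s₂ ⟨A₂, h2, hO2, hst, hfound2⟩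
        refine RunsIn.mono (Runs.assign (N := 0) ?_ ?_) le_rfl fun _ h => h
        · simp only [RamExpr.eval]
          rcases hO2 with h | h <;> omega
        · have hret : returnedSet n (s₂.setReg 0 (s₂.reg 2)) = {v | A₂ 0 v = 1} := by
            ext v
            have := h2.arr 0 v
            rw [zero_mul, add_zero] at this
            simp [returnedSet, this]
          refine ⟨fun hodd => ?_, fun hno => ?_⟩
          · have hone : s₂.reg 2 = 1 := by
              by_cases hK : ∃ L, LineModel G k4src k4tgt L ∧ 6 < ∑ e, (L e).length
              · obtain ⟨L, hL, h6⟩ := hK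
                exact hst (hfound1 (exists_minimalK4 hL h6))
              · obtain ⟨X, hX, hev⟩ := hodd.exists_isTheta
                exact hfound2 ⟨X, fun L hL h6 => hK ⟨L, hL, h6⟩, hX, hev⟩
            refine ⟨by simpa [RamExpr.eval] using hone, ?_⟩
            change InducesOddPrism G (returnedSet n (s₂.setReg 0 (s₂.reg 2)))
            rw [hret]
            rcases hO2 with h | h
            · omega
            · exact h.2
          · rcases hO2 with h | h
            · simpa [RamExpr.eval] using h
            · exact absurd ⟨_, h.2⟩ hno
  obtain ⟨s, t, h1, h2, -, h3⟩ := key hbdd _ hW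
  refine ⟨s, t, h1, h2.trans ?_, h3⟩
  have : 1 ≤ (n + 1) ^ 20 := Nat.one_le_pow _ _ (by omega)
  have h4 : D * (9 ^ 12) ^ l * (n + 1) ^ 20 ≥ 0 := Nat.zero_le _
  linarith

end Recognition

theorem mainTheorem4 :
    -- (1) an algorithm that, in time O(n ^ 20) and with words of O(log n) bits, decides whether a
    -- graph without odd holes contains an odd prism, and returns one if it does
    (∃ (p : RamProg) (C k : ℕ), ∀ (n : ℕ) (G : SimpleGraph (Fin n)), ¬ HasOddHole G →
      ∃ (s : RamState) (t : ℕ), RamExec (C * (n + 1) ^ k) p (graphInput G) s t ∧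
        t ≤ C * (n + 1) ^ 20 ∧ IsOddPrismAnswer G s) ∧
    -- (2) the line graph of a bipartite subdivision of `K₄` contains an odd prism
    (∀ (W : Type*) (R : SimpleGraph W), IsK4Subdivision R → R.IsBipartite →
      HasOddPrism R.lineGraph) ∧
    -- (3) replacing a path of a prism by a chordless path
    (∀ (V : Type*) (G : SimpleGraph V), ¬ HasOddHole G → ¬ HasLineGraphOfProperK4Subdivision G →
      ∀ (a b : Fin 3 → V) (P : ∀ i : Fin 3, G.Walk (a i) (b i)), FormsPrism G a b P →
      ∀ (i : Fin 3) (Q : G.Walk (a i) (b i)), Q.IsPath → Q.IsChordless →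
      (∀ x ∈ Q.support, x ≠ a i → x ≠ b i → ∀ j, j ≠ i → ¬ G.Adj x (a j) ∧ ¬ G.Adj x (b j)) →
      FormsPrism G a b (Function.update P i Q) ∧
        (((∀ j, Odd (P j).length) ∧ ∀ j, Odd (Function.update P i Q j).length) ∨
          ((∀ j, Even (P j).length) ∧ ∀ j, Even (Function.update P i Q j).length))) := by
  refine ⟨exists_oddPrism_program, fun W R hR hb => hR.hasOddPrism_lineGraph hb,
    fun V G hG hno a b P hP i Q hQ hQc hint => hP.update hG
      (fun L hL h6 => hno (hL.hasLineGraphOfProperK4Subdivision h6)) i Q hQ hQc hint⟩
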